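/- A *curve* $C\subset\mathbb{R}P^2$ is the image of a $C^1$ immersion of a finite disjoint union $\widetilde C$ of circles (the normalization of $C$; the circles are the components of $C$) which is a union of finitely many strictly convex arcs, where an arc is strictly convex if no line meets it in three points. A *flex* of $C$ is a point of $\widetilde C$ at which $C$ passes from one side of its tangent line to the other; a *node* is a point of $\mathbb{R}P^2$ that is the image of two distinct points of $\widetilde C$; a *bitangent* is a line tangent to $C$ at two distinct points of $\widetilde C$. Let $C$ be *generic*: there are no triple points and the two branches at a node have distinct tangents, the tangent at a flex is not tangent to $C$ elsewhere, and no line is tangent to $C$ at three points of $\widetilde C$. Let $L_\infty\subset\mathbb{R}P^2$ be a line to which $C$ is generically transverse: $L_\infty$ is not tangent to $C$, and no bitangent and no tangent at a flex passes through a point of $C\cap L_\infty$. For a line $D$, let $|C\cap D|$ denote the number of points of $\widetilde C$ mapped into $D$ (so an intersection point that is a node of $C$ counts twice, and if $D$ contains no node this is the number of points of $C\cap D$). Let $n(C)$ be the number of nodes, $i(C)$ the number of flexes, $a=|C\cap L_\infty|$, and $\mathscr{T}_\infty(C)$ the set of the tangent lines to $C$ at its points on $L_\infty$. These numbers are finite,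 as are the number of bitangents and $|C\cap T|$ for $T\in\mathscr{T}_\infty(C)$. Each bitangent $D$ is of exactly one of two types in the affine chart $\mathbb{R}P^2\setminus L_\infty\cong\mathbb{R}^2$: *exterior*, if the arcs of $C$ near the two tangency points lie on the same side of $D$, or *interior*, if they lie on opposite sides. Let $\sigma(C)$ be the number of exterior bitangents minus the number of interior ones. Then $$\sigma(C)=n(C)+\frac{i(C)}{2}+\frac{a(a-2)}{2}-\sum_{T\in\mathscr{T}_\infty(C)}\bigl(|C\cap T|-1\bigr).$$ -/

import Mathlib

open scoped LinearAlgebra.Projectivization Matrix Topology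

noncomputable section

namespace FabriciusBjerre

/-- The real projective plane. -/
abbrev Plane := ℙ ℝ (Fin 3 → ℝ)

/-- Lines of the real projective plane, as points of the dual plane: the class of a nonzero covector `d`
stands for the line `{x | d ⬝ᵥ x = 0}`. -/
abbrev Line := ℙ ℝ (Fin 3 → ℝ)

/-- Incidence: the point `x` lies on the line `D`. -/
def OnLine (x : Plane) (D : Line) : Prop := Projectivization.orthogonal D x

/-- The arc `g` over `[a, b]` (in homogeneous coordinates) is strictly convex: no line meets it in three points,
that is, the points at any three distinct parameters are not collinear. -/
def StrictlyConvexArc (g : ℝ → Fin 3 → ℝ) (a b : ℝ) : Prop :=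
  ∀ r ∈ Set.Icc a b, ∀ s ∈ Set.Icc a b, ∀ t ∈ Set.Icc a b, r < s → s < t →
    (Matrix.of ![g r, g s, g t]).det ≠ 0

/-- A closed immersed `C^1` curve `ℝ/ℤ → ℝP²` which is the union of finitely many strictly convex arcs, given in
homogeneous coordinates. Since `S² → ℝP²` is a covering, each closed `C^1` curve in `ℝP²` has a `C^1` lift to
`ℝ³ \ {0}` defined on `ℝ` that closes up to a sign (the sign is `-1` when the curve is one-sided). The curve is an
immersion exactly if the lift and its derivative are everywhere linearly independent. -/
structure ClosedCurve where
  lift : ℝ → Fin 3 → ℝ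
  contDiff : ContDiff ℝ 1 lift
  immersed : ∀ t, LinearIndependent ℝ ![lift t, deriv lift t]
  closed : ∃ ε : ℝ, (ε = 1 ∨ ε = -1) ∧ ∀ t, lift (t + 1) = ε • lift t
  convexArcs : ∃ (m : ℕ) (τ : Fin (m + 1) → ℝ), StrictMono τ ∧ τ 0 = 0 ∧ τ (Fin.last m) = 1 ∧
    ∀ k : Fin m, StrictlyConvexArc lift (τ k.castSucc) (τ k.succ)

namespace ClosedCurve

variable (c : ClosedCurve)

theorem lift_ne_zero (t : ℝ) : c.lift t ≠ 0 := (c.immersed t).ne_zero 0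

theorem cross_ne_zero (t : ℝ) : crossProduct (c.lift t) (deriv c.lift t) ≠ 0 :=
  crossProduct_ne_zero_iff_linearIndependent.2 (c.immersed t)

/-- The point of the projective plane at the parameter `t`. -/
def point (t : ℝ) : Plane := Projectivization.mk ℝ (c.lift t) (c.lift_ne_zero t)

/-- The tangent line at the parameter `t`: the line spanned by the lift and its derivative. -/
def tangent (t : ℝ) : Line :=
  Projectivization.mk ℝ (crossProduct (c.lift t) (deriv c.lift t)) (c.cross_ne_zero t)

/-- The curve has a flex at `t`: it passes there from one side of its tangent line to the other. -/
def IsFlex (t : ℝ) : Prop :=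
  ∀ᶠ r in 𝓝[<] t, ∀ᶠ s in 𝓝[>] t,
    ((c.tangent t).rep ⬝ᵥ c.lift r) * ((c.tangent t).rep ⬝ᵥ c.lift s) < 0

end ClosedCurve

/-- An affine equation of the line `D` in the affine chart `ℝP² \ L`, as a function of homogeneous coordinates;
its sign distinguishes the two sides of `D` in the chart. -/
def affineEq (L D : Line) (x : Fin 3 → ℝ) : ℝ := (D.rep ⬝ᵥ x) / (L.rep ⬝ᵥ x)

/-- The chosen affine equation of `D` in `ℝP² \ L` is positive on the curve near (but not at) the parameter `t`. -/
def PositiveNear (L D : Line) (c : ClosedCurve) (t : ℝ) : Prop :=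
  ∀ᶠ u in 𝓝[≠] t, 0 < affineEq L D (c.lift u)

/-- The chosen affine equation of `D` in `ℝP² \ L` is negative on the curve near (but not at) the parameter `t`. -/
def NegativeNear (L D : Line) (c : ClosedCurve) (t : ℝ) : Prop :=
  ∀ᶠ u in 𝓝[≠] t, affineEq L D (c.lift u) < 0

section Curve

/-! A curve is a finite family `C` of closed curves, its components. Its normalization is the disjoint union of
circles `ℝ/ℤ`, one for each component, each represented by its fundamental domain `[0, 1)`. -/

variable {ι : Type*} (C : ι → ClosedCurve)

/-- The normalization of a curve with components indexed by `ι`. -/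
def normalization (ι : Type*) : Set (ι × ℝ) := {p | p.2 ∈ Set.Ico (0 : ℝ) 1}

/-- The image in the projective plane of a point of the normalization. -/
def pointAt (p : ι × ℝ) : Plane := (C p.1).point p.2

/-- The tangent line of the curve at a point of the normalization. -/
def tangentAt (p : ι × ℝ) : Line := (C p.1).tangent p.2

/-- The flexes of the curve, as points of the normalization. -/
def flexes : Set (ι × ℝ) := {p ∈ normalization ι | (C p.1).IsFlex p.2}

/-- The nodes (double points, self-intersections) of the curve, as points of the plane. -/
def nodes : Set Plane :=
  {x | ∃ p ∈ normalization ι, ∃ q ∈ normalization ι, p ≠ q ∧ pointAt C p = x ∧ pointAt C q = x}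

/-- The bitangents of the curve: the lines tangent to it at two points. -/
def bitangents : Set Line :=
  {D | ∃ p ∈ normalization ι, ∃ q ∈ normalization ι, p ≠ q ∧ tangentAt C p = D ∧ tangentAt C q = D}

/-- The exterior bitangents (type `T`): in the chart `ℝP² \ L`, the arcs of the curve near the two tangency points
lie on the same side of the line. -/
def exteriorBitangents (L : Line) : Set Line :=
  {D | ∃ p ∈ normalization ι, ∃ q ∈ normalization ι, p ≠ q ∧ tangentAt C p = D ∧ tangentAt C q = D ∧
    ((PositiveNear L D (C p.1) p.2 ∧ PositiveNear L D (C q.1) q.2) ∨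
      (NegativeNear L D (C p.1) p.2 ∧ NegativeNear L D (C q.1) q.2))}

/-- The interior bitangents (type `S`): in the chart `ℝP² \ L`, the arcs of the curve near the two tangency points
lie on opposite sides of the line. -/
def interiorBitangents (L : Line) : Set Line :=
  {D | ∃ p ∈ normalization ι, ∃ q ∈ normalization ι, p ≠ q ∧ tangentAt C p = D ∧ tangentAt C q = D ∧
    PositiveNear L D (C p.1) p.2 ∧ NegativeNear L D (C q.1) q.2}

/-- The Fabricius-Bjerre signed count of bitangents with respect to the affine chart `ℝP² \ L`. -/
def signedCount (L : Line) : ℤ :=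
  ((exteriorBitangents C L).ncard : ℤ) - ((interiorBitangents C L).ncard : ℤ)

/-- The intersection of the curve with a line, as a set of points of the normalization: an intersection point which
is a node of the curve contributes one element for each of the two branches. -/
def inter (D : Line) : Set (ι × ℝ) := {p ∈ normalization ι | OnLine (pointAt C p) D}

/-- The set of tangents to the curve at its points on the line `L`. -/
def tangentsAtInfinity (L : Line) : Set Line := {T | ∃ p ∈ inter C L, tangentAt C p = T}

/-- Genericity of the curve. -/
structure IsGeneric : Prop where
  /-- At a double point, the two branches are transverse. -/
  node_transverse : ∀ p ∈ normalization ι, ∀ q ∈ normalization ι, p ≠ q →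
    pointAt C p = pointAt C q → tangentAt C p ≠ tangentAt C q
  /-- There is no triple point. -/
  no_triple_point : ∀ p ∈ normalization ι, ∀ q ∈ normalization ι, ∀ r ∈ normalization ι,
    p ≠ q → p ≠ r → q ≠ r → pointAt C p = pointAt C q → pointAt C p ≠ pointAt C r
  /-- The tangent at a flex is not tangent elsewhere. -/
  flex_tangent : ∀ p ∈ flexes C, ∀ q ∈ normalization ι, p ≠ q → tangentAt C p ≠ tangentAt C q
  /-- A double tangent has only two tangency points. -/
  no_triple_tangent : ∀ p ∈ normalization ι, ∀ q ∈ normalization ι, ∀ r ∈ normalization ι,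
    p ≠ q → p ≠ r → q ≠ r → tangentAt C p = tangentAt C q → tangentAt C p ≠ tangentAt C r

/-- The curve is generically transverse to the line `L`. -/
structure IsGenericallyTransverse (L : Line) : Prop where
  /-- The curve is transverse to `L`. -/
  transverse : ∀ p ∈ inter C L, tangentAt C p ≠ L
  /-- No bitangent passes through a point of the curve on `L`. -/
  bitangent : ∀ p ∈ inter C L, ∀ D ∈ bitangents C, ¬ OnLine (pointAt C p) D
  /-- No tangent at a flex passes through a point of the curve on `L`. -/
  flex : ∀ p ∈ inter C L, ∀ q ∈ flexes C, ¬ OnLine (pointAt C p) (tangentAt C q)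

end Curve

end FabriciusBjerre

end

/-!
The proof lets a tangent roll along the curve. In the chart in which `L` is the line at infinity, the point of
tangency divides the tangent at `p` into a forward and a backward half. Let `f p` be the number of points of the
curve on the forward half minus the number on the backward half (`ClosedCurve.halfSign` is the sign with which a
point is counted). Along each component `f` is a periodic step function, so its jumps add up to zero
(`sum_jump_component`, from `sum_jumps_circle`). Each jump is caused by a point `q` of the tangent at `p`, and
its value is `jump`:

* at a flex (`q = p`) the jump is `-2`, since a point of the curve passes through the point of tangency from
  the forward to the backward half (`ClosedCurve.local_flex`); at a node the same happens with the other
  branch (`ClosedCurve.localContribution_node`), once for each of the two branches;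
* at a bitangent two points appear or disappear; taking both points of tangency into account, an exterior
  bitangent contributes `4` and an interior one `-4` (`ClosedCurve.localContribution_bitangent`);
* when the point of tangency passes through infinity, every other point of the tangent changes from the backward
  to the forward half (`ClosedCurve.localContribution_tangency_at_infinity`), which contributes
  `2 (|C ∩ T| - 1)` for each tangent `T` at infinity;
* when a point `q` of the tangent passes through infinity, it changes its half in a direction that depends on the
  side of the tangent on which the curve lies (`asymptoteSign`,
  `ClosedCurve.localContribution_point_at_infinity`).

For a fixed point `q` at infinity, the sum of the contributions of the last kind is `2 (|C ∩ T| + 1 - a)`, where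
`T` is the tangent at `q`. Indeed, let a line turn about `q` from `L` to `T`, in either direction. The number of
its intersections with the curve is `a` at the beginning and `|C ∩ T| + 1` just before the end, where two
intersections merge at the point of tangency; in between it changes by `±2` exactly when the line is tangent to
the curve at a point not on `L` (`sum_pencil_jumps`, `sum_asymptoteSign`). Adding everything up gives
`count_identity`, which is the formula.

The local analysis needs only first derivatives and strict convexity of the arcs. The basic fact is that on each
side of a parameter the curve lies strictly on one side of all its tangents (`ClosedCurve.exists_side`); it
implies that the tangents on either side of a given one turn to a definite side of it
(`ClosedCurve.tangent_family`), that a line meets a short piece of the curve without flexes in at most two points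
(`ClosedCurve.no_three_zeros`), and that flexes, bitangents and the other exceptional tangents are isolated
(`finite_irregular`).
-/

section

open Filter Set

namespace FabriciusBjerre

/-! ### Vectors in three-space -/

theorem hasDerivAt_dotProduct (d : Fin 3 → ℝ) {g : ℝ → Fin 3 → ℝ} {g' : Fin 3 → ℝ} {t : ℝ}
    (hg : HasDerivAt g g' t) : HasDerivAt (fun u => d ⬝ᵥ g u) (d ⬝ᵥ g') t := by
  have h := hasDerivAt_pi.1 hg
  simp only [dotProduct, Fin.sum_univ_three]
  exact (((h 0).const_mul _).add ((h 1).const_mul _)).add ((h 2).const_mul _)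

theorem tendsto_dotProduct {α : Type*} {F : Filter α} {f g : α → Fin 3 → ℝ} {a b : Fin 3 → ℝ}
    (hf : Tendsto f F (𝓝 a)) (hg : Tendsto g F (𝓝 b)) :
    Tendsto (fun x => f x ⬝ᵥ g x) F (𝓝 (a ⬝ᵥ b)) :=
  ((continuous_fst.dotProduct continuous_snd).tendsto (a, b)).comp (hf.prodMk_nhds hg)

theorem continuous_cross : Continuous fun x : (Fin 3 → ℝ) × (Fin 3 → ℝ) => crossProduct x.1 x.2 := by
  refine continuous_pi fun i => ?_
  fin_cases i <;> simp [cross_apply] <;> fun_prop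

theorem tendsto_cross {α : Type*} {F : Filter α} {f g : α → Fin 3 → ℝ} {a b : Fin 3 → ℝ}
    (hf : Tendsto f F (𝓝 a)) (hg : Tendsto g F (𝓝 b)) :
    Tendsto (fun x => crossProduct (f x) (g x)) F (𝓝 (crossProduct a b)) :=
  (continuous_cross.tendsto (a, b)).comp (hf.prodMk_nhds hg)

theorem dot_self_pos {v : Fin 3 → ℝ} (hv : v ≠ 0) : 0 < v ⬝ᵥ v := by
  refine lt_of_le_of_ne ?_ (Ne.symm (by simpa using hv))
  simp only [dotProduct, Fin.sum_univ_three]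
  nlinarith [mul_self_nonneg (v 0), mul_self_nonneg (v 1), mul_self_nonneg (v 2)]

/-- A covector which vanishes on `a` and `b` is a multiple of `a × b`. -/
theorem smul_cross_of_dot_eq_zero {a b d : Fin 3 → ℝ} (hab : crossProduct a b ≠ 0)
    (ha : d ⬝ᵥ a = 0) (hb : d ⬝ᵥ b = 0) :
    d = ((d ⬝ᵥ crossProduct a b) / (crossProduct a b ⬝ᵥ crossProduct a b)) • crossProduct a b := by
  have hn := (dot_self_pos hab).ne'
  have key : (crossProduct a b ⬝ᵥ crossProduct a b) • d = (d ⬝ᵥ crossProduct a b) • crossProduct a b := by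
    have e := cross_cross_eq_smul_sub_smul' d a b
    have e0 : crossProduct d (crossProduct a b) = 0 := by
      rw [e, dotProduct_comm a d, ha, hb]; simp
    have e1 := cross_cross_eq_smul_sub_smul' (crossProduct a b) d (crossProduct a b)
    rw [e0] at e1
    simp only [map_zero] at e1
    rw [← sub_eq_zero, ← e1]
  rw [div_eq_inv_mul, mul_smul, ← key, smul_smul, inv_mul_cancel₀ hn, one_smul]

/-- The value on `w` of the line through `a` and `b`, in the coordinates dual to the basis `P, V, P × V`. -/
theorem frame_det (P V a b w : Fin 3 → ℝ) :
    let T := crossProduct P V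
    let A := crossProduct V T
    let B := crossProduct T P
    (T ⬝ᵥ T) ^ 2 * (crossProduct a b ⬝ᵥ w) =
      (T ⬝ᵥ w) * ((A ⬝ᵥ a) * (B ⬝ᵥ b) - (B ⬝ᵥ a) * (A ⬝ᵥ b))
      - (B ⬝ᵥ w) * ((A ⬝ᵥ a) * (T ⬝ᵥ b) - (T ⬝ᵥ a) * (A ⬝ᵥ b))
      + (A ⬝ᵥ w) * ((B ⬝ᵥ a) * (T ⬝ᵥ b) - (T ⬝ᵥ a) * (B ⬝ᵥ b)) := by
  simp [cross_apply, dotProduct, Fin.sum_univ_three]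
  ring

namespace ClosedCurve

/-- The covector `γ × γ'` of the tangent line at the parameter `t`. -/
noncomputable def tvec (c : ClosedCurve) (t : ℝ) : Fin 3 → ℝ := crossProduct (c.lift t) (deriv c.lift t)

variable (c : ClosedCurve)

theorem tvec_ne_zero (t : ℝ) : c.tvec t ≠ 0 := c.cross_ne_zero t

theorem hasDerivAt_lift (t : ℝ) : HasDerivAt c.lift (deriv c.lift t) t :=
  (c.contDiff.differentiable one_ne_zero t).hasDerivAt

theorem continuous_lift : Continuous c.lift := c.contDiff.continuous

theorem continuous_deriv_lift : Continuous (deriv c.lift) := c.contDiff.continuous_deriv le_rfl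

theorem continuous_tvec : Continuous c.tvec :=
  continuous_cross.comp (c.continuous_lift.prodMk c.continuous_deriv_lift)

theorem tvec_dot_lift (t : ℝ) : c.tvec t ⬝ᵥ c.lift t = 0 := by
  rw [tvec, dotProduct_comm, dot_self_cross]

theorem tvec_dot_deriv (t : ℝ) : c.tvec t ⬝ᵥ deriv c.lift t = 0 := by
  rw [tvec, dotProduct_comm, dot_cross_self]

theorem hasDerivAt_dot (d : Fin 3 → ℝ) (t : ℝ) :
    HasDerivAt (fun u => d ⬝ᵥ c.lift u) (d ⬝ᵥ deriv c.lift t) t :=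
  hasDerivAt_dotProduct d (c.hasDerivAt_lift t)

theorem eq_smul_tvec {d : Fin 3 → ℝ} {t : ℝ} (h : d ⬝ᵥ c.lift t = 0) (h' : d ⬝ᵥ deriv c.lift t = 0) :
    d = ((d ⬝ᵥ c.tvec t) / (c.tvec t ⬝ᵥ c.tvec t)) • c.tvec t :=
  smul_cross_of_dot_eq_zero (c.cross_ne_zero t) h h'

theorem exists_sign : ∃ ε : ℝ, ε * ε = 1 ∧ ∀ t, c.lift (t + 1) = ε • c.lift t ∧
    deriv c.lift (t + 1) = ε • deriv c.lift t := by
  obtain ⟨ε, hε, h⟩ := c.closed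
  refine ⟨ε, by rcases hε with rfl | rfl <;> norm_num, fun t => ⟨h t, ?_⟩⟩
  rw [← deriv_comp_add_const]
  have : (fun x => c.lift (x + 1)) = fun x => ε • c.lift x := funext h
  rw [this]
  exact deriv_fun_const_smul ε (c.contDiff.differentiable one_ne_zero t)

theorem tvec_add_one (t : ℝ) : c.tvec (t + 1) = c.tvec t := by
  obtain ⟨ε, hε, h⟩ := c.exists_sign
  rw [tvec, (h t).1, (h t).2, tvec]
  simp [smul_smul, hε]

theorem exists_sign_int (n : ℤ) : ∃ ε : ℝ, ε * ε = 1 ∧ ∀ t, c.lift (t + n) = ε • c.lift t ∧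
    deriv c.lift (t + n) = ε • deriv c.lift t := by
  obtain ⟨ε, hε, h⟩ := c.exists_sign
  induction n using Int.induction_on with
  | zero => exact ⟨1, by norm_num, by simp⟩
  | succ n ih =>
    obtain ⟨η, hη, k⟩ := ih
    refine ⟨ε * η, by rw [mul_mul_mul_comm, hε, hη, one_mul], fun t => ?_⟩
    have e : t + ((n : ℤ) + 1 : ℤ) = t + (n : ℤ) + 1 := by push_cast; ring
    rw [e, (h _).1, (h _).2, (k t).1, (k t).2, smul_smul, smul_smul]
    exact ⟨rfl, rfl⟩
  | pred n ih =>
    obtain ⟨η, hη, k⟩ := ih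
    refine ⟨ε * η, by rw [mul_mul_mul_comm, hε, hη, one_mul], fun t => ?_⟩
    have e : t + (-(n : ℤ) - 1 : ℤ) + 1 = t + (-(n : ℤ) : ℤ) := by push_cast; ring
    have h1 := h (t + (-(n : ℤ) - 1 : ℤ))
    rw [e, (k t).1, (k t).2] at h1
    rw [mul_smul, h1.1, mul_smul, h1.2, smul_smul, smul_smul, hε, one_smul, one_smul]
    exact ⟨rfl, rfl⟩

/-! ### Convex arcs -/

theorem exists_arc_of_mem {t : ℝ} (ht : t ∈ Ico (0 : ℝ) 1) :
    ∃ b, t < b ∧ StrictlyConvexArc c.lift t b := by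
  obtain ⟨m, τ, hτ, h0, h1, h⟩ := c.convexArcs
  have : ∀ k : Fin (m + 1), t < τ k → ∃ b, t < b ∧ StrictlyConvexArc c.lift t b := by
    intro k
    induction k using Fin.induction with
    | zero => intro hk; rw [h0] at hk; exact absurd ht.1 (not_le.2 hk)
    | succ k ih =>
      intro hk
      by_cases hk' : t < τ k.castSucc
      · exact ih hk'
      · refine ⟨τ k.succ, hk, fun r hr s hs u hu => h k r ?_ s ?_ u ?_⟩ <;>
          exact Icc_subset_Icc_left (not_lt.1 hk') (by assumption)
  exact this (Fin.last m) (by rw [h1]; exact ht.2)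

theorem exists_arc_left_of_mem {t : ℝ} (ht : t ∈ Ioc (0 : ℝ) 1) :
    ∃ b, b < t ∧ StrictlyConvexArc c.lift b t := by
  obtain ⟨m, τ, hτ, h0, h1, h⟩ := c.convexArcs
  have : ∀ k : Fin (m + 1), t ≤ τ k → ∃ b, b < t ∧ StrictlyConvexArc c.lift b t := by
    intro k
    induction k using Fin.induction with
    | zero => intro hk; rw [h0] at hk; exact absurd ht.1 (not_lt.2 hk)
    | succ k ih =>
      intro hk
      by_cases hk' : t ≤ τ k.castSucc
      · exact ih hk'
      · refine ⟨τ k.castSucc, not_le.1 hk', fun r hr s hs u hu => h k r ?_ s ?_ u ?_⟩ <;>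
          exact Icc_subset_Icc_right hk (by assumption)
  exact this (Fin.last m) (by rw [h1]; exact ht.2)

theorem strictlyConvexArc_add_int {a b : ℝ} (h : StrictlyConvexArc c.lift a b) (n : ℤ) :
    StrictlyConvexArc c.lift (a + n) (b + n) := by
  obtain ⟨ε, hε, k⟩ := c.exists_sign_int n
  intro r hr s hs t ht hrs hst
  have key := h (r - n) ⟨by linarith [hr.1], by linarith [hr.2]⟩ (s - n)
    ⟨by linarith [hs.1], by linarith [hs.2]⟩ (t - n) ⟨by linarith [ht.1], by linarith [ht.2]⟩
    (by linarith) (by linarith)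
  have e : ∀ x : ℝ, c.lift x = ε • c.lift (x - n) := fun x => by
    rw [← (k _).1, sub_add_cancel]
  have e0 : ε ≠ 0 := by rintro rfl; norm_num at hε
  rw [e r, e s, e t]
  have : (Matrix.of ![ε • c.lift (r - n), ε • c.lift (s - n), ε • c.lift (t - n)]).det =
      ε ^ 3 * (Matrix.of ![c.lift (r - n), c.lift (s - n), c.lift (t - n)]).det := by
    simp [Matrix.det_fin_three]; ring
  rw [this]
  exact mul_ne_zero (pow_ne_zero _ e0) key

theorem exists_arc_right (t : ℝ) : ∃ b, t < b ∧ StrictlyConvexArc c.lift t b := by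
  obtain ⟨b, hb, h⟩ := c.exists_arc_of_mem ⟨Int.fract_nonneg t, Int.fract_lt_one t⟩
  refine ⟨b + ⌊t⌋, ?_, ?_⟩
  · have := Int.fract_add_floor t; linarith
  · have := c.strictlyConvexArc_add_int h ⌊t⌋
    rwa [Int.fract_add_floor] at this

theorem exists_arc_left (t : ℝ) : ∃ b, b < t ∧ StrictlyConvexArc c.lift b t := by
  have ht : t - (⌈t⌉ - 1 : ℤ) ∈ Ioc (0 : ℝ) 1 := by
    have h1 := Int.ceil_lt_add_one t
    have h2 := Int.le_ceil t
    push_cast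
    constructor <;> linarith
  obtain ⟨b, hb, h⟩ := c.exists_arc_left_of_mem ht
  refine ⟨b + (⌈t⌉ - 1 : ℤ), by linarith, ?_⟩
  have := c.strictlyConvexArc_add_int h (⌈t⌉ - 1)
  rwa [sub_add_cancel] at this

end ClosedCurve

theorem cross_dot_rotate (a b d : Fin 3 → ℝ) : crossProduct b d ⬝ᵥ a = crossProduct a b ⬝ᵥ d := by
  simp [cross_apply, dotProduct, Fin.sum_univ_three]; ring

theorem cross_dot_swap (a b d : Fin 3 → ℝ) : crossProduct b a ⬝ᵥ d = -(crossProduct a b ⬝ᵥ d) := by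
  simp [cross_apply, dotProduct, Fin.sum_univ_three]; ring

theorem det_eq_cross_dot (a b d : Fin 3 → ℝ) : (Matrix.of ![a, b, d]).det = crossProduct a b ⬝ᵥ d := by
  rw [Matrix.det_fin_three]
  simp [cross_apply, dotProduct, Fin.sum_univ_three]; ring

/-- Along a strictly convex arc, the orientation of ordered triples is constant. -/
theorem StrictlyConvexArc.exists_sign {g : ℝ → Fin 3 → ℝ} (hg : Continuous g) {a b : ℝ}
    (h : StrictlyConvexArc g a b) : ∃ ν : ℝ, (ν = 1 ∨ ν = -1) ∧
      ∀ r ∈ Icc a b, ∀ s ∈ Icc a b, ∀ t ∈ Icc a b, r < s → s < t →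
        0 < ν * (crossProduct (g r) (g s) ⬝ᵥ g t) := by
  set K : Set (ℝ × ℝ × ℝ) :=
    {x | x.1 ∈ Icc a b ∧ x.2.1 ∈ Icc a b ∧ x.2.2 ∈ Icc a b ∧ x.1 < x.2.1 ∧ x.2.1 < x.2.2} with hK
  set f : ℝ × ℝ × ℝ → ℝ := fun x => crossProduct (g x.1) (g x.2.1) ⬝ᵥ g x.2.2 with hf
  have hfc : Continuous f := by
    refine Continuous.dotProduct ?_ (by fun_prop)
    exact continuous_cross.comp
      ((hg.comp continuous_fst).prodMk (hg.comp (continuous_fst.comp continuous_snd)))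
  -- The ordered triples form a convex, hence connected, set on which the determinant has no zero.
  have hconv : Convex ℝ K := by
    rintro ⟨r, s, t⟩ ⟨h1, h2, h3, h4, h5⟩ ⟨r', s', t'⟩ ⟨k1, k2, k3, k4, k5⟩ x y hx hy hxy
    have hlt : ∀ {p q p' q' : ℝ}, p < q → p' < q' → x * p + y * p' < x * q + y * q' := by
      intro p q p' q' hp hq
      rcases hx.eq_or_lt with rfl | hx'
      · have : y = 1 := by linarith
        subst this; linarith
      · nlinarith [mul_lt_mul_of_pos_left hp hx', mul_le_mul_of_nonneg_left hq.le hy]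
    refine ⟨(convex_Icc a b) h1 k1 hx hy hxy, (convex_Icc a b) h2 k2 hx hy hxy,
      (convex_Icc a b) h3 k3 hx hy hxy, ?_, ?_⟩
    · exact hlt h4 k4
    · exact hlt h5 k5
  have hne : ∀ x ∈ K, f x ≠ 0 := by
    rintro ⟨r, s, t⟩ ⟨h1, h2, h3, h4, h5⟩
    have := h r h1 s h2 t h3 h4 h5
    rwa [det_eq_cross_dot] at this
  have hdich : (∀ x ∈ K, 0 < f x) ∨ (∀ x ∈ K, f x < 0) := by
    by_contra! hcon
    obtain ⟨⟨x, hx, hx0⟩, y, hy, hy0⟩ := hcon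
    obtain ⟨z, hz, hz0⟩ := hconv.isPreconnected.intermediate_value hx hy hfc.continuousOn ⟨hx0, hy0⟩
    exact hne z hz hz0
  rcases hdich with hp | hn
  · refine ⟨1, Or.inl rfl, fun r hr s hs t ht hrs hst => ?_⟩
    have := hp (r, s, t) ⟨hr, hs, ht, hrs, hst⟩
    simpa [hf] using this
  · refine ⟨-1, Or.inr rfl, fun r hr s hs t ht hrs hst => ?_⟩
    have := hn (r, s, t) ⟨hr, hs, ht, hrs, hst⟩
    simpa [hf] using this

namespace ClosedCurve

variable (c : ClosedCurve)

/-- The weak inequality for tangents, as limits of secants. -/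
theorem arc_tangent_nonneg {a b ν : ℝ}
    (h : ∀ r ∈ Icc a b, ∀ s ∈ Icc a b, ∀ t ∈ Icc a b, r < s → s < t →
      0 < ν * (crossProduct (c.lift r) (c.lift s) ⬝ᵥ c.lift t))
    {t u : ℝ} (ht : t ∈ Icc a b) (hu : u ∈ Icc a b) (htu : t ≠ u) :
    0 ≤ ν * (c.tvec t ⬝ᵥ c.lift u) := by
  have hd : HasDerivAt (fun s => ν * (crossProduct (c.lift t) (c.lift s) ⬝ᵥ c.lift u))
      (ν * (c.tvec t ⬝ᵥ c.lift u)) t := by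
    simp only [tvec, cross_dot_rotate (c.lift u)]
    exact (c.hasDerivAt_dot (crossProduct (c.lift u) (c.lift t)) t).const_mul ν
  have hs := hasDerivAt_iff_tendsto_slope.1 hd
  have h0 : crossProduct (c.lift t) (c.lift t) ⬝ᵥ c.lift u = 0 := by rw [cross_self]; simp
  rcases lt_or_gt_of_ne htu with hlt | hlt
  · refine ge_of_tendsto (hs.mono_left (nhdsWithin_mono t fun x (hx : x ∈ Ioi t) => ne_of_gt hx)) ?_
    filter_upwards [Ioo_mem_nhdsGT hlt] with s hs
    rw [slope_def_field, h0, mul_zero, sub_zero]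
    exact div_nonneg (h t ht s ⟨ht.1.trans hs.1.le, hs.2.le.trans hu.2⟩ u hu hs.1 hs.2).le
      (sub_pos.2 hs.1).le
  · refine ge_of_tendsto (hs.mono_left (nhdsWithin_mono t fun x (hx : x ∈ Iio t) => ne_of_lt hx)) ?_
    filter_upwards [Ioo_mem_nhdsLT hlt] with s hs
    rw [slope_def_field, h0, mul_zero, sub_zero]
    refine div_nonneg_of_nonpos ?_ (sub_neg.2 hs.2).le
    have := h u hu s ⟨hu.1.trans hs.1.le, hs.2.le.trans ht.2⟩ t ht hs.1 hs.2
    rw [← cross_dot_rotate, cross_dot_swap] at this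
    linarith

/-- The tangent at a point of a strictly convex arc does not meet the arc again, except possibly when
the two parameters are the endpoints of the arc. -/
theorem arc_tangent_pos {a b ν : ℝ}
    (h : ∀ r ∈ Icc a b, ∀ s ∈ Icc a b, ∀ t ∈ Icc a b, r < s → s < t →
      0 < ν * (crossProduct (c.lift r) (c.lift s) ⬝ᵥ c.lift t))
    {t u v : ℝ} (ht : t ∈ Icc a b) (hu : u ∈ Icc a b) (hv : v ∈ Icc a b) (htu : t ≠ u)
    (hvv : (v < t ∧ v < u) ∨ (t < v ∧ u < v)) : 0 < ν * (c.tvec t ⬝ᵥ c.lift u) := by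
  refine lt_of_le_of_ne (c.arc_tangent_nonneg h ht hu htu) fun hzero => ?_
  have hν : ν ≠ 0 := by
    rintro rfl
    rcases lt_or_gt_of_ne htu with hlt | hlt <;> rcases hvv with ⟨h1, h2⟩ | ⟨h1, h2⟩
    · simpa using h v hv t ht u hu h1 hlt
    · simpa using h t ht u hu v hv hlt h2
    · simpa using h v hv u hu t ht h2 hlt
    · simpa using h u hu t ht v hv hlt h1
  have hz : c.tvec t ⬝ᵥ c.lift u = 0 := by
    rcases mul_eq_zero.1 hzero.symm with h | h
    · exact absurd h hν
    · exact h
  -- A third point between `t` and `u` lies on the other side of the secant than `v`.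
  have key : ∀ w ∈ Icc a b, ((t < w ∧ w < u) ∨ (u < w ∧ w < t)) →
      (ν * (crossProduct (c.lift t) (c.lift u) ⬝ᵥ c.lift w)) *
        (ν * (crossProduct (c.lift t) (c.lift u) ⬝ᵥ c.lift v)) < 0 := by
    rintro w hw (⟨w1, w2⟩ | ⟨w1, w2⟩)
    · have e1 := h t ht w hw u hu w1 w2
      rw [← cross_dot_rotate, ← cross_dot_rotate, cross_dot_swap] at e1
      refine mul_neg_of_neg_of_pos (by linarith) ?_
      rcases hvv with ⟨h1, h2⟩ | ⟨h1, h2⟩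
      · have := h v hv t ht u hu h1 (w1.trans w2)
        rwa [← cross_dot_rotate] at this
      · exact h t ht u hu v hv (w1.trans w2) h2
    · have e1 := h u hu w hw t ht w1 w2
      rw [← cross_dot_rotate, ← cross_dot_rotate] at e1
      refine mul_neg_of_pos_of_neg e1 ?_
      rcases hvv with ⟨h1, h2⟩ | ⟨h1, h2⟩
      · have := h v hv u hu t ht h2 (w1.trans w2)
        rw [← cross_dot_rotate, cross_dot_swap] at this
        linarith
      · have := h u hu t ht v hv (w1.trans w2) h1
        rw [cross_dot_swap] at this
        linarith
  have hw : (t + u) / 2 ∈ Icc a b := ⟨by linarith [ht.1, hu.1], by linarith [ht.2, hu.2]⟩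
  have hlt : (t < (t + u) / 2 ∧ (t + u) / 2 < u) ∨ (u < (t + u) / 2 ∧ (t + u) / 2 < t) := by
    rcases lt_or_gt_of_ne htu with hlt | hlt
    · left; constructor <;> linarith
    · right; constructor <;> linarith
  have k := key _ hw hlt
  have hcr : crossProduct (c.lift t) (c.lift u) ≠ 0 := by
    intro h0; simp [h0] at k
  -- The tangent at `t` would be the secant through `t` and `u`, which separates `w` from `v`; but a tangent
  -- has the arc on one side.
  have hsm := smul_cross_of_dot_eq_zero hcr (c.tvec_dot_lift t) hz
  set κ := (c.tvec t ⬝ᵥ crossProduct (c.lift t) (c.lift u)) /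
    (crossProduct (c.lift t) (c.lift u) ⬝ᵥ crossProduct (c.lift t) (c.lift u))
  have hκ : κ ≠ 0 := by
    intro h0; rw [h0, zero_smul] at hsm; exact c.tvec_ne_zero t hsm
  have n1 := c.arc_tangent_nonneg h ht hw (by rcases hlt with h | h <;> [exact ne_of_lt h.1; exact ne_of_gt h.2])
  have n2 := c.arc_tangent_nonneg h ht hv (by rcases hvv with h | h <;> [exact ne_of_gt h.1; exact ne_of_lt h.1])
  rw [hsm, smul_dotProduct, smul_eq_mul] at n1 n2
  have := mul_nonneg n1 n2
  nlinarith [sq_pos_of_ne_zero hκ]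

/-- On each side `e = ±1` of a parameter `t₀`, the curve near `t₀` lies strictly on one side `ν` of
each of its tangents. -/
theorem exists_side (t₀ : ℝ) {e : ℝ} (he : e = 1 ∨ e = -1) :
    ∃ ν : ℝ, (ν = 1 ∨ ν = -1) ∧ ∃ δ > 0, ∀ t u : ℝ, 0 ≤ e * (t - t₀) → e * (t - t₀) < δ →
      0 ≤ e * (u - t₀) → e * (u - t₀) < δ → t ≠ u → 0 < ν * (c.tvec t ⬝ᵥ c.lift u) := by
  rcases he with rfl | rfl
  · obtain ⟨b, hb, h⟩ := c.exists_arc_right t₀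
    obtain ⟨ν, hν, h⟩ := h.exists_sign c.continuous_lift
    refine ⟨ν, hν, b - t₀, sub_pos.2 hb, fun t u h1 h2 h3 h4 hne => ?_⟩
    exact c.arc_tangent_pos h (v := b) ⟨by linarith, by linarith⟩ ⟨by linarith, by linarith⟩
      ⟨hb.le, le_rfl⟩ hne (Or.inr ⟨by linarith, by linarith⟩)
  · obtain ⟨b, hb, h⟩ := c.exists_arc_left t₀
    obtain ⟨ν, hν, h⟩ := h.exists_sign c.continuous_lift
    refine ⟨ν, hν, t₀ - b, sub_pos.2 hb, fun t u h1 h2 h3 h4 hne => ?_⟩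
    exact c.arc_tangent_pos h (v := b) ⟨by linarith, by linarith⟩ ⟨by linarith, by linarith⟩
      ⟨le_rfl, hb.le⟩ hne (Or.inl ⟨by linarith, by linarith⟩)

end ClosedCurve

/-! ### One-sided neighbourhoods -/

/-- The right (`e = 1`) or left (`e = -1`) punctured neighbourhoods of `t₀`. -/
def side (e t₀ : ℝ) : Filter ℝ := 𝓝[{t | 0 < e * (t - t₀)}] t₀

theorem side_one (t₀ : ℝ) : side 1 t₀ = 𝓝[>] t₀ := by
  unfold side
  congr 1
  ext t
  simp

theorem side_neg_one (t₀ : ℝ) : side (-1) t₀ = 𝓝[<] t₀ := by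
  unfold side
  congr 1
  ext t
  simp

theorem side_neBot {e : ℝ} (he : e = 1 ∨ e = -1) (t₀ : ℝ) : (side e t₀).NeBot := by
  rcases he with rfl | rfl
  · rw [side_one]; infer_instance
  · rw [side_neg_one]; infer_instance

theorem side_le (e t₀ : ℝ) : side e t₀ ≤ 𝓝 t₀ := nhdsWithin_le_nhds

theorem eventually_side_pos (e t₀ : ℝ) : ∀ᶠ t in side e t₀, 0 < e * (t - t₀) := self_mem_nhdsWithin

theorem eventually_side_lt (e t₀ : ℝ) {δ : ℝ} (hδ : 0 < δ) : ∀ᶠ t in side e t₀, e * (t - t₀) < δ := by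
  apply side_le e t₀
  have : Tendsto (fun t => e * (t - t₀)) (𝓝 t₀) (𝓝 (e * (t₀ - t₀))) :=
    Continuous.tendsto (by fun_prop) _
  rw [sub_self, mul_zero] at this
  exact this.eventually (gt_mem_nhds hδ)

theorem eventually_ne_of_side {t₀ : ℝ} {p : ℝ → Prop} (h : ∀ e : ℝ, e = 1 ∨ e = -1 → ∀ᶠ t in side e t₀, p t) :
    ∀ᶠ t in 𝓝[≠] t₀, p t := by
  rw [← Iio_union_Ioi, nhdsWithin_union, eventually_sup, ← side_one, ← side_neg_one]
  exact ⟨h _ (Or.inr rfl), h _ (Or.inl rfl)⟩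

theorem mul_self_of_sign {e : ℝ} (he : e = 1 ∨ e = -1) : e * e = 1 := by
  rcases he with rfl | rfl <;> norm_num

theorem neg_sign {e : ℝ} (he : e = 1 ∨ e = -1) : -e = 1 ∨ -e = -1 := by
  rcases he with rfl | rfl <;> norm_num

namespace ClosedCurve

variable (c : ClosedCurve)

/-- The side (`1` or `-1`) of its tangents on which the curve lies to the right (`e = 1`) or to the
left (`e = -1`) of the parameter `t`; the value for other `e` is irrelevant. -/
noncomputable def sideSign (e t : ℝ) : ℝ :=
  open Classical in if h : e = 1 ∨ e = -1 then (c.exists_side t h).choose else 1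

theorem sideSign_spec (t₀ : ℝ) {e : ℝ} (he : e = 1 ∨ e = -1) :
    (c.sideSign e t₀ = 1 ∨ c.sideSign e t₀ = -1) ∧ ∃ δ > 0, ∀ t u : ℝ, 0 ≤ e * (t - t₀) →
      e * (t - t₀) < δ → 0 ≤ e * (u - t₀) → e * (u - t₀) < δ → t ≠ u →
      0 < c.sideSign e t₀ * (c.tvec t ⬝ᵥ c.lift u) := by
  rw [sideSign, dif_pos he]
  exact (c.exists_side t₀ he).choose_spec

theorem exists_tangent_rep (t : ℝ) : ∃ a : ℝ, a ≠ 0 ∧ (c.tangent t).rep = a • c.tvec t := by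
  obtain ⟨a, ha⟩ := Projectivization.exists_smul_eq_mk_rep ℝ (c.tvec t) (c.cross_ne_zero t)
  exact ⟨a, a.ne_zero, ha.symm⟩

theorem not_isFlex_of_eventually {t ν : ℝ} (h : ∀ᶠ u in 𝓝[≠] t, 0 < ν * (c.tvec t ⬝ᵥ c.lift u)) :
    ¬ c.IsFlex t := by
  intro hf
  obtain ⟨a, ha, hrep⟩ := c.exists_tangent_rep t
  unfold IsFlex at hf
  rw [hrep] at hf
  have hl := h.filter_mono (nhdsWithin_mono t fun x (hx : x ∈ Iio t) => ne_of_lt hx)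
  have hr := h.filter_mono (nhdsWithin_mono t fun x (hx : x ∈ Ioi t) => ne_of_gt hx)
  obtain ⟨r, h1, h2⟩ := (hf.and hl).exists
  obtain ⟨s, h3, h4⟩ := (h1.and hr).exists
  simp only [smul_dotProduct, smul_eq_mul] at h3
  have := mul_pos h2 h4
  nlinarith [mul_nonneg (sq_nonneg a) (sq_nonneg ν), mul_pos (sq_pos_of_ne_zero ha) this, sq_nonneg ν]

theorem eventually_side_sideSign (t₀ : ℝ) {e : ℝ} (he : e = 1 ∨ e = -1) :
    ∀ᶠ u in side e t₀, 0 < c.sideSign e t₀ * (c.tvec t₀ ⬝ᵥ c.lift u) ∧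
      0 < c.sideSign e t₀ * (c.tvec u ⬝ᵥ c.lift t₀) := by
  obtain ⟨-, δ, hδ, h⟩ := c.sideSign_spec t₀ he
  filter_upwards [eventually_side_pos e t₀, eventually_side_lt e t₀ hδ] with u h1 h2
  have hne : t₀ ≠ u := by rintro rfl; simp at h1
  exact ⟨h _ _ (by simp) (by simpa using hδ) h1.le h2 hne,
    h _ _ h1.le h2 (by simp) (by simpa using hδ) hne.symm⟩

/-- A flex is a parameter at which the curve lies on different sides of its tangents. -/
theorem isFlex_iff (t : ℝ) : c.IsFlex t ↔ c.sideSign (-1) t = -c.sideSign 1 t := by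
  have s1 := c.eventually_side_sideSign t (Or.inl rfl)
  have s2 := c.eventually_side_sideSign t (Or.inr rfl)
  have n1 := (c.sideSign_spec t (Or.inl rfl)).1
  have n2 := (c.sideSign_spec t (Or.inr rfl)).1
  constructor
  · intro hf
    by_contra hne
    have heq : c.sideSign (-1) t = c.sideSign 1 t := by
      rcases n1 with h1 | h1 <;> rcases n2 with h2 | h2 <;> rw [h1, h2] at hne ⊢ <;> norm_num at hne
    rw [heq] at s2
    refine c.not_isFlex_of_eventually (ν := c.sideSign 1 t) ?_ hf
    refine eventually_ne_of_side ?_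
    rintro e (rfl | rfl)
    · exact s1.mono fun u h => h.1
    · exact s2.mono fun u h => h.1
  · intro hneg
    obtain ⟨a, ha, hrep⟩ := c.exists_tangent_rep t
    unfold IsFlex
    rw [hrep, ← side_neg_one, ← side_one]
    filter_upwards [s2] with r hr
    filter_upwards [s1] with s hs
    simp only [smul_dotProduct, smul_eq_mul]
    rw [hneg] at hr
    have := mul_pos hr.1 hs.1
    have e1 := mul_self_of_sign n1
    have e2 : (c.tvec t ⬝ᵥ c.lift r) * (c.tvec t ⬝ᵥ c.lift s) < 0 := by
      have : 0 < -(c.sideSign 1 t * c.sideSign 1 t) * ((c.tvec t ⬝ᵥ c.lift r) * (c.tvec t ⬝ᵥ c.lift s)) := by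
        linarith
      rw [e1] at this
      linarith
    nlinarith [sq_pos_of_ne_zero ha]

theorem eventually_not_isFlex (t₀ : ℝ) : ∀ᶠ t in 𝓝[≠] t₀, ¬ c.IsFlex t := by
  refine eventually_ne_of_side fun e he => ?_
  obtain ⟨-, δ, hδ, h⟩ := c.sideSign_spec t₀ he
  filter_upwards [eventually_side_pos e t₀, eventually_side_lt e t₀ hδ] with t h1 h2
  refine c.not_isFlex_of_eventually (ν := c.sideSign e t₀) ?_
  have hc : Continuous fun u => e * (u - t₀) := by fun_prop
  filter_upwards [nhdsWithin_le_nhds ((hc.tendsto t).eventually (lt_mem_nhds h1)),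
    nhdsWithin_le_nhds ((hc.tendsto t).eventually (gt_mem_nhds h2)), self_mem_nhdsWithin] with u u1 u2 u3
  exact h _ _ h1.le h2 u1.le u2 (Ne.symm u3)

/-! ### Coordinates adapted to a point of the curve -/

/-- With `tvec t₀`, the covectors `covA`, `covB` form (up to a common factor) the basis dual to
`γ(t₀), γ'(t₀), γ(t₀) × γ'(t₀)`. -/
noncomputable def covA (t₀ : ℝ) : Fin 3 → ℝ := crossProduct (deriv c.lift t₀) (c.tvec t₀)

/-- The second covector of the frame at `t₀`; it vanishes at `γ(t₀)`. -/
noncomputable def covB (t₀ : ℝ) : Fin 3 → ℝ := crossProduct (c.tvec t₀) (c.lift t₀)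

/-- The coefficients of the tangent at `t` in the frame of covectors at `t₀`. -/
noncomputable def coefT (t₀ t : ℝ) : ℝ :=
  (c.covA t₀ ⬝ᵥ c.lift t) * (c.covB t₀ ⬝ᵥ deriv c.lift t) -
    (c.covB t₀ ⬝ᵥ c.lift t) * (c.covA t₀ ⬝ᵥ deriv c.lift t)

/-- The coefficient of `-covB` of the tangent at `t`. -/
noncomputable def coefB (t₀ t : ℝ) : ℝ :=
  (c.covA t₀ ⬝ᵥ c.lift t) * (c.tvec t₀ ⬝ᵥ deriv c.lift t) -
    (c.tvec t₀ ⬝ᵥ c.lift t) * (c.covA t₀ ⬝ᵥ deriv c.lift t)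

/-- The coefficient of `covA` of the tangent at `t`. -/
noncomputable def coefA (t₀ t : ℝ) : ℝ :=
  (c.covB t₀ ⬝ᵥ c.lift t) * (c.tvec t₀ ⬝ᵥ deriv c.lift t) -
    (c.tvec t₀ ⬝ᵥ c.lift t) * (c.covB t₀ ⬝ᵥ deriv c.lift t)

theorem frame_tvec_dot (t₀ t : ℝ) (w : Fin 3 → ℝ) :
    (c.tvec t₀ ⬝ᵥ c.tvec t₀) ^ 2 * (c.tvec t ⬝ᵥ w) = (c.tvec t₀ ⬝ᵥ w) * c.coefT t₀ t
      - (c.covB t₀ ⬝ᵥ w) * c.coefB t₀ t + (c.covA t₀ ⬝ᵥ w) * c.coefA t₀ t :=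
  frame_det (c.lift t₀) (deriv c.lift t₀) (c.lift t) (deriv c.lift t) w

theorem frame_tvec (t₀ t : ℝ) : (c.tvec t₀ ⬝ᵥ c.tvec t₀) ^ 2 • c.tvec t =
    c.coefT t₀ t • c.tvec t₀ - c.coefB t₀ t • c.covB t₀ + c.coefA t₀ t • c.covA t₀ := by
  ext i
  have := c.frame_tvec_dot t₀ t (Pi.single i 1)
  simp only [dotProduct_single, mul_one] at this
  simp only [Pi.smul_apply, Pi.add_apply, Pi.sub_apply, smul_eq_mul]
  linarith

theorem coef_rel (t₀ t : ℝ) : (c.covA t₀ ⬝ᵥ c.lift t) * c.coefA t₀ t =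
    (c.covB t₀ ⬝ᵥ c.lift t) * c.coefB t₀ t - (c.tvec t₀ ⬝ᵥ c.lift t) * c.coefT t₀ t := by
  unfold coefA coefB coefT; ring

theorem covA_lift (t₀ : ℝ) : c.covA t₀ ⬝ᵥ c.lift t₀ = c.tvec t₀ ⬝ᵥ c.tvec t₀ := by
  unfold covA tvec
  simp [cross_apply, dotProduct, Fin.sum_univ_three]; ring

theorem covB_lift (t₀ : ℝ) : c.covB t₀ ⬝ᵥ c.lift t₀ = 0 := by
  unfold covB
  rw [dotProduct_comm, dot_cross_self]

theorem covB_deriv (t₀ : ℝ) : c.covB t₀ ⬝ᵥ deriv c.lift t₀ = c.tvec t₀ ⬝ᵥ c.tvec t₀ := by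
  unfold covB tvec
  simp [cross_apply, dotProduct, Fin.sum_univ_three]; ring

theorem tendsto_dot_lift (d : Fin 3 → ℝ) (t₀ : ℝ) :
    Tendsto (fun t => d ⬝ᵥ c.lift t) (𝓝 t₀) (𝓝 (d ⬝ᵥ c.lift t₀)) :=
  tendsto_dotProduct tendsto_const_nhds (c.continuous_lift.tendsto t₀)

theorem tendsto_dot_deriv (d : Fin 3 → ℝ) (t₀ : ℝ) :
    Tendsto (fun t => d ⬝ᵥ deriv c.lift t) (𝓝 t₀) (𝓝 (d ⬝ᵥ deriv c.lift t₀)) :=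
  tendsto_dotProduct tendsto_const_nhds (c.continuous_deriv_lift.tendsto t₀)

theorem tendsto_coefT (t₀ : ℝ) :
    Tendsto (c.coefT t₀) (𝓝 t₀) (𝓝 ((c.tvec t₀ ⬝ᵥ c.tvec t₀) ^ 2)) := by
  have := ((c.tendsto_dot_lift (c.covA t₀) t₀).mul (c.tendsto_dot_deriv (c.covB t₀) t₀)).sub
    ((c.tendsto_dot_lift (c.covB t₀) t₀).mul (c.tendsto_dot_deriv (c.covA t₀) t₀))
  rw [covA_lift, covB_lift, covB_deriv, zero_mul, sub_zero, ← sq] at this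
  exact this

theorem tendsto_coefB (t₀ : ℝ) : Tendsto (c.coefB t₀) (𝓝 t₀) (𝓝 0) := by
  have := ((c.tendsto_dot_lift (c.covA t₀) t₀).mul (c.tendsto_dot_deriv (c.tvec t₀) t₀)).sub
    ((c.tendsto_dot_lift (c.tvec t₀) t₀).mul (c.tendsto_dot_deriv (c.covA t₀) t₀))
  rw [tvec_dot_lift, tvec_dot_deriv, zero_mul, mul_zero, sub_zero] at this
  exact this

/-- A function vanishing at `t₀` with nonzero derivative has the sign of its derivative times `e`
on the side `e`. -/
theorem _root_.FabriciusBjerre.eventually_side_sign {f : ℝ → ℝ} {f' t₀ : ℝ} (hf : HasDerivAt f f' t₀)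
    (h0 : f t₀ = 0) (hf' : f' ≠ 0) (e : ℝ) : ∀ᶠ t in side e t₀, 0 < e * f' * f t := by
  have hs := hasDerivAt_iff_tendsto_slope.1 hf
  have hle : side e t₀ ≤ 𝓝[≠] t₀ := nhdsWithin_mono t₀ fun x hx => by
    rintro rfl; simp at hx
  have h1 : Tendsto (fun t => f' * slope f t₀ t) (side e t₀) (𝓝 (f' * f')) :=
    (hs.mono_left hle).const_mul f'
  filter_upwards [h1.eventually (lt_mem_nhds (mul_self_pos.2 hf')), eventually_side_pos e t₀] with t h2 h3
  rw [slope_def_field, h0, sub_zero] at h2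
  have hne : t - t₀ ≠ 0 := by intro h; rw [h, mul_zero] at h3; exact lt_irrefl _ h3
  have : e * f' * f t = (f' * (f t / (t - t₀))) * (e * (t - t₀)) := by field_simp
  rw [this]
  exact mul_pos h2 h3

/-- The signs of the coordinates and of the tangent coefficients on the side `e` of `t₀`. -/
theorem eventually_side_coords (t₀ : ℝ) {e : ℝ} (he : e = 1 ∨ e = -1) :
    ∀ᶠ t in side e t₀, 0 < c.covA t₀ ⬝ᵥ c.lift t ∧ 0 < c.coefT t₀ t ∧ 0 < e * (c.covB t₀ ⬝ᵥ c.lift t) ∧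
      0 < c.sideSign e t₀ * (c.tvec t₀ ⬝ᵥ c.lift t) ∧ 0 < c.sideSign e t₀ * c.coefA t₀ t ∧
      0 < c.sideSign e t₀ * e * c.coefB t₀ t := by
  have hn := dot_self_pos (c.tvec_ne_zero t₀)
  have hA := (c.tendsto_dot_lift (c.covA t₀) t₀).mono_left (side_le e t₀)
  rw [covA_lift] at hA
  have hM := (c.tendsto_coefT t₀).mono_left (side_le e t₀)
  have hX := eventually_side_sign (c.hasDerivAt_dot (c.covB t₀) t₀) (c.covB_lift t₀)
    (by rw [covB_deriv]; exact hn.ne') e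
  rw [covB_deriv] at hX
  filter_upwards [hA.eventually (lt_mem_nhds hn), hM.eventually (lt_mem_nhds (pow_pos hn 2)), hX,
    c.eventually_side_sideSign t₀ he] with t h1 h2 h3 h4
  have h3' : 0 < e * (c.covB t₀ ⬝ᵥ c.lift t) := by
    have : e * (c.tvec t₀ ⬝ᵥ c.tvec t₀) * (c.covB t₀ ⬝ᵥ c.lift t) =
      (c.tvec t₀ ⬝ᵥ c.tvec t₀) * (e * (c.covB t₀ ⬝ᵥ c.lift t)) := by ring
    rw [this] at h3
    exact pos_of_mul_pos_right h3 hn.le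
  have h5 : 0 < c.sideSign e t₀ * c.coefA t₀ t := by
    have k := c.frame_tvec_dot t₀ t (c.lift t₀)
    rw [tvec_dot_lift, covB_lift, covA_lift] at k
    have k2 : (c.tvec t₀ ⬝ᵥ c.tvec t₀) * (c.sideSign e t₀ * c.coefA t₀ t) =
        (c.tvec t₀ ⬝ᵥ c.tvec t₀) ^ 2 * (c.sideSign e t₀ * (c.tvec t ⬝ᵥ c.lift t₀)) := by
      linear_combination (-c.sideSign e t₀) * k
    have k3 := mul_pos (pow_pos hn 2) h4.2
    rw [← k2] at k3
    exact pos_of_mul_pos_right k3 hn.le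
  refine ⟨h1, h2, h3', h4.1, h5, ?_⟩
  have k := c.coef_rel t₀ t
  have ee := mul_self_of_sign he
  have k2 : (e * (c.covB t₀ ⬝ᵥ c.lift t)) * (c.sideSign e t₀ * e * c.coefB t₀ t) =
      (c.covA t₀ ⬝ᵥ c.lift t) * (c.sideSign e t₀ * c.coefA t₀ t) +
      c.coefT t₀ t * (c.sideSign e t₀ * (c.tvec t₀ ⬝ᵥ c.lift t)) := by
    linear_combination (c.covB t₀ ⬝ᵥ c.lift t) * c.coefB t₀ t * c.sideSign e t₀ * ee -
      c.sideSign e t₀ * k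
  have k3 := add_pos (mul_pos h1 h5) (mul_pos h2 h4.1)
  rw [← k2] at k3
  exact pos_of_mul_pos_right k3 h3'.le

/-- On the side `e` of `t₀`, the tangents are, up to positive factors, the perturbations
`T + s E` of the tangent `T` at `t₀`, where `s → 0` has a definite sign and `E → -covB`. -/
theorem tangent_family (t₀ : ℝ) {e : ℝ} (he : e = 1 ∨ e = -1) :
    ∃ (k s : ℝ → ℝ) (E : ℝ → Fin 3 → ℝ), Tendsto s (side e t₀) (𝓝 0) ∧
      Tendsto E (side e t₀) (𝓝 (-c.covB t₀)) ∧
      ∀ᶠ t in side e t₀, 0 < k t ∧ k t • c.tvec t = c.tvec t₀ + s t • E t ∧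
        0 < c.sideSign e t₀ * e * s t := by
  have hn := dot_self_pos (c.tvec_ne_zero t₀)
  have hA := (c.tendsto_dot_lift (c.covA t₀) t₀).mono_left (side_le e t₀)
  have hX := (c.tendsto_dot_lift (c.covB t₀) t₀).mono_left (side_le e t₀)
  rw [covA_lift] at hA
  rw [covB_lift] at hX
  have hM := (c.tendsto_coefT t₀).mono_left (side_le e t₀)
  have hQ := (c.tendsto_coefB t₀).mono_left (side_le e t₀)
  -- In `coef_rel`, written as `covB * coefB = covA * coefA + tvec * coefT`, the two summands on the right have
  -- the same sign, so that `|coefA / coefB|` is at most `|covB / covA|`.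
  have hR : Tendsto (fun t => c.coefA t₀ t / c.coefB t₀ t) (side e t₀) (𝓝 0) := by
    have hb : Tendsto (fun t => |(c.covB t₀ ⬝ᵥ c.lift t) / (c.covA t₀ ⬝ᵥ c.lift t)|)
        (side e t₀) (𝓝 0) := by
      have := (hX.div hA hn.ne').abs
      simpa using this
    refine squeeze_zero_norm' ?_ hb
    filter_upwards [c.eventually_side_coords t₀ he] with t ⟨h1, h2, h3, h4, h5, h6⟩
    have k := c.coef_rel t₀ t
    have hQ0 : c.coefB t₀ t ≠ 0 := by intro h; rw [h, mul_zero] at h6; exact lt_irrefl _ h6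
    rw [Real.norm_eq_abs, abs_div, abs_div, div_le_div_iff₀ (abs_pos.2 hQ0) (abs_pos.2 h1.ne'),
      ← abs_mul, ← abs_mul]
    apply sq_le_sq.1
    have hν := mul_self_of_sign (c.sideSign_spec t₀ he).1
    have e1 : (c.covB t₀ ⬝ᵥ c.lift t) * c.coefB t₀ t =
      (c.covA t₀ ⬝ᵥ c.lift t) * c.coefA t₀ t + (c.tvec t₀ ⬝ᵥ c.lift t) * c.coefT t₀ t := by
      linarith
    rw [e1]
    have h7 := mul_pos (mul_pos h1 h5) (mul_pos h2 h4)
    have h8 : 0 < ((c.covA t₀ ⬝ᵥ c.lift t) * c.coefA t₀ t) *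
        ((c.tvec t₀ ⬝ᵥ c.lift t) * c.coefT t₀ t) := by
      have : (c.covA t₀ ⬝ᵥ c.lift t) * (c.sideSign e t₀ * c.coefA t₀ t) *
          (c.coefT t₀ t * (c.sideSign e t₀ * (c.tvec t₀ ⬝ᵥ c.lift t))) =
          (c.sideSign e t₀ * c.sideSign e t₀) * (((c.covA t₀ ⬝ᵥ c.lift t) * c.coefA t₀ t) *
        ((c.tvec t₀ ⬝ᵥ c.lift t) * c.coefT t₀ t)) := by ring
      rw [this, hν, one_mul] at h7
      exact h7
    nlinarith [sq_nonneg ((c.tvec t₀ ⬝ᵥ c.lift t) * c.coefT t₀ t)]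
  refine ⟨fun t => (c.tvec t₀ ⬝ᵥ c.tvec t₀) ^ 2 / c.coefT t₀ t, fun t => c.coefB t₀ t / c.coefT t₀ t,
    fun t => -c.covB t₀ + (c.coefA t₀ t / c.coefB t₀ t) • c.covA t₀, ?_, ?_, ?_⟩
  · have := hQ.div hM (pow_pos hn 2).ne'
    rwa [zero_div] at this
  · simpa using tendsto_const_nhds.add (hR.smul_const (c.covA t₀))
  · filter_upwards [c.eventually_side_coords t₀ he] with t ⟨h1, h2, h3, h4, h5, h6⟩
    have hQ0 : c.coefB t₀ t ≠ 0 := by intro h; rw [h, mul_zero] at h6; exact lt_irrefl _ h6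
    refine ⟨div_pos (pow_pos hn 2) h2, ?_, ?_⟩
    · rw [div_eq_inv_mul, mul_smul, frame_tvec, smul_add, smul_sub, smul_smul, smul_smul, smul_smul,
        inv_mul_cancel₀ h2.ne', one_smul, smul_add, smul_smul, smul_neg]
      have e1 : c.coefB t₀ t / c.coefT t₀ t * (c.coefA t₀ t / c.coefB t₀ t) =
        (c.coefT t₀ t)⁻¹ * c.coefA t₀ t := by field_simp
      rw [e1, div_eq_inv_mul]
      abel
    · rw [← mul_div_assoc]; exact div_pos h6 h2

/-- Near a parameter which is not a flex, the curve lies strictly on one side of each of its tangents. -/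
theorem exists_convex_window {t₀ : ℝ} (hf : ¬ c.IsFlex t₀) : ∃ δ > 0, ∀ t u : ℝ, |t - t₀| < δ →
    |u - t₀| < δ → t ≠ u → 0 < c.sideSign 1 t₀ * (c.tvec t ⬝ᵥ c.lift u) := by
  have hn := dot_self_pos (c.tvec_ne_zero t₀)
  have heq : ∀ e : ℝ, e = 1 ∨ e = -1 → c.sideSign e t₀ = c.sideSign 1 t₀ := by
    rintro e (rfl | rfl)
    · rfl
    · rw [isFlex_iff] at hf
      have n1 := (c.sideSign_spec t₀ (Or.inl rfl)).1
      have n2 := (c.sideSign_spec t₀ (Or.inr rfl)).1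
      rcases n1 with h1 | h1 <;> rcases n2 with h2 | h2 <;> rw [h1, h2] at hf ⊢ <;> norm_num at hf
  have hev : ∀ᶠ t in 𝓝[≠] t₀, ∀ e : ℝ, e = 1 ∨ e = -1 → 0 < e * (t - t₀) →
      0 < c.covA t₀ ⬝ᵥ c.lift t ∧ 0 < c.coefT t₀ t ∧ 0 < e * (c.covB t₀ ⬝ᵥ c.lift t) ∧
      0 < c.sideSign 1 t₀ * (c.tvec t₀ ⬝ᵥ c.lift t) ∧ 0 < c.sideSign 1 t₀ * c.coefA t₀ t ∧
      0 < c.sideSign 1 t₀ * e * c.coefB t₀ t := by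
    refine eventually_ne_of_side fun e he => ?_
    filter_upwards [c.eventually_side_coords t₀ he, eventually_side_pos e t₀] with t h h0 e' he' h0'
    have : e' = e := by
      rcases he with rfl | rfl <;> rcases he' with rfl | rfl <;> first | rfl | (exfalso; linarith)
    subst this
    rwa [heq e' he] at h
  obtain ⟨δ₀, hδ₀, hw⟩ := Metric.eventually_nhds_iff.1 (eventually_nhdsWithin_iff.1 hev)
  obtain ⟨-, δ₁, hδ₁, h₁⟩ := c.sideSign_spec t₀ (Or.inl rfl)
  obtain ⟨-, δ₂, hδ₂, h₂⟩ := c.sideSign_spec t₀ (Or.inr rfl)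
  rw [heq _ (Or.inr rfl)] at h₂
  refine ⟨min δ₀ (min δ₁ δ₂), by positivity, fun t u ht hu hne => ?_⟩
  simp only [lt_min_iff, abs_lt] at ht hu
  obtain ⟨⟨t1, t2⟩, ⟨t3, t4⟩, t5, t6⟩ := ht
  obtain ⟨⟨u1, u2⟩, ⟨u3, u4⟩, u5, u6⟩ := hu
  -- For parameters on opposite sides of `t₀`, the three terms of `frame_tvec_dot` have the same sign.
  have opp : ∀ e : ℝ, e = 1 ∨ e = -1 → 0 < e * (t - t₀) → 0 < -e * (u - t₀) →
      0 < c.sideSign 1 t₀ * (c.tvec t ⬝ᵥ c.lift u) := by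
    intro e he ht' hu'
    obtain ⟨-, a2, -, -, a5, a6⟩ := hw (y := t) (by rw [Real.dist_eq, abs_lt]; exact ⟨t1, t2⟩)
      (by rintro rfl; simp at ht') e he ht'
    obtain ⟨b1, -, b3, b4, -, -⟩ := hw (y := u) (by rw [Real.dist_eq, abs_lt]; exact ⟨u1, u2⟩)
      (by rintro rfl; simp at hu') (-e) (neg_sign he) hu'
    have k := c.frame_tvec_dot t₀ t (c.lift u)
    have ee := mul_self_of_sign he
    have k2 : (c.tvec t₀ ⬝ᵥ c.tvec t₀) ^ 2 * (c.sideSign 1 t₀ * (c.tvec t ⬝ᵥ c.lift u)) =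
        (c.sideSign 1 t₀ * (c.tvec t₀ ⬝ᵥ c.lift u)) * c.coefT t₀ t +
        (-e * (c.covB t₀ ⬝ᵥ c.lift u)) * (c.sideSign 1 t₀ * e * c.coefB t₀ t) +
        (c.covA t₀ ⬝ᵥ c.lift u) * (c.sideSign 1 t₀ * c.coefA t₀ t) := by
      linear_combination c.sideSign 1 t₀ * k +
        (c.covB t₀ ⬝ᵥ c.lift u) * c.sideSign 1 t₀ * c.coefB t₀ t * ee
    have k3 := add_pos (add_pos (mul_pos b4 a2) (mul_pos b3 a6)) (mul_pos b1 a5)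
    rw [← k2] at k3
    exact pos_of_mul_pos_right k3 (pow_pos hn 2).le
  rcases le_total t₀ t with ht' | ht' <;> rcases le_total t₀ u with hu' | hu'
  · exact h₁ t u (by linarith) (by linarith) (by linarith) (by linarith) hne
  · rcases ht'.eq_or_lt with rfl | ht''
    · exact h₂ _ u (by linarith) (by linarith) (by linarith) (by linarith) hne
    rcases hu'.eq_or_lt with rfl | hu''
    · exact h₁ t _ (by linarith) (by linarith) (by linarith) (by linarith) hne
    exact opp 1 (Or.inl rfl) (by linarith) (by linarith)
  · rcases ht'.eq_or_lt with rfl | ht''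
    · exact h₁ _ u (by linarith) (by linarith) (by linarith) (by linarith) hne
    rcases hu'.eq_or_lt with rfl | hu''
    · exact h₂ t _ (by linarith) (by linarith) (by linarith) (by linarith) hne
    exact opp (-1) (Or.inr rfl) (by linarith) (by linarith)
  · exact h₂ t u (by linarith) (by linarith) (by linarith) (by linarith) hne

end ClosedCurve

/-! ### Intersections of a curve with the lines near a given one -/

namespace ClosedCurve

variable (c : ClosedCurve)

theorem tendsto_dot_prod (D₀ : Fin 3 → ℝ) (u₀ : ℝ) :
    Tendsto (fun z : (Fin 3 → ℝ) × ℝ => z.1 ⬝ᵥ c.lift z.2) (𝓝 D₀ ×ˢ 𝓝 u₀) (𝓝 (D₀ ⬝ᵥ c.lift u₀)) :=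
  tendsto_dotProduct tendsto_fst ((c.continuous_lift.tendsto u₀).comp tendsto_snd)

theorem tendsto_dot_deriv_prod (D₀ : Fin 3 → ℝ) (u₀ : ℝ) :
    Tendsto (fun z : (Fin 3 → ℝ) × ℝ => z.1 ⬝ᵥ deriv c.lift z.2) (𝓝 D₀ ×ˢ 𝓝 u₀)
      (𝓝 (D₀ ⬝ᵥ deriv c.lift u₀)) :=
  tendsto_dotProduct tendsto_fst ((c.continuous_deriv_lift.tendsto u₀).comp tendsto_snd)

/-- A property which holds near `(F, u₀)` holds on all sufficiently small windows around `u₀`. -/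
theorem _root_.FabriciusBjerre.eventually_window {α : Type*} {F : Filter α} {u₀ : ℝ} {p : α → ℝ → Prop}
    (h : ∀ᶠ z in F ×ˢ 𝓝 u₀, p z.1 z.2) :
    ∀ᶠ δ in 𝓝[>] (0 : ℝ), ∀ᶠ x in F, ∀ u ∈ Ioo (u₀ - δ) (u₀ + δ), p x u := by
  obtain ⟨P, hP, Q, hQ, h⟩ := eventually_prod_iff.1 h
  obtain ⟨r, hr, hQ⟩ := Metric.eventually_nhds_iff.1 hQ
  filter_upwards [Ioo_mem_nhdsGT hr] with δ hδ
  filter_upwards [hP] with x hx u hu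
  refine h hx (hQ ?_)
  rw [Real.dist_eq, abs_lt]
  constructor <;> linarith [hu.1, hu.2, hδ.2]

theorem _root_.FabriciusBjerre.eventually_pos_gt (r : ℝ) (hr : 0 < r) : ∀ᶠ δ in 𝓝[>] (0 : ℝ), 0 < δ ∧ δ < r := by
  filter_upwards [Ioo_mem_nhdsGT hr] with δ hδ using hδ

/-- Near a transverse intersection with `D₀`, each line close to `D₀` has exactly one intersection. -/
theorem transverse_window {D₀ : Fin 3 → ℝ} {u₀ : ℝ} (h0 : D₀ ⬝ᵥ c.lift u₀ = 0)
    (h' : D₀ ⬝ᵥ deriv c.lift u₀ ≠ 0) : ∀ᶠ δ in 𝓝[>] (0 : ℝ), ∀ᶠ D in 𝓝 D₀,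
      (∀ u ∈ Ioo (u₀ - δ) (u₀ + δ), D ⬝ᵥ deriv c.lift u ≠ 0) ∧
      (∀ u ∈ Ioo (u₀ - δ) (u₀ + δ), ∀ v ∈ Ioo (u₀ - δ) (u₀ + δ), u ≤ v →
        (D₀ ⬝ᵥ deriv c.lift u₀) ^ 2 / 2 * (v - u) ≤
          (D₀ ⬝ᵥ deriv c.lift u₀) * (D ⬝ᵥ c.lift v - D ⬝ᵥ c.lift u)) ∧
      ∃ u₁ ∈ Ioo (u₀ - δ) (u₀ + δ), ∀ u ∈ Ioo (u₀ - δ) (u₀ + δ), D ⬝ᵥ c.lift u = 0 ↔ u = u₁ := by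
  set κ := D₀ ⬝ᵥ deriv c.lift u₀ with hκ
  have hκ2 : 0 < κ ^ 2 := by positivity
  have h1 : ∀ᶠ z in 𝓝 D₀ ×ˢ 𝓝 u₀, κ ^ 2 / 2 < κ * (z.1 ⬝ᵥ deriv c.lift z.2) := by
    have := (c.tendsto_dot_deriv_prod D₀ u₀).const_mul κ
    refine this.eventually (lt_mem_nhds ?_)
    rw [← hκ]; nlinarith
  filter_upwards [eventually_window (p := fun D u => κ ^ 2 / 2 < κ * (D ⬝ᵥ deriv c.lift u)) h1,
    self_mem_nhdsWithin] with δ hδ hpos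
  have hpos : 0 < δ := hpos
  have hmono : ∀ D : Fin 3 → ℝ, (∀ u ∈ Ioo (u₀ - δ) (u₀ + δ), κ ^ 2 / 2 < κ * (D ⬝ᵥ deriv c.lift u)) →
      ∀ u ∈ Ioo (u₀ - δ) (u₀ + δ), ∀ v ∈ Ioo (u₀ - δ) (u₀ + δ), u ≤ v →
        κ ^ 2 / 2 * (v - u) ≤ κ * (D ⬝ᵥ c.lift v - D ⬝ᵥ c.lift u) := by
    intro D hD u hu v hv huv
    have hder : ∀ x, HasDerivAt (fun u => κ * (D ⬝ᵥ c.lift u)) (κ * (D ⬝ᵥ deriv c.lift x)) x :=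
      fun x => (c.hasDerivAt_dot D x).const_mul κ
    have := (convex_Ioo (u₀ - δ) (u₀ + δ)).mul_sub_le_image_sub_of_le_deriv
      (f := fun u => κ * (D ⬝ᵥ c.lift u)) (C := κ ^ 2 / 2)
      (fun x _ => (hder x).continuousAt.continuousWithinAt)
      (fun x _ => (hder x).differentiableAt.differentiableWithinAt)
      (fun x hx => by rw [(hder x).deriv]; rw [interior_Ioo] at hx; exact (hD x hx).le) u hu v hv huv
    linarith
  have hm0 := hmono D₀ hδ.self_of_nhds
  have hl : κ * (D₀ ⬝ᵥ c.lift (u₀ - δ / 2)) < 0 := by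
    have := hm0 (u₀ - δ / 2) ⟨by linarith, by linarith⟩ u₀ ⟨by linarith, by linarith⟩ (by linarith)
    rw [h0] at this
    nlinarith
  have hr : 0 < κ * (D₀ ⬝ᵥ c.lift (u₀ + δ / 2)) := by
    have := hm0 u₀ ⟨by linarith, by linarith⟩ (u₀ + δ / 2) ⟨by linarith, by linarith⟩ (by linarith)
    rw [h0] at this
    nlinarith
  have hc : ∀ u, Tendsto (fun D : Fin 3 → ℝ => κ * (D ⬝ᵥ c.lift u)) (𝓝 D₀) (𝓝 (κ * (D₀ ⬝ᵥ c.lift u))) :=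
    fun u => (tendsto_dotProduct tendsto_id tendsto_const_nhds).const_mul κ
  filter_upwards [hδ, (hc _).eventually (gt_mem_nhds hl), (hc _).eventually (lt_mem_nhds hr)] with D hD hDl hDr
  have hmD := hmono D hD
  refine ⟨fun u hu h => ?_, hmD, ?_⟩
  · have := hD u hu
    rw [h] at this; linarith
  · have hcont : ContinuousOn (fun u => κ * (D ⬝ᵥ c.lift u)) (Icc (u₀ - δ / 2) (u₀ + δ / 2)) :=
      fun x _ => ((c.hasDerivAt_dot D x).const_mul κ).continuousAt.continuousWithinAt
    obtain ⟨u₁, hu₁, hz⟩ := intermediate_value_Icc (by linarith) hcont ⟨hDl.le, hDr.le⟩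
    have hz : D ⬝ᵥ c.lift u₁ = 0 := (mul_eq_zero.1 hz).resolve_left h'
    have hu₁' : u₁ ∈ Ioo (u₀ - δ) (u₀ + δ) := ⟨by linarith [hu₁.1], by linarith [hu₁.2]⟩
    refine ⟨u₁, hu₁', fun u hu => ⟨fun h => ?_, fun h => h ▸ hz⟩⟩
    rcases lt_trichotomy u u₁ with hlt | heq | hlt
    · have := hmD u hu u₁ hu₁' hlt.le
      rw [h, hz] at this; nlinarith
    · exact heq
    · have := hmD u₁ hu₁' u hu hlt.le
      rw [h, hz] at this; nlinarith

/-- A line meets a convex window of the curve in at most two points: in a linear relation between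
three collinear points, the tangents at these points force the coefficients to have pairwise
opposite signs. -/
theorem no_three_zeros {ν : ℝ} {s : Set ℝ}
    (h : ∀ t ∈ s, ∀ u ∈ s, t ≠ u → 0 < ν * (c.tvec t ⬝ᵥ c.lift u)) {D : Fin 3 → ℝ} (hD : D ≠ 0)
    {x y z : ℝ} (hx : x ∈ s) (hy : y ∈ s) (hz : z ∈ s) (hxy : x ≠ y) (hxz : x ≠ z) (hyz : y ≠ z)
    (h1 : D ⬝ᵥ c.lift x = 0) (h2 : D ⬝ᵥ c.lift y = 0) (h3 : D ⬝ᵥ c.lift z = 0) : False := by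
  have hdet : (Matrix.of ![c.lift x, c.lift y, c.lift z]).det = 0 := by
    refine Matrix.exists_mulVec_eq_zero_iff.1 ⟨D, hD, ?_⟩
    ext i
    rw [Matrix.mulVec, dotProduct_comm]
    fin_cases i <;> simpa
  obtain ⟨v, hv, hrel⟩ := Matrix.exists_vecMul_eq_zero_iff.2 hdet
  have hrel' : v 0 • c.lift x + v 1 • c.lift y + v 2 • c.lift z = 0 := by
    rw [← hrel]
    ext i
    simp [Matrix.vecMul, dotProduct, Fin.sum_univ_three]
  have hap : ∀ t, v 0 * (c.tvec t ⬝ᵥ c.lift x) + v 1 * (c.tvec t ⬝ᵥ c.lift y) +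
      v 2 * (c.tvec t ⬝ᵥ c.lift z) = 0 := by
    intro t
    have := congrArg (fun w => c.tvec t ⬝ᵥ w) hrel'
    simpa [dotProduct_add, dotProduct_smul] using this
  have ex := hap x
  have ey := hap y
  have ez := hap z
  rw [tvec_dot_lift] at ex ey ez
  -- Opposite signs, from a relation with positive coefficients.
  have opp : ∀ {a b p q : ℝ}, 0 < ν * p → 0 < ν * q → a * p + b * q = 0 →
      a * b ≤ 0 ∧ (a = 0 ↔ b = 0) := by
    intro a b p q hp hq hab
    have hpq : 0 < p * q := by
      have := mul_pos hp hq
      have e : ν * p * (ν * q) = ν ^ 2 * (p * q) := by ring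
      rw [e] at this
      exact pos_of_mul_pos_right this (sq_nonneg ν)
    have hp0 : p ≠ 0 := by rintro rfl; simp at hpq
    have hq0 : q ≠ 0 := by rintro rfl; simp at hpq
    refine ⟨?_, ?_, ?_⟩
    · have e : (p * q) * (a * b) = -(a * p) ^ 2 := by
        have : b * q = -(a * p) := by linarith
        calc (p * q) * (a * b) = (a * p) * (b * q) := by ring
          _ = -(a * p) ^ 2 := by rw [this]; ring
      by_contra hcon
      have := mul_pos hpq (not_le.1 hcon)
      nlinarith [sq_nonneg (a * p)]
    · rintro rfl
      simpa [hq0] using hab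
    · rintro rfl
      simpa [hp0] using hab
  obtain ⟨o1, o1'⟩ := opp (h x hx y hy hxy) (h x hx z hz hxz) (by linarith : v 1 * _ + v 2 * _ = 0)
  obtain ⟨o2, o2'⟩ := opp (h y hy x hx hxy.symm) (h y hy z hz hyz) (by linarith : v 0 * _ + v 2 * _ = 0)
  obtain ⟨o3, o3'⟩ := opp (h z hz x hx hxz.symm) (h z hz y hy hyz.symm) (by linarith : v 0 * _ + v 1 * _ = 0)
  have hprod : 0 ≤ (v 1 * v 2) * (v 0 * v 2) * (v 0 * v 1) := by
    have : (v 1 * v 2) * (v 0 * v 2) * (v 0 * v 1) = (v 0 * v 1 * v 2) ^ 2 := by ring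
    rw [this]; positivity
  have h0 : v 0 = 0 := by
    by_contra hne
    have h1' : v 1 ≠ 0 := fun h => hne (o3'.2 h)
    have h2' : v 2 ≠ 0 := fun h => hne (o2'.2 h)
    have a1 := lt_of_le_of_ne o1 (mul_ne_zero h1' h2')
    have a2 := lt_of_le_of_ne o2 (mul_ne_zero hne h2')
    have a3 := lt_of_le_of_ne o3 (mul_ne_zero hne h1')
    have := mul_neg_of_pos_of_neg (mul_pos_of_neg_of_neg a1 a2) a3
    linarith
  apply hv
  ext i
  fin_cases i
  · exact h0
  · exact o3'.1 h0
  · exact o2'.1 h0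

/-- The convex window, with the window size as an eventual parameter. -/
theorem eventually_convex_window {u₀ : ℝ} (hf : ¬ c.IsFlex u₀) : ∀ᶠ δ in 𝓝[>] (0 : ℝ),
    ∀ t ∈ Ioo (u₀ - δ) (u₀ + δ), ∀ u ∈ Ioo (u₀ - δ) (u₀ + δ), t ≠ u →
      0 < c.sideSign 1 u₀ * (c.tvec t ⬝ᵥ c.lift u) := by
  obtain ⟨r, hr, h⟩ := c.exists_convex_window hf
  filter_upwards [Ioo_mem_nhdsGT hr] with δ hδ t ht u hu
  refine h t u ?_ ?_ <;> rw [abs_lt] <;> constructor <;> linarith [ht.1, ht.2, hu.1, hu.2, hδ.2]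

theorem exists_zero_between {D : Fin 3 → ℝ} {ν u v : ℝ} (hu : ν * (D ⬝ᵥ c.lift u) < 0)
    (hv : 0 < ν * (D ⬝ᵥ c.lift v)) : ∃ w ∈ uIcc u v, w ≠ u ∧ w ≠ v ∧ D ⬝ᵥ c.lift w = 0 := by
  have hcont : ContinuousOn (fun u => ν * (D ⬝ᵥ c.lift u)) (uIcc u v) :=
    fun x _ => ((c.hasDerivAt_dot D x).const_mul ν).continuousAt.continuousWithinAt
  obtain ⟨w, hw, hz⟩ := intermediate_value_uIcc hcont (mem_uIcc.2 (Or.inl ⟨hu.le, hv.le⟩))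
  have hz : ν * (D ⬝ᵥ c.lift w) = 0 := hz
  refine ⟨w, hw, ?_, ?_, ?_⟩
  · rintro rfl; linarith
  · rintro rfl; linarith
  · rcases mul_eq_zero.1 hz with h | h
    · rw [h] at hu; simp at hu
    · exact h

/-- A line close to the tangent at `u₀` lies on the convex side of the curve at `u₀ ± δ/2`. -/
theorem eventually_ends {u₀ κ : ℝ} (hκ : κ ≠ 0) {δ : ℝ} (hδ : 0 < δ)
    (h : ∀ t ∈ Ioo (u₀ - δ) (u₀ + δ), ∀ u ∈ Ioo (u₀ - δ) (u₀ + δ), t ≠ u →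
      0 < c.sideSign 1 u₀ * (c.tvec t ⬝ᵥ c.lift u)) : ∀ᶠ D in 𝓝 (κ • c.tvec u₀), D ≠ 0 ∧
      ∀ e : ℝ, e = 1 ∨ e = -1 → 0 < κ * c.sideSign 1 u₀ * (D ⬝ᵥ c.lift (u₀ + e * (δ / 2))) := by
  have h0 : κ • c.tvec u₀ ≠ 0 := smul_ne_zero hκ (c.tvec_ne_zero u₀)
  have key : ∀ e : ℝ, e = 1 ∨ e = -1 → ∀ᶠ D in 𝓝 (κ • c.tvec u₀),
      0 < κ * c.sideSign 1 u₀ * (D ⬝ᵥ c.lift (u₀ + e * (δ / 2))) := by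
    intro e he
    have hc : Tendsto (fun D : Fin 3 → ℝ => κ * c.sideSign 1 u₀ * (D ⬝ᵥ c.lift (u₀ + e * (δ / 2))))
        (𝓝 (κ • c.tvec u₀)) _ := (tendsto_dotProduct tendsto_id tendsto_const_nhds).const_mul _
    refine hc.eventually (lt_mem_nhds ?_)
    have := h u₀ ⟨by linarith, by linarith⟩ (u₀ + e * (δ / 2))
      (by rcases he with rfl | rfl <;> constructor <;> linarith)
      (by rcases he with rfl | rfl <;> intro h <;> linarith)
    rw [smul_dotProduct, smul_eq_mul]
    have := mul_pos (sq_pos_of_ne_zero hκ) this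
    nlinarith
  filter_upwards [key 1 (Or.inl rfl), key (-1) (Or.inr rfl), isOpen_ne.mem_nhds h0] with D h1 h2 h3
  refine ⟨h3, ?_⟩
  rintro e (rfl | rfl) <;> assumption

theorem transverse_of_two_zeros {ν : ℝ} {s : Set ℝ}
    (h : ∀ t ∈ s, ∀ u ∈ s, t ≠ u → 0 < ν * (c.tvec t ⬝ᵥ c.lift u)) {D : Fin 3 → ℝ} (hD : D ≠ 0)
    {x y : ℝ} (hx : x ∈ s) (hy : y ∈ s) (hxy : x ≠ y) (h1 : D ⬝ᵥ c.lift x = 0)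
    (h2 : D ⬝ᵥ c.lift y = 0) : D ⬝ᵥ deriv c.lift x ≠ 0 := by
  intro h3
  have e := c.eq_smul_tvec h1 h3
  rw [e, smul_dotProduct, smul_eq_mul] at h2
  have := h x hx y hy hxy
  rcases mul_eq_zero.1 h2 with h4 | h4
  · rw [h4, zero_smul] at e; exact hD e
  · rw [h4] at this; simp at this

/-- A line close to a tangent `κ T` at `u₀` which separates the point at `u₀` from its neighbours meets
the curve near `u₀` in exactly two points, transversely. -/
theorem tangent_window_two {u₀ κ : ℝ} (hf : ¬ c.IsFlex u₀) (hκ : κ ≠ 0) : ∀ᶠ δ in 𝓝[>] (0 : ℝ),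
    ∀ᶠ D in 𝓝 (κ • c.tvec u₀), κ * c.sideSign 1 u₀ * (D ⬝ᵥ c.lift u₀) < 0 →
      ∃ u₁ ∈ Ioo (u₀ - δ) (u₀ + δ), ∃ u₂ ∈ Ioo (u₀ - δ) (u₀ + δ), u₁ ≠ u₂ ∧
        (∀ u ∈ Ioo (u₀ - δ) (u₀ + δ), D ⬝ᵥ c.lift u = 0 ↔ u = u₁ ∨ u = u₂) ∧
        D ⬝ᵥ deriv c.lift u₁ ≠ 0 ∧ D ⬝ᵥ deriv c.lift u₂ ≠ 0 := by
  filter_upwards [c.eventually_convex_window hf, self_mem_nhdsWithin] with δ hcv hpos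
  have hpos : 0 < δ := hpos
  filter_upwards [c.eventually_ends hκ hpos hcv] with D ⟨hD, hends⟩ hneg
  obtain ⟨u₁, m1, n1, -, z1⟩ := c.exists_zero_between hneg (hends 1 (Or.inl rfl))
  obtain ⟨u₂, m2, n2, -, z2⟩ := c.exists_zero_between hneg (hends (-1) (Or.inr rfl))
  rw [uIcc_of_le (by linarith)] at m1
  rw [uIcc_of_ge (by linarith)] at m2
  have l1 : u₀ < u₁ := lt_of_le_of_ne m1.1 n1.symm
  have l2 : u₂ < u₀ := lt_of_le_of_ne m2.2 n2
  have i1 : u₁ ∈ Ioo (u₀ - δ) (u₀ + δ) := ⟨by linarith, by linarith [m1.2]⟩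
  have i2 : u₂ ∈ Ioo (u₀ - δ) (u₀ + δ) := ⟨by linarith [m2.1], by linarith⟩
  have hne : u₁ ≠ u₂ := (l2.trans l1).ne'
  refine ⟨u₁, i1, u₂, i2, hne, fun u hu => ⟨fun h => ?_, ?_⟩, ?_, ?_⟩
  · by_contra! hcon
    exact c.no_three_zeros hcv hD hu i1 i2 hcon.1 hcon.2 hne h z1 z2
  · rintro (rfl | rfl) <;> assumption
  · exact c.transverse_of_two_zeros hcv hD i1 i2 hne z1 z2
  · exact c.transverse_of_two_zeros hcv hD i2 i1 hne.symm z2 z1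

/-- Lines `κ T + s E` close to the tangent `T` at `u₀`, on the side of the tangent away from the
curve at the point `u₀`, do not meet the curve near `u₀`. -/
theorem tangent_window_none {α : Type*} {F : Filter α} {u₀ κ : ℝ} (hf : ¬ c.IsFlex u₀)
    {D E : α → Fin 3 → ℝ} {s : α → ℝ} {E₀ : Fin 3 → ℝ} (hE : Tendsto E F (𝓝 E₀))
    (hDE : ∀ᶠ x in F, D x = κ • c.tvec u₀ + s x • E x)
    (hs : ∀ᶠ x in F, 0 < κ * c.sideSign 1 u₀ * s x * (E₀ ⬝ᵥ c.lift u₀)) :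
    ∀ᶠ δ in 𝓝[>] (0 : ℝ), ∀ᶠ x in F, ∀ u ∈ Ioo (u₀ - δ) (u₀ + δ), D x ⬝ᵥ c.lift u ≠ 0 := by
  rcases F.eq_or_neBot with rfl | hF
  · simp
  have he0 : E₀ ⬝ᵥ c.lift u₀ ≠ 0 := by
    intro h
    obtain ⟨x, hx⟩ := hs.exists
    rw [h, mul_zero] at hx; exact lt_irrefl _ hx
  have h1 : ∀ᶠ z in F ×ˢ 𝓝 u₀, 0 < (E₀ ⬝ᵥ c.lift u₀) * (E z.1 ⬝ᵥ c.lift z.2) := by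
    have : Tendsto (fun z : α × ℝ => (E₀ ⬝ᵥ c.lift u₀) * (E z.1 ⬝ᵥ c.lift z.2)) (F ×ˢ 𝓝 u₀) _ :=
      (tendsto_dotProduct (hE.comp tendsto_fst)
        ((c.continuous_lift.tendsto u₀).comp tendsto_snd)).const_mul (E₀ ⬝ᵥ c.lift u₀)
    exact this.eventually (lt_mem_nhds (mul_self_pos.2 he0))
  filter_upwards [c.eventually_convex_window hf,
    eventually_window (p := fun x u => 0 < (E₀ ⬝ᵥ c.lift u₀) * (E x ⬝ᵥ c.lift u)) h1,
    self_mem_nhdsWithin] with δ hcv hδ hpos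
  have hpos : 0 < δ := hpos
  filter_upwards [hDE, hs, hδ] with x hx hsx hEx u hu hzero
  have hge : 0 ≤ κ * c.sideSign 1 u₀ * ((κ • c.tvec u₀) ⬝ᵥ c.lift u) := by
    rw [smul_dotProduct, smul_eq_mul]
    by_cases huu : u₀ = u
    · rw [← huu, tvec_dot_lift]; simp
    · have := hcv u₀ ⟨by linarith, by linarith⟩ u hu huu
      nlinarith [mul_nonneg (sq_nonneg κ) this.le]
  have hgt := mul_pos hsx (hEx u hu)
  rw [hx, add_dotProduct, smul_dotProduct (s x), smul_eq_mul] at hzero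
  have e : κ * c.sideSign 1 u₀ * s x * (E₀ ⬝ᵥ c.lift u₀) * ((E₀ ⬝ᵥ c.lift u₀) * (E x ⬝ᵥ c.lift u)) =
      -((E₀ ⬝ᵥ c.lift u₀) ^ 2 * (κ * c.sideSign 1 u₀ * ((κ • c.tvec u₀) ⬝ᵥ c.lift u))) := by
    linear_combination (κ * c.sideSign 1 u₀ * (E₀ ⬝ᵥ c.lift u₀) ^ 2) * hzero
  rw [e] at hgt
  have := mul_nonneg (sq_nonneg (E₀ ⬝ᵥ c.lift u₀)) hge
  linarith

/-- A line through the point at `u₀`, close to the tangent there but different from it, has exactly one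
further intersection with the curve near `u₀`. -/
theorem tangent_window_pencil {u₀ κ : ℝ} (hf : ¬ c.IsFlex u₀) (hκ : κ ≠ 0) : ∀ᶠ δ in 𝓝[>] (0 : ℝ),
    ∀ᶠ D in 𝓝 (κ • c.tvec u₀), D ⬝ᵥ c.lift u₀ = 0 → D ⬝ᵥ deriv c.lift u₀ ≠ 0 →
      ∃ u₁ ∈ Ioo (u₀ - δ) (u₀ + δ), u₀ ≠ u₁ ∧
        ∀ u ∈ Ioo (u₀ - δ) (u₀ + δ), D ⬝ᵥ c.lift u = 0 ↔ u = u₀ ∨ u = u₁ := by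
  filter_upwards [c.eventually_convex_window hf, self_mem_nhdsWithin] with δ hcv hpos
  have hpos : 0 < δ := hpos
  filter_upwards [c.eventually_ends hκ hpos hcv] with D ⟨hD, hends⟩ h0 h0'
  have i0 : u₀ ∈ Ioo (u₀ - δ) (u₀ + δ) := ⟨by linarith, by linarith⟩
  set ρ := κ * c.sideSign 1 u₀ with hρ
  have hρ0 : ρ ≠ 0 := by
    intro h; have := hends 1 (Or.inl rfl); rw [h] at this; simp at this
  have hd : HasDerivAt (fun u => ρ * (D ⬝ᵥ c.lift u)) (ρ * (D ⬝ᵥ deriv c.lift u₀)) u₀ :=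
    (c.hasDerivAt_dot D u₀).const_mul ρ
  have hne : ρ * (D ⬝ᵥ deriv c.lift u₀) ≠ 0 := mul_ne_zero hρ0 h0'
  -- The side on which the line passes between the curve and its tangent.
  obtain ⟨e, he, hes⟩ : ∃ e : ℝ, (e = 1 ∨ e = -1) ∧ e * (ρ * (D ⬝ᵥ deriv c.lift u₀)) < 0 := by
    rcases lt_or_gt_of_ne hne with h | h
    · exact ⟨1, Or.inl rfl, by linarith⟩
    · exact ⟨-1, Or.inr rfl, by linarith⟩
  have hev := eventually_side_sign hd (by rw [h0, mul_zero]) hne e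
  have := side_neBot he u₀
  obtain ⟨v, ⟨hv1, hv2⟩, hv3⟩ := ((hev.and (eventually_side_pos e u₀)).and
    (eventually_side_lt e u₀ (half_pos hpos))).exists
  have hvneg : ρ * (D ⬝ᵥ c.lift v) < 0 := by
    by_contra hcon
    have := mul_nonpos_of_nonpos_of_nonneg hes.le (not_lt.1 hcon)
    linarith
  obtain ⟨u₁, m1, n1, -, z1⟩ := c.exists_zero_between hvneg (hends e he)
  have hu1 : 0 < e * (u₁ - u₀) ∧ e * (u₁ - u₀) < δ := by
    rcases he with rfl | rfl
    · rw [uIcc_of_le (by linarith)] at m1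
      constructor <;> linarith [m1.1, m1.2]
    · rw [uIcc_of_ge (by linarith)] at m1
      constructor <;> linarith [m1.1, m1.2]
  have i1 : u₁ ∈ Ioo (u₀ - δ) (u₀ + δ) := by
    rcases he with rfl | rfl <;> constructor <;> linarith
  have hne1 : u₀ ≠ u₁ := by rintro rfl; simp at hu1
  refine ⟨u₁, i1, hne1, fun u hu => ⟨fun h => ?_, ?_⟩⟩
  · by_contra! hcon
    exact c.no_three_zeros hcv hD hu i0 i1 hcon.1 hcon.2 hne1 h h0 z1
  · rintro (rfl | rfl) <;> assumption

end ClosedCurve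

/-! ### Sums of jumps of locally constant functions -/

theorem finite_of_isolated {K : Set ℝ} (hK : IsCompact K) {p : ℝ → Prop}
    (h : ∀ t ∈ K, ∀ᶠ s in 𝓝[≠] t, ¬ p s) : {t | t ∈ K ∧ p t}.Finite := by
  by_contra hinf
  obtain ⟨x, hx, hacc⟩ := Set.Infinite.exists_accPt_of_subset_isCompact hinf hK (fun y hy => hy.1)
  rw [accPt_iff_frequently_nhdsNE] at hacc
  obtain ⟨y, hy, hy'⟩ := (hacc.and_eventually (h x hx)).exists
  exact hy' hy.2

theorem eventually_right_const {f : ℝ → ℤ} {x : ℝ} {v : ℤ} (h : ∀ᶠ y in 𝓝[>] x, f y = v) :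
    ∀ᶠ y in 𝓝[>] x, ∀ᶠ z in 𝓝 y, f z = v := by
  filter_upwards [eventually_eventually_nhdsWithin.2 h, self_mem_nhdsWithin] with y hy hxy
  rwa [IsOpen.nhdsWithin_eq isOpen_Ioi hxy] at hy

theorem eventually_left_const {f : ℝ → ℤ} {x : ℝ} {v : ℤ} (h : ∀ᶠ y in 𝓝[<] x, f y = v) :
    ∀ᶠ y in 𝓝[<] x, ∀ᶠ z in 𝓝 y, f z = v := by
  filter_upwards [eventually_eventually_nhdsWithin.2 h, self_mem_nhdsWithin] with y hy hxy
  rwa [IsOpen.nhdsWithin_eq isOpen_Iio hxy] at hy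

/-- The jumps of an integer valued function with one-sided limits add up to its total variation:
if `r` and `l` are the right and left limits, the sum of `r - l` over the open interval `(a, b)`
is `l b - r a`. -/
theorem sum_jumps {a b : ℝ} (hab : a < b) {f r l : ℝ → ℤ}
    (hr : ∀ x ∈ Ico a b, ∀ᶠ y in 𝓝[>] x, f y = r x) (hl : ∀ x ∈ Ioc a b, ∀ᶠ y in 𝓝[<] x, f y = l x) :
    {x | x ∈ Ioo a b ∧ r x ≠ l x}.Finite ∧ ∑ᶠ x ∈ Ioo a b, (r x - l x) = l b - r a := by
  have hrl : ∀ y ∈ Ioo a b, ∀ v, (∀ᶠ z in 𝓝 y, f z = v) → r y = v ∧ l y = v := by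
    intro y hy v hv
    constructor
    · obtain ⟨z, h1, h2⟩ := ((hr y (Ioo_subset_Ico_self hy)).and (hv.filter_mono nhdsWithin_le_nhds)).exists
      exact h1.symm.trans h2
    · obtain ⟨z, h1, h2⟩ := ((hl y (Ioo_subset_Ioc_self hy)).and (hv.filter_mono nhdsWithin_le_nhds)).exists
      exact h1.symm.trans h2
  have hR : ∀ x ∈ Ico a b, ∀ᶠ y in 𝓝[>] x, y ∈ Ioo a b → r y = r x ∧ l y = r x := fun x hx =>
    (eventually_right_const (hr x hx)).mono fun y hy hy' => hrl y hy' _ hy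
  have hL : ∀ x ∈ Ioc a b, ∀ᶠ y in 𝓝[<] x, y ∈ Ioo a b → r y = l x ∧ l y = l x := fun x hx =>
    (eventually_left_const (hl x hx)).mono fun y hy hy' => hrl y hy' _ hy
  have hfin : {x | x ∈ Ioo a b ∧ r x ≠ l x}.Finite := by
    refine (finite_of_isolated (K := Icc a b) isCompact_Icc (p := fun x => x ∈ Ioo a b ∧ r x ≠ l x)
      fun t ht => ?_).subset fun x hx => ⟨Ioo_subset_Icc_self hx.1, hx⟩
    rw [← Iio_union_Ioi, nhdsWithin_union, eventually_sup]
    constructor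
    · rcases ht.1.eq_or_lt with rfl | h
      · filter_upwards [self_mem_nhdsWithin] with y hy hcon
        exact absurd hcon.1.1 (not_lt.2 (le_of_lt hy))
      · filter_upwards [hL t ⟨h, ht.2⟩] with y hy hcon
        exact hcon.2 ((hy hcon.1).1.trans (hy hcon.1).2.symm)
    · rcases ht.2.eq_or_lt with rfl | h
      · filter_upwards [self_mem_nhdsWithin] with y hy hcon
        exact absurd hcon.1.2 (not_lt.2 (le_of_lt hy))
      · filter_upwards [hR t ⟨ht.1, h⟩] with y hy hcon
        exact hcon.2 ((hy hcon.1).1.trans (hy hcon.1).2.symm)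
  refine ⟨hfin, ?_⟩
  set S := hfin.toFinset with hS
  have hmem : ∀ x, x ∈ S ↔ x ∈ Ioo a b ∧ r x ≠ l x := fun x => by simp [hS]
  have hsum : ∑ᶠ x ∈ Ioo a b, (r x - l x) = ∑ x ∈ S, (r x - l x) := by
    refine finsum_mem_eq_sum_of_inter_support_eq _ ?_
    ext x
    simp [hmem, sub_eq_zero]
  rw [hsum]
  -- The partial sums of the jumps differ from `l` by a constant.
  set G : ℝ → ℤ := fun y => ∑ x ∈ S with x < y, (r x - l x) with hG
  have hstepR : ∀ x ∈ Ico a b, ∀ᶠ y in 𝓝[>] x, y ∈ Ioo a b ∧ G y = ∑ x' ∈ S with x' ≤ x, (r x' - l x') := by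
    intro x hx
    have : ∀ᶠ y in 𝓝[>] x, ∀ x' ∈ S, x < x' → y < x' := by
      rw [eventually_all_finset]
      intro x' _
      by_cases hlt : x < x'
      · exact ((gt_mem_nhds hlt : ∀ᶠ y in 𝓝 x, y < x').filter_mono nhdsWithin_le_nhds).mono fun y hy _ => hy
      · exact Eventually.of_forall fun y h => absurd h hlt
    filter_upwards [this, Ioo_mem_nhdsGT hx.2] with y hy hy'
    refine ⟨⟨hx.1.trans_lt hy'.1, hy'.2⟩, ?_⟩
    rw [hG]
    refine Finset.sum_congr (Finset.filter_congr fun x' hx' => ?_) fun _ _ => rfl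
    exact ⟨fun h => not_lt.1 fun h' => absurd h (not_lt.2 (hy x' hx' h').le), fun h => h.trans_lt hy'.1⟩
  have hstepL : ∀ x ∈ Ioc a b, ∀ᶠ y in 𝓝[<] x, y ∈ Ioo a b ∧ G y = G x := by
    intro x hx
    have : ∀ᶠ y in 𝓝[<] x, ∀ x' ∈ S, x' < x → x' < y := by
      rw [eventually_all_finset]
      intro x' _
      by_cases hlt : x' < x
      · exact ((lt_mem_nhds hlt : ∀ᶠ y in 𝓝 x, x' < y).filter_mono nhdsWithin_le_nhds).mono fun y hy _ => hy
      · exact Eventually.of_forall fun y h => absurd h hlt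
    filter_upwards [this, Ioo_mem_nhdsLT hx.1] with y hy hy'
    refine ⟨⟨hy'.1, hy'.2.trans_le hx.2⟩, ?_⟩
    rw [hG]
    refine Finset.sum_congr (Finset.filter_congr fun x' hx' => ?_) fun _ _ => rfl
    exact ⟨fun h => h.trans hy'.2, fun h => hy x' hx' h⟩
  have hcont : ContinuousOn (fun y => G y - l y) (Ioo a b) := by
    intro x hx
    refine ContinuousAt.continuousWithinAt ?_
    rw [ContinuousAt, nhds_discrete ℤ, tendsto_pure, ← nhdsNE_sup_pure, eventually_sup]
    refine ⟨?_, by simp⟩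
    rw [← Iio_union_Ioi, nhdsWithin_union, eventually_sup]
    constructor
    · filter_upwards [hL x (Ioo_subset_Ioc_self hx), hstepL x (Ioo_subset_Ioc_self hx)] with y h1 h2
      rw [h2.2, (h1 h2.1).2]
    · filter_upwards [hR x (Ioo_subset_Ico_self hx), hstepR x (Ioo_subset_Ico_self hx)] with y h1 h2
      rw [h2.2, (h1 h2.1).2]
      by_cases hxS : x ∈ S
      · have : (S.filter fun x' => x' ≤ x) = insert x (S.filter fun x' => x' < x) := by
          ext z
          simp only [Finset.mem_filter, Finset.mem_insert, le_iff_eq_or_lt]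
          constructor
          · rintro ⟨h, rfl | h'⟩
            · exact Or.inl rfl
            · exact Or.inr ⟨h, h'⟩
          · rintro (rfl | h)
            · exact ⟨hxS, Or.inl rfl⟩
            · exact ⟨h.1, Or.inr h.2⟩
        rw [this, Finset.sum_insert (by simp)]
        simp only [hG]
        ring
      · have : (S.filter fun x' => x' ≤ x) = (S.filter fun x' => x' < x) := by
          refine Finset.filter_congr fun z hz => ?_
          rw [le_iff_eq_or_lt, or_iff_right]
          rintro rfl; exact hxS hz
        have hrl' : r x = l x := by
          by_contra hne; exact hxS ((hmem x).2 ⟨hx, hne⟩)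
        rw [this, hrl']
  obtain ⟨y, hy1, hy2, hy3⟩ := ((hR a ⟨le_rfl, hab⟩).and (hstepR a ⟨le_rfl, hab⟩)).exists
  obtain ⟨z, hz1, hz2, hz3⟩ := ((hL b ⟨hab, le_rfl⟩).and (hstepL b ⟨hab, le_rfl⟩)).exists
  have key : G y - l y = G z - l z := isPreconnected_Ioo.constant hcont hy2 hz2
  rw [hy3, hz3, (hy1 hy2).2, (hz1 hz2).2] at key
  have e1 : (S.filter fun x' => x' ≤ a) = ∅ := by
    refine Finset.filter_eq_empty_iff.2 fun x hx => not_le.2 ((hmem x).1 hx).1.1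
  have e2 : G b = ∑ x ∈ S, (r x - l x) := by
    simp only [hG]
    rw [Finset.filter_true_of_mem fun x hx => ((hmem x).1 hx).1.2]
  rw [e1, e2, Finset.sum_empty] at key
  linarith

/-- On the circle `ℝ/ℤ` the jumps add up to zero. -/
theorem sum_jumps_circle {f r l : ℝ → ℤ} (hf : ∀ x, f (x + 1) = f x)
    (hr : ∀ x ∈ Ico (0 : ℝ) 1, ∀ᶠ y in 𝓝[>] x, f y = r x)
    (hl : ∀ x ∈ Ico (0 : ℝ) 1, ∀ᶠ y in 𝓝[<] x, f y = l x) :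
    ∑ᶠ x ∈ Ico (0 : ℝ) 1, (r x - l x) = 0 := by
  have hl' : ∀ x ∈ Ioc (0 : ℝ) 1, ∀ᶠ y in 𝓝[<] x, f y = (Function.update l 1 (l 0)) x := by
    intro x hx
    rcases hx.2.eq_or_lt with rfl | h
    · rw [Function.update_self]
      have h0 := hl 0 ⟨le_rfl, one_pos⟩
      have ht : Tendsto (fun y : ℝ => y - 1) (𝓝[<] 1) (𝓝[<] 0) := by
        refine tendsto_nhdsWithin_of_tendsto_nhds_of_eventually_within _ ?_ ?_
        · have : Tendsto (fun y : ℝ => y - 1) (𝓝 1) (𝓝 (1 - 1)) := Continuous.tendsto (by fun_prop) _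
          rw [sub_self] at this
          exact this.mono_left nhdsWithin_le_nhds
        · filter_upwards [self_mem_nhdsWithin] with y hy
          exact sub_neg.2 (mem_Iio.1 hy)
      filter_upwards [ht.eventually h0] with y hy
      have := hf (y - 1)
      rw [sub_add_cancel] at this
      rw [this, hy]
    · rw [Function.update_of_ne h.ne]
      exact hl x ⟨hx.1.le, h⟩
  obtain ⟨hfin, hsum⟩ := sum_jumps one_pos hr hl'
  rw [Function.update_self] at hsum
  have e : ∑ᶠ x ∈ Ioo (0 : ℝ) 1, (r x - Function.update l 1 (l 0) x) = ∑ᶠ x ∈ Ioo (0 : ℝ) 1, (r x - l x) :=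
    finsum_mem_congr rfl fun x hx => by rw [Function.update_of_ne hx.2.ne]
  rw [e] at hsum
  have hins : Ico (0 : ℝ) 1 = insert 0 (Ioo 0 1) := (Ioo_insert_left one_pos).symm
  rw [hins, finsum_mem_insert' _ (by simp) ?_, hsum]
  · ring
  · refine hfin.subset fun x hx => ⟨hx.1, ?_⟩
    have := hx.2
    rw [Function.mem_support, sub_ne_zero] at this
    rwa [Function.update_of_ne hx.1.2.ne]

/-! ### Intersections with a line as sums over one period -/

theorem apply_fract {β : Type*} {f : ℝ → β} (hf : ∀ u, f (u + 1) = f u) (u : ℝ) : f (Int.fract u) = f u := by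
  have hp : Function.Periodic f 1 := hf
  have := hp.sub_zsmul_eq (x := u) ⌊u⌋
  rwa [zsmul_one] at this

theorem apply_add_int {β : Type*} {f : ℝ → β} (hf : ∀ u, f (u + 1) = f u) (u : ℝ) (n : ℤ) :
    f (u + n) = f u := by
  rw [← apply_fract hf, Int.fract_add_intCast, apply_fract hf]

/-- The sum of a periodic function over any period. -/
theorem finsum_period {f : ℝ → ℤ} (hf : ∀ u, f (u + 1) = f u) {p : ℝ → Prop}
    (hp : ∀ u, p (u + 1) ↔ p u) (a : ℝ) :
    ∑ᶠ u ∈ {u | u ∈ Ico a (a + 1) ∧ p u}, f u = ∑ᶠ u ∈ {u | u ∈ Ico (0 : ℝ) 1 ∧ p u}, f u := by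
  have hp' : ∀ u, p (Int.fract u) = p u := apply_fract fun u => propext (hp u)
  refine finsum_mem_eq_of_bijOn Int.fract ⟨?_, ?_, ?_⟩ fun u _ => (apply_fract hf u).symm
  · intro u hu
    exact ⟨⟨Int.fract_nonneg u, Int.fract_lt_one u⟩, (hp' u).mpr hu.2⟩
  · intro u hu v hv h
    obtain ⟨n, hn⟩ := Int.fract_eq_fract.1 h
    have h1 : (-1 : ℝ) < n := by rw [← hn]; linarith [hu.1.1, hv.1.2]
    have h2 : (n : ℝ) < 1 := by rw [← hn]; linarith [hu.1.2, hv.1.1]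
    have : n = 0 := by
      have h1' : -1 < n := by exact_mod_cast h1
      have h2' : n < 1 := by exact_mod_cast h2
      omega
    rw [this] at hn
    simp at hn
    linarith
  · rintro u ⟨hu, hpu⟩
    refine ⟨u + ⌈a - u⌉, ⟨⟨?_, ?_⟩, ?_⟩, ?_⟩
    · linarith [Int.le_ceil (a - u)]
    · linarith [Int.ceil_lt_add_one (a - u)]
    · rwa [← hp', Int.fract_add_intCast, hp']
    · rw [Int.fract_add_intCast, Int.fract_eq_self.2 hu]

namespace ClosedCurve

variable (c : ClosedCurve)

theorem dot_lift_add_one (D : Fin 3 → ℝ) (u : ℝ) : D ⬝ᵥ c.lift (u + 1) = 0 ↔ D ⬝ᵥ c.lift u = 0 := by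
  obtain ⟨ε, hε, h⟩ := c.exists_sign
  have : ε ≠ 0 := by rintro rfl; norm_num at hε
  rw [(h u).1, dotProduct_smul, smul_eq_mul, mul_eq_zero, or_iff_right this]

/-- The intersections of the curve with a line are isolated. -/
theorem eventually_dot_ne {D : Fin 3 → ℝ} (hD : D ≠ 0) (u₀ : ℝ) :
    ∀ᶠ u in 𝓝[≠] u₀, D ⬝ᵥ c.lift u ≠ 0 := by
  by_cases h0 : D ⬝ᵥ c.lift u₀ = 0
  · by_cases h1 : D ⬝ᵥ deriv c.lift u₀ = 0
    · have e := c.eq_smul_tvec h0 h1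
      refine eventually_ne_of_side fun s hs => ?_
      filter_upwards [c.eventually_side_sideSign u₀ hs] with u hu hz
      rw [e, smul_dotProduct, smul_eq_mul, mul_eq_zero] at hz
      rcases hz with h | h
      · rw [h, zero_smul] at e; exact hD e
      · rw [h] at hu; simp at hu
    · exact (c.hasDerivAt_dot D u₀).eventually_ne h1
  · exact nhdsWithin_le_nhds (((c.hasDerivAt_dot D u₀).continuousAt).eventually_ne h0)

theorem finite_zeros {D : Fin 3 → ℝ} (hD : D ≠ 0) {s : Set ℝ} {a b : ℝ} (hs : s ⊆ Icc a b) :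
    {u | u ∈ s ∧ D ⬝ᵥ c.lift u = 0}.Finite :=
  (finite_of_isolated (K := Icc a b) isCompact_Icc (p := fun u => D ⬝ᵥ c.lift u = 0)
    fun u _ => c.eventually_dot_ne hD u).subset fun _ hu => ⟨hs hu.1, hu.2⟩

/-- For lines `D x` in a family, the sum of the weights `w x` over the intersections with `c` near `u₀`
is eventually equal to `v`. -/
def HasLocalSum {α : Type*} (F : Filter α) (D : α → Fin 3 → ℝ) (w : α → ℝ → ℤ) (u₀ : ℝ) (v : ℤ) : Prop :=
  ∀ᶠ δ in 𝓝[>] (0 : ℝ), ∀ᶠ x in F,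
    ∑ᶠ u ∈ {u | u ∈ Ioo (u₀ - δ) (u₀ + δ) ∧ D x ⬝ᵥ c.lift u = 0}, w x u = v

theorem HasLocalSum.add_int {c : ClosedCurve} {α : Type*} {F : Filter α} {D : α → Fin 3 → ℝ} {w : α → ℝ → ℤ}
    {u₀ : ℝ} {v : ℤ} (h : c.HasLocalSum F D w u₀ v) (hw : ∀ x u, w x (u + 1) = w x u) (n : ℤ) :
    c.HasLocalSum F D w (u₀ + n) v := by
  unfold HasLocalSum at h ⊢
  filter_upwards [h] with δ hδ
  filter_upwards [hδ] with x hx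
  rw [← hx]
  symm
  have hz : ∀ u, (D x ⬝ᵥ c.lift (u + n) = 0) = (D x ⬝ᵥ c.lift u = 0) := fun u =>
    apply_add_int (f := fun u => D x ⬝ᵥ c.lift u = 0) (fun u => propext (c.dot_lift_add_one (D x) u)) u n
  refine finsum_mem_eq_of_bijOn (fun u => u + n) ⟨?_, ?_, ?_⟩ fun u _ => (apply_add_int (hw x) u n).symm
  · rintro u ⟨h1, h2⟩
    exact ⟨⟨by linarith [h1.1], by linarith [h1.2]⟩, (hz u).mpr h2⟩
  · intro u _ v _ huv
    exact add_right_cancel huv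
  · rintro u ⟨h1, h2⟩
    refine ⟨u - n, ⟨⟨by linarith [h1.1], by linarith [h1.2]⟩, ?_⟩, by simp⟩
    rw [← hz, sub_add_cancel]; exact h2

/-- Weighted intersection numbers localize: the sum over the intersections with a line close to `D₀` is
the sum of the local contributions at the intersections with `D₀`. -/
theorem sum_zeros_eventually {α : Type*} {F : Filter α} {D : α → Fin 3 → ℝ} {D₀ : Fin 3 → ℝ} (h0 : D₀ ≠ 0)
    (hD : Tendsto D F (𝓝 D₀)) {w : α → ℝ → ℤ} (hw : ∀ x u, w x (u + 1) = w x u) {v : ℝ → ℤ}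
    (h : ∀ u ∈ Ico (0 : ℝ) 1, D₀ ⬝ᵥ c.lift u = 0 → c.HasLocalSum F D w u (v u)) :
    ∀ᶠ x in F, ∑ᶠ u ∈ {u | u ∈ Ico (0 : ℝ) 1 ∧ D x ⬝ᵥ c.lift u = 0}, w x u =
      ∑ᶠ u ∈ {u | u ∈ Ico (0 : ℝ) 1 ∧ D₀ ⬝ᵥ c.lift u = 0}, v u := by
  -- A period that starts off the line `D₀` has no intersection at its ends.
  obtain ⟨a, ha⟩ : ∃ a, D₀ ⬝ᵥ c.lift a ≠ 0 := (c.eventually_dot_ne h0 0).exists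
  have ha1 : D₀ ⬝ᵥ c.lift (a + 1) ≠ 0 := fun h => ha ((c.dot_lift_add_one D₀ a).1 h)
  set v' : ℝ → ℤ := fun u => v (Int.fract u) with hv'
  have hloc : ∀ u, D₀ ⬝ᵥ c.lift u = 0 → c.HasLocalSum F D w u (v' u) := by
    intro u hu
    have hz : (D₀ ⬝ᵥ c.lift (Int.fract u) = 0) = (D₀ ⬝ᵥ c.lift u = 0) :=
      apply_fract (f := fun u => D₀ ⬝ᵥ c.lift u = 0) (fun u => propext (c.dot_lift_add_one D₀ u)) u
    have := (h (Int.fract u) ⟨Int.fract_nonneg u, Int.fract_lt_one u⟩ (hz.mpr hu)).add_int hw ⌊u⌋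
    rwa [Int.fract_add_floor] at this
  have hRHS : ∑ᶠ u ∈ {u | u ∈ Ico (0 : ℝ) 1 ∧ D₀ ⬝ᵥ c.lift u = 0}, v u =
      ∑ᶠ u ∈ {u | u ∈ Ico a (a + 1) ∧ D₀ ⬝ᵥ c.lift u = 0}, v' u := by
    rw [finsum_period (fun u => by simp only [hv', Int.fract_add_one]) (c.dot_lift_add_one D₀) a]
    refine finsum_mem_congr rfl fun u hu => ?_
    rw [hv']
    simp only
    rw [Int.fract_eq_self.2 hu.1]
  rw [hRHS]
  set S : Set ℝ := {u | u ∈ Ico a (a + 1) ∧ D₀ ⬝ᵥ c.lift u = 0} with hS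
  have hSfin : S.Finite := c.finite_zeros h0 Ico_subset_Icc_self
  have hSI : ∀ u ∈ S, u ∈ Ioo a (a + 1) := by
    rintro u ⟨hu, hz⟩
    refine ⟨lt_of_le_of_ne hu.1 ?_, hu.2⟩
    rintro rfl; exact ha hz
  have hδ : ∀ᶠ δ in 𝓝[>] (0 : ℝ), (∀ u ∈ S, Ioo (u - δ) (u + δ) ⊆ Ioo a (a + 1)) ∧
      (∀ u ∈ S, ∀ u' ∈ S, u ≠ u' → Disjoint (Ioo (u - δ) (u + δ)) (Ioo (u' - δ) (u' + δ))) ∧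
      (∀ u ∈ S, ∀ᶠ x in F,
        ∑ᶠ y ∈ {y | y ∈ Ioo (u - δ) (u + δ) ∧ D x ⬝ᵥ c.lift y = 0}, w x y = v' u) := by
    refine Eventually.and ?_ (Eventually.and ?_ ?_)
    · rw [hSfin.eventually_all]
      intro u hu
      have hu := hSI u hu
      filter_upwards [Ioo_mem_nhdsGT (lt_min (sub_pos.2 hu.1) (sub_pos.2 hu.2))] with δ hδ
      have := lt_min_iff.1 hδ.2
      exact Ioo_subset_Ioo (by linarith) (by linarith)
    · rw [hSfin.eventually_all]
      intro u hu
      rw [hSfin.eventually_all]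
      intro u' hu'
      by_cases hne : u = u'
      · exact Eventually.of_forall fun δ h => absurd hne h
      · have hpos : 0 < |u - u'| / 2 := by have := abs_pos.2 (sub_ne_zero.2 hne); linarith
        filter_upwards [Ioo_mem_nhdsGT hpos] with δ hδ _
        rw [Set.disjoint_left]
        rintro y ⟨y1, y2⟩ ⟨y3, y4⟩
        have h1 : |u - u'| < 2 * δ := by rw [abs_lt]; constructor <;> linarith
        linarith [hδ.2]
    · rw [hSfin.eventually_all]
      intro u hu
      exact hloc u hu.2
  obtain ⟨δ, ⟨hδ1, hδ2, hδ3⟩, hδpos⟩ := (hδ.and (self_mem_nhdsWithin : ∀ᶠ δ in 𝓝[>] (0 : ℝ), 0 < δ)).exists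
  -- Off the windows the curve does not meet `D₀`, nor, by compactness, the lines close to it.
  set K : Set ℝ := Icc a (a + 1) \ ⋃ u ∈ S, Ioo (u - δ) (u + δ) with hK
  have hKc : IsCompact K := isCompact_Icc.diff (isOpen_biUnion fun u _ => isOpen_Ioo)
  have hKne : ∀ᶠ D in 𝓝 D₀, ∀ u ∈ K, D ⬝ᵥ c.lift u ≠ 0 := by
    refine hKc.eventually_forall_of_forall_eventually fun u hu => ?_
    rw [nhds_prod_eq]
    refine (c.tendsto_dot_prod D₀ u).eventually_ne fun hz => ?_
    refine hu.2 (mem_biUnion (x := u) ⟨⟨hu.1.1, lt_of_le_of_ne hu.1.2 ?_⟩, hz⟩ ⟨by linarith, by linarith⟩)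
    rintro rfl; exact ha1 hz
  filter_upwards [hD.eventually hKne, (hSfin.eventually_all (l := F)).2 hδ3, hD.eventually_ne h0] with x hx1 hx2 hx3
  refine (finsum_period (hw x) (c.dot_lift_add_one (D x)) a).symm.trans ?_
  have hset : {u | u ∈ Ico a (a + 1) ∧ D x ⬝ᵥ c.lift u = 0} =
      ⋃ u ∈ S, {y | y ∈ Ioo (u - δ) (u + δ) ∧ D x ⬝ᵥ c.lift y = 0} := by
    ext y
    simp only [mem_iUnion, mem_ofPred_eq, exists_prop]
    constructor
    · rintro ⟨hy, hz⟩
      by_contra hcon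
      refine hx1 y ⟨Ico_subset_Icc_self hy, fun hmem => ?_⟩ hz
      obtain ⟨u, hu, hyu⟩ := mem_iUnion₂.1 hmem
      exact hcon ⟨u, hu, hyu, hz⟩
    · rintro ⟨u, hu, hyu, hz⟩
      exact ⟨Ioo_subset_Ico_self (hδ1 u hu hyu), hz⟩
  rw [hset, finsum_mem_biUnion]
  · exact finsum_mem_congr rfl hx2
  · intro u hu u' hu' hne
    exact (hδ2 u hu u' hu' hne).mono (fun y hy => hy.1) (fun y hy => hy.1)
  · exact hSfin
  · intro u hu
    exact c.finite_zeros hx3 Ioo_subset_Icc_self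

/-- A property of intersections which holds near each intersection with `D₀` holds at all
intersections with a line close to `D₀`. -/
theorem forall_zeros_eventually {α : Type*} {F : Filter α} {D : α → Fin 3 → ℝ} {D₀ : Fin 3 → ℝ}
    (hD : Tendsto D F (𝓝 D₀)) {P : α → ℝ → Prop} (hP : ∀ x u, P x (u + 1) ↔ P x u)
    (h : ∀ u₀ ∈ Ico (0 : ℝ) 1, D₀ ⬝ᵥ c.lift u₀ = 0 → ∀ᶠ δ in 𝓝[>] (0 : ℝ), ∀ᶠ x in F,
      ∀ u ∈ Ioo (u₀ - δ) (u₀ + δ), D x ⬝ᵥ c.lift u = 0 → P x u) :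
    ∀ᶠ x in F, ∀ u, D x ⬝ᵥ c.lift u = 0 → P x u := by
  have hQ : ∀ x u, (D x ⬝ᵥ c.lift (u + 1) = 0 → P x (u + 1)) = (D x ⬝ᵥ c.lift u = 0 → P x u) := by
    intro x u
    rw [c.dot_lift_add_one, hP]
  have h1 : ∀ u ∈ Ico (0 : ℝ) 1, ∀ᶠ z in F ×ˢ 𝓝 u, D z.1 ⬝ᵥ c.lift z.2 = 0 → P z.1 z.2 := by
    intro u hu
    by_cases hz : D₀ ⬝ᵥ c.lift u = 0
    · obtain ⟨δ, hδ, hpos⟩ := ((h u hu hz).and (self_mem_nhdsWithin : ∀ᶠ δ in 𝓝[>] (0 : ℝ), 0 < δ)).exists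
      have hpos : 0 < δ := hpos
      have hm : Ioo (u - δ) (u + δ) ∈ 𝓝 u := Ioo_mem_nhds (by linarith) (by linarith)
      filter_upwards [prod_mem_prod hδ hm] with z hz
      exact hz.1 z.2 hz.2
    · have ht : Tendsto (fun z : α × ℝ => D z.1 ⬝ᵥ c.lift z.2) (F ×ˢ 𝓝 u) (𝓝 (D₀ ⬝ᵥ c.lift u)) :=
        (c.tendsto_dot_prod D₀ u).comp (hD.prodMap tendsto_id)
      filter_upwards [ht.eventually_ne hz] with z hz1 hz2
      exact absurd hz2 hz1
  have h2 : ∀ u ∈ Icc (0 : ℝ) 1, ∀ᶠ z in F ×ˢ 𝓝 u, D z.1 ⬝ᵥ c.lift z.2 = 0 → P z.1 z.2 := by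
    intro u hu
    rcases hu.2.eq_or_lt with rfl | hlt
    · have ht : Tendsto (fun y : ℝ => y - 1) (𝓝 1) (𝓝 0) := by
        have : Tendsto (fun y : ℝ => y - 1) (𝓝 1) (𝓝 (1 - 1)) := Continuous.tendsto (by fun_prop) _
        rwa [sub_self] at this
      have := (tendsto_id (x := F)).prodMap ht |>.eventually (h1 0 ⟨le_rfl, one_pos⟩)
      filter_upwards [this] with z hz
      have e := hQ z.1 (z.2 - 1)
      rw [sub_add_cancel] at e
      rw [e]; exact hz
    · exact h1 u ⟨hu.1, hlt⟩
  have h3 : ∀ᶠ x in F, ∀ u ∈ Icc (0 : ℝ) 1, D x ⬝ᵥ c.lift u = 0 → P x u := by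
    have : ∀ᶠ z in F ×ˢ 𝓝ˢ (Icc (0 : ℝ) 1), D z.1 ⬝ᵥ c.lift z.2 = 0 → P z.1 z.2 :=
      isCompact_Icc.mem_prod_nhdsSet_of_forall h2
    exact this.curry.mono fun x hx => hx.self_of_nhdsSet
  filter_upwards [h3] with x hx u
  have := hx (Int.fract u) ⟨Int.fract_nonneg u, (Int.fract_lt_one u).le⟩
  rwa [apply_fract (f := fun u => (D x ⬝ᵥ c.lift u = 0 → P x u)) (hQ x)] at this

end ClosedCurve

/-! ### The two half tangents -/

theorem sign_eq_of_mul_pos {x y : ℝ} (h : 0 < x * y) : SignType.sign x = SignType.sign y := by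
  rcases pos_and_pos_or_neg_and_neg_of_mul_pos h with ⟨h1, h2⟩ | ⟨h1, h2⟩
  · rw [sign_pos h1, sign_pos h2]
  · rw [sign_neg h1, sign_neg h2]

/-- The sign `1` or `-1` of a nonzero real number as an integer. -/
noncomputable def isign (x : ℝ) : ℤ := (SignType.sign x : ℤ)

theorem isign_pos {x : ℝ} (h : 0 < x) : isign x = 1 := by rw [isign, sign_pos h]; rfl

theorem isign_neg {x : ℝ} (h : x < 0) : isign x = -1 := by rw [isign, sign_neg h]; rfl

theorem isign_zero : isign 0 = 0 := by rw [isign, sign_zero]; rfl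

theorem isign_eq_of_mul_pos {x y : ℝ} (h : 0 < x * y) : isign x = isign y := by
  rw [isign, isign, sign_eq_of_mul_pos h]

theorem isign_ne_zero {x : ℝ} (h : x ≠ 0) : isign x ≠ 0 := by
  rcases lt_or_gt_of_ne h with h | h
  · rw [isign_neg h]; norm_num
  · rw [isign_pos h]; norm_num

theorem ne_zero_of_isign {x : ℝ} (h : isign x ≠ 0) : x ≠ 0 := by
  rintro rfl; exact h isign_zero

theorem isign_opp (x : ℝ) : isign (-x) = -isign x := by
  rcases lt_trichotomy x 0 with h | rfl | h
  · rw [isign_neg h, isign_pos (neg_pos.2 h)]; norm_num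
  · rw [neg_zero, isign_zero]; norm_num
  · rw [isign_pos h, isign_neg (neg_neg_of_pos h)]

theorem isign_mul (x y : ℝ) : isign (x * y) = isign x * isign y := by
  unfold isign; rw [sign_mul]; push_cast; rfl

theorem finsum_window_one {f : ℝ → ℤ} {I : Set ℝ} {p : ℝ → Prop} {u₁ : ℝ} (h₁ : u₁ ∈ I)
    (h : ∀ u ∈ I, p u ↔ u = u₁) : ∑ᶠ u ∈ {u | u ∈ I ∧ p u}, f u = f u₁ := by
  have : {u | u ∈ I ∧ p u} = {u₁} := by
    ext u
    constructor
    · rintro ⟨hu, hz⟩; exact (h u hu).1 hz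
    · rintro rfl; exact ⟨h₁, (h _ h₁).2 rfl⟩
  rw [this, finsum_mem_singleton]

theorem finsum_window_two {f : ℝ → ℤ} {I : Set ℝ} {p : ℝ → Prop} {u₁ u₂ : ℝ} (h₁ : u₁ ∈ I) (h₂ : u₂ ∈ I)
    (hne : u₁ ≠ u₂) (h : ∀ u ∈ I, p u ↔ u = u₁ ∨ u = u₂) :
    ∑ᶠ u ∈ {u | u ∈ I ∧ p u}, f u = f u₁ + f u₂ := by
  have : {u | u ∈ I ∧ p u} = {u₁, u₂} := by
    ext u
    constructor
    · rintro ⟨hu, hz⟩; exact (h u hu).1 hz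
    · rintro (rfl | rfl)
      · exact ⟨h₁, (h _ h₁).2 (Or.inl rfl)⟩
      · exact ⟨h₂, (h _ h₂).2 (Or.inr rfl)⟩
  rw [this, finsum_mem_pair hne]

theorem finsum_window_zero {f : ℝ → ℤ} {I : Set ℝ} {p : ℝ → Prop} (h : ∀ u ∈ I, p u → f u = 0) :
    ∑ᶠ u ∈ {u | u ∈ I ∧ p u}, f u = 0 :=
  finsum_mem_eq_zero_of_forall_eq_zero fun u hu => h u hu.1 hu.2

namespace ClosedCurve

variable (c : ClosedCurve)

/-- In the affine chart with line at infinity `ℓ`, the sign of a point `w` of the tangent at `t`: it is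
`1` on the half tangent pointing forwards, `-1` on the one pointing backwards, and `0` at the point of
tangency or if one of the two points is at infinity. Indeed `covB t ⬝ᵥ w` is a positive multiple of the
coefficient `β` in `w = α γ(t) + β γ'(t)`. -/
noncomputable def halfSign (ℓ : Fin 3 → ℝ) (t : ℝ) (w : Fin 3 → ℝ) : ℤ :=
  isign ((c.covB t ⬝ᵥ w) * (ℓ ⬝ᵥ c.lift t) * (ℓ ⬝ᵥ w))

theorem halfSign_add_one (ℓ : Fin 3 → ℝ) (t : ℝ) (w : Fin 3 → ℝ) :
    c.halfSign ℓ (t + 1) w = c.halfSign ℓ t w := by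
  obtain ⟨ε, hε, h⟩ := c.exists_sign
  unfold halfSign covB
  rw [c.tvec_add_one, (h t).1]
  congr 1
  simp only [map_smul, smul_dotProduct, dotProduct_smul, smul_eq_mul]
  linear_combination ((crossProduct (c.tvec t)) (c.lift t) ⬝ᵥ w) * (ℓ ⬝ᵥ c.lift t) * (ℓ ⬝ᵥ w) * hε

theorem halfSign_lift_add_one (ℓ : Fin 3 → ℝ) (t : ℝ) (c' : ClosedCurve) (u : ℝ) :
    c.halfSign ℓ t (c'.lift (u + 1)) = c.halfSign ℓ t (c'.lift u) := by
  obtain ⟨ε, hε, h⟩ := c'.exists_sign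
  unfold halfSign
  rw [(h u).1]
  congr 1
  simp only [dotProduct_smul, smul_eq_mul]
  linear_combination (c.covB t ⬝ᵥ c'.lift u) * (ℓ ⬝ᵥ c.lift t) * (ℓ ⬝ᵥ c'.lift u) * hε

theorem frame_decomp (t : ℝ) (w : Fin 3 → ℝ) : (c.tvec t ⬝ᵥ c.tvec t) • w =
    (c.covA t ⬝ᵥ w) • c.lift t + (c.covB t ⬝ᵥ w) • deriv c.lift t + (c.tvec t ⬝ᵥ w) • c.tvec t := by
  unfold covA covB tvec
  ext i
  fin_cases i <;> simp [cross_apply, dotProduct, Fin.sum_univ_three] <;> ring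

theorem continuous_covB : Continuous c.covB :=
  continuous_cross.comp (c.continuous_tvec.prodMk c.continuous_lift)

theorem tendsto_covB_prod (c' : ClosedCurve) (t₀ u₀ : ℝ) :
    Tendsto (fun z : ℝ × ℝ => c.covB z.1 ⬝ᵥ c'.lift z.2) (𝓝 t₀ ×ˢ 𝓝 u₀) (𝓝 (c.covB t₀ ⬝ᵥ c'.lift u₀)) :=
  tendsto_dotProduct ((c.continuous_covB.tendsto t₀).comp tendsto_fst)
    ((c'.continuous_lift.tendsto u₀).comp tendsto_snd)

/-- The contribution of the intersections near `u₀` to the signed count of the points of `c'` on the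
tangents of `c` on the side `e` of `t₀` is `v`; these intersections are transverse and have nonzero sign. -/
def LocalContribution (c c' : ClosedCurve) (ℓ : Fin 3 → ℝ) (t₀ u₀ e : ℝ) (v : ℤ) : Prop :=
  c'.HasLocalSum (side e t₀) c.tvec (fun t u => c.halfSign ℓ t (c'.lift u)) u₀ v ∧
    ∀ᶠ δ in 𝓝[>] (0 : ℝ), ∀ᶠ t in side e t₀, ∀ u ∈ Ioo (u₀ - δ) (u₀ + δ), c.tvec t ⬝ᵥ c'.lift u = 0 →
      c.halfSign ℓ t (c'.lift u) ≠ 0 ∧ c.tvec t ⬝ᵥ deriv c'.lift u ≠ 0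

variable (c' : ClosedCurve)

theorem tendsto_tvec_side (e t₀ : ℝ) : Tendsto c.tvec (side e t₀) (𝓝 (c.tvec t₀)) :=
  (c.continuous_tvec.tendsto t₀).mono_left (side_le e t₀)

theorem eventually_window_side {e t₀ u₀ : ℝ} {p : ℝ → ℝ → Prop} (h : ∀ᶠ z in 𝓝 t₀ ×ˢ 𝓝 u₀, p z.1 z.2) :
    ∀ᶠ δ in 𝓝[>] (0 : ℝ), ∀ᶠ t in side e t₀, ∀ u ∈ Ioo (u₀ - δ) (u₀ + δ), p t u :=
  eventually_window (h.filter_mono (prod_mono (side_le e t₀) le_rfl))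

/-- A unique transverse intersection, whose sign is known. -/
theorem localContribution_of_transverse {ℓ : Fin 3 → ℝ} {t₀ u₀ e : ℝ} {v : ℤ}
    (h0 : c.tvec t₀ ⬝ᵥ c'.lift u₀ = 0) (h' : c.tvec t₀ ⬝ᵥ deriv c'.lift u₀ ≠ 0) (hv : v ≠ 0)
    (h : ∀ᶠ δ in 𝓝[>] (0 : ℝ), ∀ᶠ t in side e t₀, ∀ u ∈ Ioo (u₀ - δ) (u₀ + δ),
      c.tvec t ⬝ᵥ c'.lift u = 0 → c.halfSign ℓ t (c'.lift u) = v) :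
    LocalContribution c c' ℓ t₀ u₀ e v := by
  have hw := (c'.transverse_window h0 h').mono fun δ hδ => (c.tendsto_tvec_side e t₀).eventually hδ
  constructor
  · filter_upwards [h, hw] with δ h1 h2
    filter_upwards [h1, h2] with t h1 ⟨_, _, u₁, hu₁, h4⟩
    exact (finsum_window_one hu₁ h4).trans (h1 u₁ hu₁ ((h4 _ hu₁).2 rfl))
  · filter_upwards [h, hw] with δ h1 h2
    filter_upwards [h1, h2] with t h1 h2 u hu hz
    exact ⟨by rw [h1 u hu hz]; exact hv, h2.1 u hu⟩

/-- At a transverse intersection away from infinity and from the point of tangency, the sign is locally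
constant. -/
theorem localContribution_regular {ℓ : Fin 3 → ℝ} {t₀ u₀ e : ℝ}
    (h0 : c.tvec t₀ ⬝ᵥ c'.lift u₀ = 0) (h' : c.tvec t₀ ⬝ᵥ deriv c'.lift u₀ ≠ 0)
    (hs : c.halfSign ℓ t₀ (c'.lift u₀) ≠ 0) :
    LocalContribution c c' ℓ t₀ u₀ e (c.halfSign ℓ t₀ (c'.lift u₀)) := by
  refine c.localContribution_of_transverse c' h0 h' hs ?_
  have ht : Tendsto (fun z : ℝ × ℝ => ((c.covB z.1 ⬝ᵥ c'.lift z.2) * (ℓ ⬝ᵥ c.lift z.1) * (ℓ ⬝ᵥ c'.lift z.2)) *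
      ((c.covB t₀ ⬝ᵥ c'.lift u₀) * (ℓ ⬝ᵥ c.lift t₀) * (ℓ ⬝ᵥ c'.lift u₀))) (𝓝 t₀ ×ˢ 𝓝 u₀) _ :=
    (((c.tendsto_covB_prod c' t₀ u₀).mul ((c.tendsto_dot_lift ℓ t₀).comp tendsto_fst)).mul
      ((c'.tendsto_dot_lift ℓ u₀).comp tendsto_snd)).mul_const _
  have := ht.eventually (lt_mem_nhds (mul_self_pos.2 (ne_zero_of_isign hs)))
  refine (eventually_window_side (p := fun t u => 0 < ((c.covB t ⬝ᵥ c'.lift u) * (ℓ ⬝ᵥ c.lift t) *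
    (ℓ ⬝ᵥ c'.lift u)) * ((c.covB t₀ ⬝ᵥ c'.lift u₀) * (ℓ ⬝ᵥ c.lift t₀) * (ℓ ⬝ᵥ c'.lift u₀))) this).mono
    fun δ hδ => hδ.mono fun t ht u hu _ => isign_eq_of_mul_pos (ht u hu)

/-- When the point of tangency passes through infinity, a point of the tangent passes from the backward
to the forward half tangent. -/
theorem localContribution_tangency_at_infinity {ℓ : Fin 3 → ℝ} {t₀ u₀ e : ℝ} (he : e = 1 ∨ e = -1)
    (h0 : c.tvec t₀ ⬝ᵥ c'.lift u₀ = 0) (h' : c.tvec t₀ ⬝ᵥ deriv c'.lift u₀ ≠ 0)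
    (hp : ℓ ⬝ᵥ c.lift t₀ = 0) (hp' : ℓ ⬝ᵥ deriv c.lift t₀ ≠ 0) (hB : c.covB t₀ ⬝ᵥ c'.lift u₀ ≠ 0) :
    LocalContribution c c' ℓ t₀ u₀ e (isign e) := by
  have hn := dot_self_pos (c.tvec_ne_zero t₀)
  refine c.localContribution_of_transverse c' h0 h'
    (isign_ne_zero (by rcases he with rfl | rfl <;> norm_num)) ?_
  have hq : (c.tvec t₀ ⬝ᵥ c.tvec t₀) * (ℓ ⬝ᵥ c'.lift u₀) =
      (c.covB t₀ ⬝ᵥ c'.lift u₀) * (ℓ ⬝ᵥ deriv c.lift t₀) := by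
    have := congrArg (fun x => ℓ ⬝ᵥ x) (c.frame_decomp t₀ (c'.lift u₀))
    simpa [dotProduct_add, dotProduct_smul, h0, hp] using this
  have ht : Tendsto (fun z : ℝ × ℝ => (ℓ ⬝ᵥ deriv c.lift t₀) * ((c.covB z.1 ⬝ᵥ c'.lift z.2) * (ℓ ⬝ᵥ c'.lift z.2)))
      (𝓝 t₀ ×ˢ 𝓝 u₀) _ :=
    ((c.tendsto_covB_prod c' t₀ u₀).mul
      ((c'.tendsto_dot_lift ℓ u₀).comp tendsto_snd)).const_mul _
  have hpos : 0 < (ℓ ⬝ᵥ deriv c.lift t₀) * ((c.covB t₀ ⬝ᵥ c'.lift u₀) * (ℓ ⬝ᵥ c'.lift u₀)) := by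
    have e1 : (c.tvec t₀ ⬝ᵥ c.tvec t₀) *
      ((ℓ ⬝ᵥ deriv c.lift t₀) * ((c.covB t₀ ⬝ᵥ c'.lift u₀) * (ℓ ⬝ᵥ c'.lift u₀))) =
      ((c.covB t₀ ⬝ᵥ c'.lift u₀) * (ℓ ⬝ᵥ deriv c.lift t₀)) ^ 2 := by
      linear_combination ((ℓ ⬝ᵥ deriv c.lift t₀) * (c.covB t₀ ⬝ᵥ c'.lift u₀)) * hq
    have e2 : 0 < ((c.covB t₀ ⬝ᵥ c'.lift u₀) * (ℓ ⬝ᵥ deriv c.lift t₀)) ^ 2 := by positivity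
    rw [← e1] at e2
    exact pos_of_mul_pos_right e2 hn.le
  filter_upwards [eventually_window_side (e := e) (p := fun t u => 0 < (ℓ ⬝ᵥ deriv c.lift t₀) *
    ((c.covB t ⬝ᵥ c'.lift u) * (ℓ ⬝ᵥ c'.lift u))) (ht.eventually (lt_mem_nhds hpos))] with δ hδ
  filter_upwards [hδ, eventually_side_sign (c.hasDerivAt_dot ℓ t₀) hp hp' e] with t h1 h2 u hu _
  refine isign_eq_of_mul_pos ?_
  have h3 := mul_pos (h1 u hu) h2
  have e3 : (ℓ ⬝ᵥ deriv c.lift t₀) * ((c.covB t ⬝ᵥ c'.lift u) * (ℓ ⬝ᵥ c'.lift u)) *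
      (e * (ℓ ⬝ᵥ deriv c.lift t₀) * (ℓ ⬝ᵥ c.lift t)) = (ℓ ⬝ᵥ deriv c.lift t₀) ^ 2 *
      ((c.covB t ⬝ᵥ c'.lift u) * (ℓ ⬝ᵥ c.lift t) * (ℓ ⬝ᵥ c'.lift u) * e) := by ring
  rw [e3] at h3
  exact pos_of_mul_pos_right h3 (sq_nonneg _)

theorem _root_.FabriciusBjerre.eventually_deriv_sign {f : ℝ → ℝ} {f' u₀ : ℝ} (hf : HasDerivAt f f' u₀)
    (h0 : f u₀ = 0) (hf' : f' ≠ 0) : ∀ᶠ u in 𝓝 u₀, u ≠ u₀ → 0 < f' * (u - u₀) * f u := by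
  refine eventually_nhdsWithin_iff.1 (eventually_ne_of_side (t₀ := u₀)
    (p := fun u => 0 < f' * (u - u₀) * f u) fun e he => ?_)
  · filter_upwards [eventually_side_sign hf h0 hf' e, eventually_side_pos e u₀] with u h1 h2
    have := mul_pos h1 h2
    have e1 : e * f' * f u * (e * (u - u₀)) = (e * e) * (f' * (u - u₀) * f u) := by ring
    rwa [e1, mul_self_of_sign he, one_mul] at this

theorem sideSign_eq {t : ℝ} (hf : ¬ c.IsFlex t) {e : ℝ} (he : e = 1 ∨ e = -1) :
    c.sideSign e t = c.sideSign 1 t := by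
  rcases he with rfl | rfl
  · rfl
  · rw [isFlex_iff] at hf
    have n1 := (c.sideSign_spec t (Or.inl rfl)).1
    have n2 := (c.sideSign_spec t (Or.inr rfl)).1
    rcases n1 with h1 | h1 <;> rcases n2 with h2 | h2 <;> rw [h1, h2] at hf ⊢ <;> norm_num at hf

/-- The position of the intersection of a transverse branch with the tangents close to `t₀`, and the sign
of `ℓ` there if `ℓ` vanishes on the branch at `u₀`. -/
theorem eventually_intersection_sign {e t₀ u₀ : ℝ} (h0 : c.tvec t₀ ⬝ᵥ c'.lift u₀ = 0)
    (h' : c.tvec t₀ ⬝ᵥ deriv c'.lift u₀ ≠ 0) {ℓ : Fin 3 → ℝ} (hq : ℓ ⬝ᵥ c'.lift u₀ = 0)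
    (hq' : ℓ ⬝ᵥ deriv c'.lift u₀ ≠ 0) (hne : ∀ᶠ t in side e t₀, c.tvec t ⬝ᵥ c'.lift u₀ ≠ 0) :
    ∀ᶠ δ in 𝓝[>] (0 : ℝ), ∀ᶠ t in side e t₀, ∀ u ∈ Ioo (u₀ - δ) (u₀ + δ), c.tvec t ⬝ᵥ c'.lift u = 0 →
      0 < -((c.tvec t₀ ⬝ᵥ deriv c'.lift u₀) * (ℓ ⬝ᵥ deriv c'.lift u₀)) *
        ((c.tvec t ⬝ᵥ c'.lift u₀) * (ℓ ⬝ᵥ c'.lift u)) := by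
  have hw := (c'.transverse_window h0 h').mono fun δ hδ => (c.tendsto_tvec_side e t₀).eventually hδ
  have hd : ∀ᶠ z in side e t₀ ×ˢ 𝓝 u₀, z.2 ≠ u₀ → 0 < (ℓ ⬝ᵥ deriv c'.lift u₀) * (z.2 - u₀) * (ℓ ⬝ᵥ c'.lift z.2) :=
    tendsto_snd.eventually (eventually_deriv_sign (c'.hasDerivAt_dot ℓ u₀) hq hq')
  filter_upwards [hw, eventually_window (p := fun _ u => u ≠ u₀ →
    0 < (ℓ ⬝ᵥ deriv c'.lift u₀) * (u - u₀) * (ℓ ⬝ᵥ c'.lift u)) hd, self_mem_nhdsWithin] with δ h1 h2 hpos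
  have hpos : 0 < δ := hpos
  filter_upwards [h1, h2, hne] with t ⟨_, h1, _⟩ h2 hnet u hu hz
  have huu : u ≠ u₀ := by rintro rfl; exact hnet hz
  have i0 : u₀ ∈ Ioo (u₀ - δ) (u₀ + δ) := ⟨by linarith, by linarith⟩
  set κ := c.tvec t₀ ⬝ᵥ deriv c'.lift u₀
  have hκ : 0 < κ ^ 2 := by positivity
  have h3 : 0 < -(κ * (c.tvec t ⬝ᵥ c'.lift u₀)) * (u - u₀) := by
    rcases lt_or_gt_of_ne huu with hlt | hlt
    · have := h1 u hu u₀ i0 hlt.le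
      rw [hz] at this
      nlinarith [mul_pos hκ (sub_pos.2 hlt), sub_pos.2 hlt]
    · have := h1 u₀ i0 u hu hlt.le
      rw [hz] at this
      nlinarith [mul_pos hκ (sub_pos.2 hlt), sub_pos.2 hlt]
  have h4 := mul_pos h3 (h2 u hu huu)
  have e1 : -(κ * (c.tvec t ⬝ᵥ c'.lift u₀)) * (u - u₀) * ((ℓ ⬝ᵥ deriv c'.lift u₀) * (u - u₀) * (ℓ ⬝ᵥ c'.lift u)) =
      (u - u₀) ^ 2 * (-(κ * (ℓ ⬝ᵥ deriv c'.lift u₀)) * ((c.tvec t ⬝ᵥ c'.lift u₀) * (ℓ ⬝ᵥ c'.lift u))) := by ring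
  rw [e1] at h4
  exact pos_of_mul_pos_right h4 (sq_nonneg _)

/-- The value of the tangents close to `t₀` at a point `w` of the tangent at `t₀`. -/
theorem eventually_tvec_dot_sign {e t₀ : ℝ} (he : e = 1 ∨ e = -1) {w : Fin 3 → ℝ}
    (h0 : c.tvec t₀ ⬝ᵥ w = 0) (hB : c.covB t₀ ⬝ᵥ w ≠ 0) : ∀ᶠ t in side e t₀,
      0 < -(e * c.sideSign e t₀ * (c.covB t₀ ⬝ᵥ w)) * (c.tvec t ⬝ᵥ w) := by
  obtain ⟨k, s, E, hs, hE, hev⟩ := c.tangent_family t₀ he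
  have hEw : Tendsto (fun t => -(c.covB t₀ ⬝ᵥ w) * (E t ⬝ᵥ w)) (side e t₀) (𝓝 (-(c.covB t₀ ⬝ᵥ w) * ((-c.covB t₀) ⬝ᵥ w))) :=
    (tendsto_dotProduct hE tendsto_const_nhds).const_mul _
  have hpos : 0 < -(c.covB t₀ ⬝ᵥ w) * ((-c.covB t₀) ⬝ᵥ w) := by
    rw [neg_dotProduct, neg_mul_neg]; exact mul_self_pos.2 hB
  filter_upwards [hev, hEw.eventually (lt_mem_nhds hpos)] with t ⟨h1, h2, h3⟩ h4
  have h5 := congrArg (fun x => x ⬝ᵥ w) h2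
  simp only [add_dotProduct, smul_dotProduct, smul_eq_mul, h0, zero_add] at h5
  have h6 := mul_pos h3 h4
  have e1 : c.sideSign e t₀ * e * s t * (-(c.covB t₀ ⬝ᵥ w) * (E t ⬝ᵥ w)) =
      k t * (-(e * c.sideSign e t₀ * (c.covB t₀ ⬝ᵥ w)) * (c.tvec t ⬝ᵥ w)) := by
    linear_combination (c.sideSign e t₀ * e * (c.covB t₀ ⬝ᵥ w)) * h5
  rw [e1] at h6
  exact pos_of_mul_pos_right h6 h1.le

/-- When a transverse intersection passes through infinity, it changes from one half tangent to the other;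
the direction of this change depends on the side of the tangent on which the curve lies. -/
theorem localContribution_point_at_infinity {ℓ : Fin 3 → ℝ} {t₀ u₀ e : ℝ} (he : e = 1 ∨ e = -1)
    (h0 : c.tvec t₀ ⬝ᵥ c'.lift u₀ = 0) (h' : c.tvec t₀ ⬝ᵥ deriv c'.lift u₀ ≠ 0)
    (hf : ¬ c.IsFlex t₀) (hp : ℓ ⬝ᵥ c.lift t₀ ≠ 0)
    (hq : ℓ ⬝ᵥ c'.lift u₀ = 0) (hq' : ℓ ⬝ᵥ deriv c'.lift u₀ ≠ 0) (hB : c.covB t₀ ⬝ᵥ c'.lift u₀ ≠ 0) :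
    LocalContribution c c' ℓ t₀ u₀ e (isign (e * (c.sideSign 1 t₀ * (ℓ ⬝ᵥ c.lift t₀) *
      (ℓ ⬝ᵥ deriv c'.lift u₀) * (c.tvec t₀ ⬝ᵥ deriv c'.lift u₀)))) := by
  have hν : c.sideSign 1 t₀ ≠ 0 := by
    rcases (c.sideSign_spec t₀ (Or.inl rfl)).1 with h | h <;> rw [h] <;> norm_num
  have he0 : e ≠ 0 := by rcases he with rfl | rfl <;> norm_num
  refine c.localContribution_of_transverse c' h0 h' (isign_ne_zero (by positivity)) ?_
  have hT := c.eventually_tvec_dot_sign he h0 hB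
  rw [c.sideSign_eq hf he] at hT
  have ht : Tendsto (fun z : ℝ × ℝ => ((c.covB t₀ ⬝ᵥ c'.lift u₀) * (ℓ ⬝ᵥ c.lift t₀)) *
      ((c.covB z.1 ⬝ᵥ c'.lift z.2) * (ℓ ⬝ᵥ c.lift z.1))) (𝓝 t₀ ×ˢ 𝓝 u₀) _ :=
    ((c.tendsto_covB_prod c' t₀ u₀).mul
      ((c.tendsto_dot_lift ℓ t₀).comp tendsto_fst)).const_mul _
  filter_upwards [c.eventually_intersection_sign c' h0 h' hq hq' (hT.mono fun t h hz => by
      rw [hz, mul_zero] at h; exact lt_irrefl _ h),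
    eventually_window_side (e := e) (p := fun t u => 0 < ((c.covB t₀ ⬝ᵥ c'.lift u₀) * (ℓ ⬝ᵥ c.lift t₀)) *
      ((c.covB t ⬝ᵥ c'.lift u) * (ℓ ⬝ᵥ c.lift t)))
      (ht.eventually (lt_mem_nhds (mul_self_pos.2 (mul_ne_zero hB hp))))] with δ h1 h2
  filter_upwards [h1, h2, hT] with t h1 h2 h3 u hu hz
  refine isign_eq_of_mul_pos ?_
  have h4 := mul_pos (mul_pos (h1 u hu hz) (h2 u hu)) h3
  set Tq := c.tvec t ⬝ᵥ c'.lift u₀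
  have e1 : -((c.tvec t₀ ⬝ᵥ deriv c'.lift u₀) * (ℓ ⬝ᵥ deriv c'.lift u₀)) * (Tq * (ℓ ⬝ᵥ c'.lift u)) *
      (((c.covB t₀ ⬝ᵥ c'.lift u₀) * (ℓ ⬝ᵥ c.lift t₀)) * ((c.covB t ⬝ᵥ c'.lift u) * (ℓ ⬝ᵥ c.lift t))) *
      (-(e * c.sideSign 1 t₀ * (c.covB t₀ ⬝ᵥ c'.lift u₀)) * Tq) =
      (Tq * (c.covB t₀ ⬝ᵥ c'.lift u₀)) ^ 2 * ((c.covB t ⬝ᵥ c'.lift u) * (ℓ ⬝ᵥ c.lift t) * (ℓ ⬝ᵥ c'.lift u) *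
        (e * (c.sideSign 1 t₀ * (ℓ ⬝ᵥ c.lift t₀) *
      (ℓ ⬝ᵥ deriv c'.lift u₀) * (c.tvec t₀ ⬝ᵥ deriv c'.lift u₀)))) := by ring
  rw [e1] at h4
  exact pos_of_mul_pos_right h4 (sq_nonneg _)

end ClosedCurve

namespace ClosedCurve

variable (c c' : ClosedCurve)

/-! ### Nodes -/

/-- The tangent at `t` passes the point `γ(t₀)` at a distance of smaller order than `t - t₀`, whereas the distance
of `γ(t₀)` from the point of tangency, measured by `covB t`, is of order `t - t₀`. -/
theorem tendsto_tvec_dot_div (t₀ : ℝ) :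
    Tendsto (fun t => (c.tvec t ⬝ᵥ c.lift t₀) / (t - t₀)) (𝓝[≠] t₀) (𝓝 0) ∧
    Tendsto (fun t => (c.covB t ⬝ᵥ c.lift t₀) / (t - t₀)) (𝓝[≠] t₀) (𝓝 (-(c.tvec t₀ ⬝ᵥ c.tvec t₀))) := by
  have hs := hasDerivAt_iff_tendsto_slope.1 (c.hasDerivAt_lift t₀)
  have hl : Tendsto c.lift (𝓝[≠] t₀) (𝓝 (c.lift t₀)) :=
    (c.continuous_lift.tendsto t₀).mono_left nhdsWithin_le_nhds
  have hd : Tendsto (deriv c.lift) (𝓝[≠] t₀) (𝓝 (deriv c.lift t₀)) :=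
    (c.continuous_deriv_lift.tendsto t₀).mono_left nhdsWithin_le_nhds
  have hT : Tendsto c.tvec (𝓝[≠] t₀) (𝓝 (c.tvec t₀)) :=
    (c.continuous_tvec.tendsto t₀).mono_left nhdsWithin_le_nhds
  have h1 := tendsto_dotProduct hd (tendsto_cross tendsto_const_nhds hs (f := fun _ => c.lift t₀))
  have h2 := (tendsto_dotProduct hT (tendsto_cross hl hs)).neg
  have e1 : deriv c.lift t₀ ⬝ᵥ crossProduct (c.lift t₀) (deriv c.lift t₀) = 0 := dot_cross_self _ _
  rw [e1] at h1
  constructor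
  · refine h1.congr' ?_
    filter_upwards [self_mem_nhdsWithin] with t ht
    have ht : t - t₀ ≠ 0 := sub_ne_zero.2 ht
    rw [slope_def_module, eq_div_iff ht]
    simp only [map_smul, dotProduct_smul, smul_eq_mul]
    rw [mul_comm, ← mul_assoc, mul_inv_cancel₀ ht, one_mul]
    unfold tvec
    simp [cross_apply, dotProduct, Fin.sum_univ_three]; ring
  · refine h2.congr' ?_
    filter_upwards [self_mem_nhdsWithin] with t ht
    have ht : t - t₀ ≠ 0 := sub_ne_zero.2 ht
    rw [slope_def_module, eq_div_iff ht]
    simp only [map_smul, dotProduct_smul, smul_eq_mul]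
    rw [neg_mul, mul_comm, ← mul_assoc, mul_inv_cancel₀ ht, one_mul]
    unfold covB
    simp [cross_apply, dotProduct, Fin.sum_univ_three]; ring

/-- At a node, the intersection of the other branch with the tangents passes from the forward to the
backward half tangent: it is so close to the node that it lies on the same half as the node itself. -/
theorem eventually_node_sign {e t₀ u₀ lam : ℝ} (he : e = 1 ∨ e = -1) (hlam : lam ≠ 0)
    (hnode : c'.lift u₀ = lam • c.lift t₀) (h' : c.tvec t₀ ⬝ᵥ deriv c'.lift u₀ ≠ 0) :
    ∀ᶠ δ in 𝓝[>] (0 : ℝ), ∀ᶠ t in side e t₀, ∀ u ∈ Ioo (u₀ - δ) (u₀ + δ), c.tvec t ⬝ᵥ c'.lift u = 0 →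
      0 < -(lam * e) * (c.covB t ⬝ᵥ c'.lift u) := by
  have hn := dot_self_pos (c.tvec_ne_zero t₀)
  have h0 : c.tvec t₀ ⬝ᵥ c'.lift u₀ = 0 := by rw [hnode, dotProduct_smul, tvec_dot_lift, smul_zero]
  set κ := c.tvec t₀ ⬝ᵥ deriv c'.lift u₀ with hκ
  have hκ2 : 0 < κ ^ 2 := by positivity
  have hle : side e t₀ ≤ 𝓝[≠] t₀ := nhdsWithin_mono t₀ fun x hx => by
    rintro rfl; simp at hx
  obtain ⟨l1, l2⟩ := c.tendsto_tvec_dot_div t₀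
  -- A bound for the derivative of `covB t ⬝ᵥ γ'(u)`.
  obtain ⟨B, hB⟩ : ∃ B, |c.covB t₀ ⬝ᵥ deriv c'.lift u₀| < B := exists_gt _
  have hB0 : 0 < B := (abs_nonneg _).trans_lt hB
  have hBd : ∀ᶠ z in 𝓝 t₀ ×ˢ 𝓝 u₀, |c.covB z.1 ⬝ᵥ deriv c'.lift z.2| < B := by
    have : Tendsto (fun z : ℝ × ℝ => |c.covB z.1 ⬝ᵥ deriv c'.lift z.2|) (𝓝 t₀ ×ˢ 𝓝 u₀) _ :=
      (tendsto_dotProduct ((c.continuous_covB.tendsto t₀).comp tendsto_fst)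
        ((c'.continuous_deriv_lift.tendsto u₀).comp tendsto_snd)).abs
    exact this.eventually (gt_mem_nhds hB)
  -- The smallness of the tangent at the node, relative to `t - t₀`.
  obtain ⟨η, hη0, hη⟩ : ∃ η > 0, B * (2 * |lam| * η / |κ|) < |lam| * (c.tvec t₀ ⬝ᵥ c.tvec t₀) / 2 := by
    have hl : 0 < |lam| := abs_pos.2 hlam
    have hk : 0 < |κ| := abs_pos.2 h'
    refine ⟨(c.tvec t₀ ⬝ᵥ c.tvec t₀) * |κ| / (8 * B), by positivity, ?_⟩
    have : B * (2 * |lam| * ((c.tvec t₀ ⬝ᵥ c.tvec t₀) * |κ| / (8 * B)) / |κ|) =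
        |lam| * (c.tvec t₀ ⬝ᵥ c.tvec t₀) / 4 := by field_simp; norm_num
    rw [this]
    have := mul_pos hl hn
    linarith
  have hw := (c'.transverse_window h0 h').mono fun δ hδ => (c.tendsto_tvec_side e t₀).eventually hδ
  have hs1 : ∀ᶠ t in side e t₀, |(c.tvec t ⬝ᵥ c.lift t₀) / (t - t₀)| < η := by
    have := (l1.mono_left hle).abs
    rw [abs_zero] at this
    exact this.eventually (gt_mem_nhds hη0)
  have hs2 : ∀ᶠ t in side e t₀, (c.covB t ⬝ᵥ c.lift t₀) / (t - t₀) < -((c.tvec t₀ ⬝ᵥ c.tvec t₀) / 2) :=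
    (l2.mono_left hle).eventually (gt_mem_nhds (by linarith))
  filter_upwards [hw, eventually_window_side (e := e)
    (p := fun t u => |c.covB t ⬝ᵥ deriv c'.lift u| < B) hBd, self_mem_nhdsWithin] with δ h1 h2 hpos
  have hpos : 0 < δ := hpos
  filter_upwards [h1, h2, hs1, hs2, eventually_side_pos e t₀] with t ⟨_, h1, _⟩ h2 h3 h4 h5 u hu hz
  have i0 : u₀ ∈ Ioo (u₀ - δ) (u₀ + δ) := ⟨by linarith, by linarith⟩
  have ht0 : t - t₀ ≠ 0 := by intro h; rw [h, mul_zero] at h5; exact lt_irrefl _ h5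
  have habs : e * (t - t₀) = |t - t₀| := by
    rcases he with rfl | rfl
    · rw [abs_of_pos (by linarith)]; ring
    · rw [abs_of_neg (by linarith)]; ring
  have htp : 0 < |t - t₀| := abs_pos.2 ht0
  have hTq : |c.tvec t ⬝ᵥ c'.lift u₀| ≤ |lam| * η * |t - t₀| := by
    rw [abs_div, div_lt_iff₀ htp] at h3
    rw [hnode, dotProduct_smul, smul_eq_mul, abs_mul, mul_assoc]
    exact mul_le_mul_of_nonneg_left h3.le (abs_nonneg _)
  have hdist : κ ^ 2 / 2 * |u - u₀| ≤ |κ| * |c.tvec t ⬝ᵥ c'.lift u₀| := by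
    rw [← abs_mul]
    rcases le_total u u₀ with hlt | hlt
    · have := h1 u hu u₀ i0 hlt
      rw [hz, sub_zero] at this
      rw [abs_of_nonpos (sub_nonpos.2 hlt), neg_sub]
      exact this.trans (le_abs_self _)
    · have := h1 u₀ i0 u hu hlt
      rw [hz, zero_sub, mul_neg] at this
      rw [abs_of_nonneg (sub_nonneg.2 hlt)]
      exact this.trans (neg_le_abs _)
  have hdist2 : |u - u₀| ≤ 2 * |lam| * η / |κ| * |t - t₀| := by
    have hk : 0 < |κ| := abs_pos.2 h'
    rw [div_mul_eq_mul_div, le_div_iff₀ hk]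
    have h6 := hdist.trans (mul_le_mul_of_nonneg_left hTq (abs_nonneg κ))
    rw [← sq_abs κ] at h6
    have : |κ| * (|u - u₀| * |κ|) ≤ |κ| * (2 * |lam| * η * |t - t₀|) := by nlinarith
    exact le_of_mul_le_mul_left this hk
  have hmv : |c.covB t ⬝ᵥ c'.lift u - c.covB t ⬝ᵥ c'.lift u₀| ≤ B * |u - u₀| := by
    have := (convex_Ioo (u₀ - δ) (u₀ + δ)).norm_image_sub_le_of_norm_hasDerivWithin_le
      (f := fun u => c.covB t ⬝ᵥ c'.lift u) (C := B)
      (fun x _ => (c'.hasDerivAt_dot (c.covB t) x).hasDerivWithinAt) (fun x hx => (h2 x hx).le) i0 hu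
    simpa [Real.norm_eq_abs] using this
  have hdiff : |c.covB t ⬝ᵥ c'.lift u - c.covB t ⬝ᵥ c'.lift u₀| <
      |lam| * (c.tvec t₀ ⬝ᵥ c.tvec t₀) / 2 * |t - t₀| := by
    refine (hmv.trans (mul_le_mul_of_nonneg_left hdist2 hB0.le)).trans_lt ?_
    rw [← mul_assoc]
    exact mul_lt_mul_of_pos_right hη htp
  have hmain : lam ^ 2 * ((c.tvec t₀ ⬝ᵥ c.tvec t₀) / 2) * |t - t₀| < -(lam * e) * (c.covB t ⬝ᵥ c'.lift u₀) := by
    rw [hnode, dotProduct_smul, smul_eq_mul, ← habs]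
    have h6 : 0 < lam ^ 2 * (e * (t - t₀)) := by positivity
    have h7 := mul_lt_mul_of_pos_left h4 h6
    have e1 : lam ^ 2 * (e * (t - t₀)) * ((c.covB t ⬝ᵥ c.lift t₀) / (t - t₀)) =
      lam ^ 2 * e * (c.covB t ⬝ᵥ c.lift t₀) := by field_simp
    rw [e1] at h7
    linarith
  have hsmall : |(lam * e) * (c.covB t ⬝ᵥ c'.lift u - c.covB t ⬝ᵥ c'.lift u₀)| <
      lam ^ 2 * ((c.tvec t₀ ⬝ᵥ c.tvec t₀) / 2) * |t - t₀| := by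
    have e1 : |e| = 1 := by rcases he with rfl | rfl <;> norm_num
    rw [abs_mul, abs_mul, e1, mul_one]
    have := mul_lt_mul_of_pos_left hdiff (abs_pos.2 hlam)
    rw [← sq_abs lam]
    linarith
  have := (abs_lt.1 hsmall).2
  linarith

/-- A node away from infinity. -/
theorem localContribution_node {ℓ : Fin 3 → ℝ} {e t₀ u₀ lam : ℝ} (he : e = 1 ∨ e = -1) (hlam : lam ≠ 0)
    (hnode : c'.lift u₀ = lam • c.lift t₀) (h' : c.tvec t₀ ⬝ᵥ deriv c'.lift u₀ ≠ 0)
    (hp : ℓ ⬝ᵥ c.lift t₀ ≠ 0) : LocalContribution c c' ℓ t₀ u₀ e (isign (-e)) := by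
  have h0 : c.tvec t₀ ⬝ᵥ c'.lift u₀ = 0 := by rw [hnode, dotProduct_smul, tvec_dot_lift, smul_zero]
  refine c.localContribution_of_transverse c' h0 h'
    (isign_ne_zero (by rcases he with rfl | rfl <;> norm_num)) ?_
  have ht : Tendsto (fun z : ℝ × ℝ => lam * ((ℓ ⬝ᵥ c.lift z.1) * (ℓ ⬝ᵥ c'.lift z.2)))
      (𝓝 t₀ ×ˢ 𝓝 u₀) _ :=
    (((c.tendsto_dot_lift ℓ t₀).comp tendsto_fst).mul
      ((c'.tendsto_dot_lift ℓ u₀).comp tendsto_snd)).const_mul _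
  have hpos : 0 < lam * ((ℓ ⬝ᵥ c.lift t₀) * (ℓ ⬝ᵥ c'.lift u₀)) := by
    rw [hnode, dotProduct_smul, smul_eq_mul]
    have : lam * ((ℓ ⬝ᵥ c.lift t₀) * (lam * (ℓ ⬝ᵥ c.lift t₀))) = (lam * (ℓ ⬝ᵥ c.lift t₀)) ^ 2 := by ring
    rw [this]; positivity
  filter_upwards [c.eventually_node_sign c' he hlam hnode h', eventually_window_side (e := e)
    (p := fun t u => 0 < lam * ((ℓ ⬝ᵥ c.lift t) * (ℓ ⬝ᵥ c'.lift u))) (ht.eventually (lt_mem_nhds hpos))]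
    with δ h1 h2
  filter_upwards [h1, h2] with t h1 h2 u hu hz
  refine isign_eq_of_mul_pos ?_
  have h3 := mul_pos (h1 u hu hz) (h2 u hu)
  have e1 : -(lam * e) * (c.covB t ⬝ᵥ c'.lift u) * (lam * ((ℓ ⬝ᵥ c.lift t) * (ℓ ⬝ᵥ c'.lift u))) =
      lam ^ 2 * ((c.covB t ⬝ᵥ c'.lift u) * (ℓ ⬝ᵥ c.lift t) * (ℓ ⬝ᵥ c'.lift u) * -e) := by ring
  rw [e1] at h3
  exact pos_of_mul_pos_right h3 (sq_nonneg _)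

/-- A node at infinity does not contribute: the changes caused by the node and by infinity cancel. -/
theorem localContribution_node_at_infinity {ℓ : Fin 3 → ℝ} {e t₀ u₀ lam : ℝ} (he : e = 1 ∨ e = -1)
    (hlam : lam ≠ 0) (hnode : c'.lift u₀ = lam • c.lift t₀) (h' : c.tvec t₀ ⬝ᵥ deriv c'.lift u₀ ≠ 0)
    (hf : ¬ c.IsFlex t₀) (hp : ℓ ⬝ᵥ c.lift t₀ = 0) (hp' : ℓ ⬝ᵥ deriv c.lift t₀ ≠ 0)
    (hq' : ℓ ⬝ᵥ deriv c'.lift u₀ ≠ 0) : LocalContribution c c' ℓ t₀ u₀ e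
      (isign (c.sideSign 1 t₀ * (c.tvec t₀ ⬝ᵥ deriv c'.lift u₀) * (ℓ ⬝ᵥ deriv c.lift t₀) *
        (ℓ ⬝ᵥ deriv c'.lift u₀))) := by
  have h0 : c.tvec t₀ ⬝ᵥ c'.lift u₀ = 0 := by rw [hnode, dotProduct_smul, tvec_dot_lift, smul_zero]
  have hq : ℓ ⬝ᵥ c'.lift u₀ = 0 := by rw [hnode, dotProduct_smul, hp, smul_zero]
  have hν : c.sideSign 1 t₀ ≠ 0 := by
    rcases (c.sideSign_spec t₀ (Or.inl rfl)).1 with h | h <;> rw [h] <;> norm_num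
  refine c.localContribution_of_transverse c' h0 h' (isign_ne_zero (by positivity)) ?_
  have hT : ∀ᶠ t in side e t₀, 0 < lam * c.sideSign 1 t₀ * (c.tvec t ⬝ᵥ c'.lift u₀) := by
    filter_upwards [c.eventually_side_sideSign t₀ he] with t ht
    rw [c.sideSign_eq hf he] at ht
    rw [hnode, dotProduct_smul, smul_eq_mul]
    have := mul_pos (sq_pos_of_ne_zero hlam) ht.2
    linarith
  filter_upwards [c.eventually_node_sign c' he hlam hnode h',
    c.eventually_intersection_sign c' h0 h' hq hq' (hT.mono fun t h hz => by
      rw [hz, mul_zero] at h; exact lt_irrefl _ h)] with δ h1 h2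
  filter_upwards [h1, h2, hT, eventually_side_sign (c.hasDerivAt_dot ℓ t₀) hp hp' e] with t h1 h2 h3 h4 u hu hz
  refine isign_eq_of_mul_pos ?_
  have h5 := mul_pos (mul_pos (mul_pos (h1 u hu hz) (h2 u hu hz)) h3) h4
  have ee := mul_self_of_sign he
  set Tq := c.tvec t ⬝ᵥ c'.lift u₀
  have e1 : -(lam * e) * (c.covB t ⬝ᵥ c'.lift u) *
      (-((c.tvec t₀ ⬝ᵥ deriv c'.lift u₀) * (ℓ ⬝ᵥ deriv c'.lift u₀)) * (Tq * (ℓ ⬝ᵥ c'.lift u))) *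
      (lam * c.sideSign 1 t₀ * Tq) * (e * (ℓ ⬝ᵥ deriv c.lift t₀) * (ℓ ⬝ᵥ c.lift t)) =
      (lam * Tq * e) ^ 2 * ((c.covB t ⬝ᵥ c'.lift u) * (ℓ ⬝ᵥ c.lift t) * (ℓ ⬝ᵥ c'.lift u) *
      (c.sideSign 1 t₀ * (c.tvec t₀ ⬝ᵥ deriv c'.lift u₀) * (ℓ ⬝ᵥ deriv c.lift t₀) *
        (ℓ ⬝ᵥ deriv c'.lift u₀))) := by ring
  rw [e1] at h5
  exact pos_of_mul_pos_right h5 (sq_nonneg _)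

/-! ### Bitangents -/

/-- On one side of a bitangent, the tangents do not meet the other branch near its point of tangency; on the
other side, they meet it in two points. -/
theorem localContribution_bitangent {ℓ : Fin 3 → ℝ} {e t₀ u₀ κ : ℝ} (he : e = 1 ∨ e = -1) (hκ : κ ≠ 0)
    (hT : c.tvec t₀ = κ • c'.tvec u₀) (hf : ¬ c.IsFlex t₀) (hf' : ¬ c'.IsFlex u₀)
    (hs : c.halfSign ℓ t₀ (c'.lift u₀) ≠ 0) : LocalContribution c c' ℓ t₀ u₀ e
      (if 0 < e * (κ * c.sideSign 1 t₀ * c'.sideSign 1 u₀ * (c.covB t₀ ⬝ᵥ c'.lift u₀)) then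
        2 * c.halfSign ℓ t₀ (c'.lift u₀) else 0) := by
  have hf0 := ne_zero_of_isign hs
  have hB : c.covB t₀ ⬝ᵥ c'.lift u₀ ≠ 0 := by
    intro h; rw [h, zero_mul, zero_mul] at hf0; exact hf0 rfl
  have hν : c.sideSign 1 t₀ ≠ 0 := by
    rcases (c.sideSign_spec t₀ (Or.inl rfl)).1 with h | h <;> rw [h] <;> norm_num
  have hν' : c'.sideSign 1 u₀ ≠ 0 := by
    rcases (c'.sideSign_spec u₀ (Or.inl rfl)).1 with h | h <;> rw [h] <;> norm_num
  have he0 : e ≠ 0 := by rcases he with rfl | rfl <;> norm_num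
  obtain ⟨k, s, E, hs0, hE, hev⟩ := c.tangent_family t₀ he
  rw [c.sideSign_eq hf he] at hev
  have hDk : Tendsto (fun t => k t • c.tvec t) (side e t₀) (𝓝 (κ • c'.tvec u₀)) := by
    have : Tendsto (fun t => c.tvec t₀ + s t • E t) (side e t₀) (𝓝 (c.tvec t₀ + (0 : ℝ) • (-c.covB t₀))) :=
      tendsto_const_nhds.add (hs0.smul hE)
    rw [zero_smul, add_zero, hT] at this
    exact this.congr' (hev.mono fun t ht => by rw [← hT]; exact ht.2.1.symm)
  have hzero : ∀ t, 0 < k t → ∀ w : Fin 3 → ℝ, (k t • c.tvec t) ⬝ᵥ w = 0 ↔ c.tvec t ⬝ᵥ w = 0 := by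
    intro t ht w
    rw [smul_dotProduct, smul_eq_mul, mul_eq_zero, or_iff_right ht.ne']
  set Ξ := κ * c.sideSign 1 t₀ * c'.sideSign 1 u₀ * (c.covB t₀ ⬝ᵥ c'.lift u₀) with hΞ
  have hΞ0 : e * Ξ ≠ 0 := by positivity
  -- For `0 < e * Ξ` the tangents at `t` separate the point at `u₀` from its neighbours.
  by_cases hpos : 0 < e * Ξ
  · rw [if_pos hpos]
    have hneg : ∀ᶠ t in side e t₀, κ * c'.sideSign 1 u₀ * ((k t • c.tvec t) ⬝ᵥ c'.lift u₀) < 0 := by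
      have hEw : Tendsto (fun t => -(c.covB t₀ ⬝ᵥ c'.lift u₀) * (E t ⬝ᵥ c'.lift u₀)) (side e t₀)
          (𝓝 (-(c.covB t₀ ⬝ᵥ c'.lift u₀) * ((-c.covB t₀) ⬝ᵥ c'.lift u₀))) :=
        (tendsto_dotProduct hE tendsto_const_nhds).const_mul _
      have hp : 0 < -(c.covB t₀ ⬝ᵥ c'.lift u₀) * ((-c.covB t₀) ⬝ᵥ c'.lift u₀) := by
        rw [neg_dotProduct, neg_mul_neg]; exact mul_self_pos.2 hB
      filter_upwards [hev, hEw.eventually (lt_mem_nhds hp)] with t ⟨h1, h2, h3⟩ h4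
      have h5 := mul_pos (mul_pos h3 h4) hpos
      have e0 : c.tvec t₀ ⬝ᵥ c'.lift u₀ = 0 := by rw [hT, smul_dotProduct, tvec_dot_lift, smul_zero]
      rw [h2, add_dotProduct, smul_dotProduct, smul_eq_mul, e0, zero_add]
      have ee := mul_self_of_sign he
      have e1 : c.sideSign 1 t₀ * e * s t * (-(c.covB t₀ ⬝ᵥ c'.lift u₀) * (E t ⬝ᵥ c'.lift u₀)) * (e * Ξ) =
        (c.sideSign 1 t₀ * e * (c.covB t₀ ⬝ᵥ c'.lift u₀)) ^ 2 *
          -(κ * c'.sideSign 1 u₀ * (s t * (E t ⬝ᵥ c'.lift u₀))) := by rw [hΞ]; ring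
      rw [e1] at h5
      have := pos_of_mul_pos_right h5 (sq_nonneg _)
      linarith
    have ht : Tendsto (fun z : ℝ × ℝ => ((c.covB z.1 ⬝ᵥ c'.lift z.2) * (ℓ ⬝ᵥ c.lift z.1) * (ℓ ⬝ᵥ c'.lift z.2)) *
        ((c.covB t₀ ⬝ᵥ c'.lift u₀) * (ℓ ⬝ᵥ c.lift t₀) * (ℓ ⬝ᵥ c'.lift u₀))) (𝓝 t₀ ×ˢ 𝓝 u₀) _ :=
      (((c.tendsto_covB_prod c' t₀ u₀).mul ((c.tendsto_dot_lift ℓ t₀).comp tendsto_fst)).mul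
        ((c'.tendsto_dot_lift ℓ u₀).comp tendsto_snd)).mul_const _
    have hsg := eventually_window_side (e := e) (p := fun t u => 0 < ((c.covB t ⬝ᵥ c'.lift u) *
      (ℓ ⬝ᵥ c.lift t) * (ℓ ⬝ᵥ c'.lift u)) * ((c.covB t₀ ⬝ᵥ c'.lift u₀) * (ℓ ⬝ᵥ c.lift t₀) *
      (ℓ ⬝ᵥ c'.lift u₀))) (ht.eventually (lt_mem_nhds (mul_self_pos.2 hf0)))
    have hw := (c'.tangent_window_two hf' hκ).mono fun δ hδ => hDk.eventually hδ
    constructor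
    · filter_upwards [hw, hsg] with δ h1 h2
      filter_upwards [h1, h2, hneg, hev] with t h1 h2 h3 h4
      obtain ⟨u₁, i1, u₂, i2, hne, hiff, -, -⟩ := h1 h3
      simp only [hzero t h4.1] at hiff
      refine (finsum_window_two i1 i2 hne hiff).trans ?_
      rw [show c.halfSign ℓ t (c'.lift u₁) = c.halfSign ℓ t₀ (c'.lift u₀) from isign_eq_of_mul_pos (h2 u₁ i1),
        show c.halfSign ℓ t (c'.lift u₂) = c.halfSign ℓ t₀ (c'.lift u₀) from isign_eq_of_mul_pos (h2 u₂ i2),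
        two_mul]
    · filter_upwards [hw, hsg] with δ h1 h2
      filter_upwards [h1, h2, hneg, hev] with t h1 h2 h3 h4 u hu hz
      obtain ⟨u₁, i1, u₂, i2, hne, hiff, d1, d2⟩ := h1 h3
      simp only [hzero t h4.1] at hiff
      rw [ne_eq, hzero t h4.1] at d1 d2
      refine ⟨?_, ?_⟩
      · rw [show c.halfSign ℓ t (c'.lift u) = c.halfSign ℓ t₀ (c'.lift u₀) from isign_eq_of_mul_pos (h2 u hu)]
        exact hs
      · rcases (hiff u hu).1 hz with rfl | rfl <;> assumption
  · rw [if_neg hpos]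
    have hneg : e * Ξ < 0 := lt_of_le_of_ne (not_lt.1 hpos) hΞ0
    have hw := c'.tangent_window_none hf' (D := fun t => k t • c.tvec t) (s := s) (κ := κ) hE
      (hev.mono fun t ht => by rw [ht.2.1, hT]) (by
        filter_upwards [hev] with t ⟨h1, h2, h3⟩
        have h5 := mul_pos_of_neg_of_neg hneg (neg_neg_of_pos h3)
        have ν2 := mul_self_of_sign (c.sideSign_spec t₀ (Or.inl rfl)).1
        have ee := mul_self_of_sign he
        rw [neg_dotProduct]
        have e1 : e * Ξ * -(c.sideSign 1 t₀ * e * s t) = (e * e) * (c.sideSign 1 t₀ * c.sideSign 1 t₀) *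
          (κ * c'.sideSign 1 u₀ * s t * -(c.covB t₀ ⬝ᵥ c'.lift u₀)) := by rw [hΞ]; ring
        rw [e1, ee, ν2, one_mul, one_mul] at h5
        exact h5)
    constructor
    · filter_upwards [hw] with δ h1
      filter_upwards [h1, hev] with t h1 h2
      refine finsum_window_zero fun u hu hz => absurd ((hzero t h2.1 _).2 hz) (h1 u hu)
    · filter_upwards [hw] with δ h1
      filter_upwards [h1, hev] with t h1 h2 u hu hz
      exact absurd ((hzero t h2.1 _).2 hz) (h1 u hu)

/-! ### The point of tangency itself -/

theorem halfSign_self (ℓ : Fin 3 → ℝ) (t : ℝ) : c.halfSign ℓ t (c.lift t) = 0 := by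
  have : c.covB t ⬝ᵥ c.lift t = 0 := c.covB_lift t
  rw [halfSign, this, zero_mul, zero_mul, isign_zero]

theorem eventually_mem_window {e t₀ δ : ℝ} (hδ : 0 < δ) :
    ∀ᶠ t in side e t₀, t ∈ Ioo (t₀ - δ) (t₀ + δ) :=
  side_le e t₀ (Ioo_mem_nhds (by linarith) (by linarith))

/-- Near a parameter which is not a flex, the tangents meet the curve only at the point of tangency. -/
theorem local_diagonal {ℓ : Fin 3 → ℝ} {t₀ e : ℝ} (hf : ¬ c.IsFlex t₀) :
    c.HasLocalSum (side e t₀) c.tvec (fun t u => c.halfSign ℓ t (c.lift u)) t₀ 0 ∧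
    ∀ᶠ δ in 𝓝[>] (0 : ℝ), ∀ᶠ t in side e t₀, ∀ u ∈ Ioo (t₀ - δ) (t₀ + δ), c.tvec t ⬝ᵥ c.lift u = 0 → u = t := by
  have key : ∀ᶠ δ in 𝓝[>] (0 : ℝ), ∀ᶠ t in side e t₀, ∀ u ∈ Ioo (t₀ - δ) (t₀ + δ),
      c.tvec t ⬝ᵥ c.lift u = 0 → u = t := by
    filter_upwards [c.eventually_convex_window hf, self_mem_nhdsWithin] with δ h1 hpos
    filter_upwards [eventually_mem_window hpos] with t ht u hu hz
    by_contra hne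
    have := h1 t ht u hu (Ne.symm hne)
    rw [hz, mul_zero] at this
    exact lt_irrefl _ this
  refine ⟨?_, key⟩
  filter_upwards [key] with δ h1
  filter_upwards [h1] with t h1
  refine finsum_window_zero fun u hu hz => ?_
  rw [h1 u hu hz, halfSign_self]

/-- Near a flex, the tangents meet the curve in one further point, which lies beyond the flex. -/
theorem flex_window {t₀ e : ℝ} (he : e = 1 ∨ e = -1) (hf : c.IsFlex t₀) :
    ∀ᶠ δ in 𝓝[>] (0 : ℝ), ∀ᶠ t in side e t₀, ∃ u₁ ∈ Ioo (t₀ - δ) (t₀ + δ), t ≠ u₁ ∧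
      (∀ u ∈ Ioo (t₀ - δ) (t₀ + δ), c.tvec t ⬝ᵥ c.lift u = 0 ↔ u = t ∨ u = u₁) ∧
      c.tvec t ⬝ᵥ deriv c.lift u₁ ≠ 0 ∧ 0 < -e * (c.covB t ⬝ᵥ c.lift u₁) := by
  have hn := dot_self_pos (c.tvec_ne_zero t₀)
  have ee := mul_self_of_sign he
  have he' := neg_sign he
  set ν := c.sideSign e t₀ with hν
  have hν' : c.sideSign (-e) t₀ = -ν := by
    rw [isFlex_iff] at hf
    rcases he with rfl | rfl
    · exact hf
    · rw [hν, hf, neg_neg, neg_neg]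
  obtain ⟨hν1, δ₁, hδ₁, hs₁⟩ := c.sideSign_spec t₀ he
  obtain ⟨-, δ₂, hδ₂, hs₂⟩ := c.sideSign_spec t₀ he'
  rw [← hν] at hs₁ hν1
  rw [hν'] at hs₂
  have νν := mul_self_of_sign hν1
  have hc1 := c.eventually_side_coords t₀ he
  have hc2 := c.eventually_side_coords t₀ he'
  rw [← hν] at hc1
  rw [hν'] at hc2
  have hc2n : ∀ᶠ u in 𝓝 t₀, 0 < -e * (u - t₀) →
      (0 < c.covA t₀ ⬝ᵥ c.lift u ∧ 0 < c.coefT t₀ u ∧ 0 < -e * (c.covB t₀ ⬝ᵥ c.lift u)) :=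
    (eventually_nhdsWithin_iff.1 hc2).mono fun u h h' => ⟨(h h').1, (h h').2.1, (h h').2.2.1⟩
  have hc2' := eventually_window (F := (⊤ : Filter Unit)) (u₀ := t₀) (p := fun _ u => 0 < -e * (u - t₀) →
    (0 < c.covA t₀ ⬝ᵥ c.lift u ∧ 0 < c.coefT t₀ u ∧ 0 < -e * (c.covB t₀ ⬝ᵥ c.lift u)))
    (tendsto_snd.eventually hc2n)
  filter_upwards [hc2', eventually_pos_gt (min δ₁ δ₂) (lt_min hδ₁ hδ₂)] with δ hw ⟨hδ, hδm⟩
  obtain ⟨hδ1, hδ2⟩ := lt_min_iff.1 hδm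
  have hw : ∀ u ∈ Ioo (t₀ - δ) (t₀ + δ), 0 < -e * (u - t₀) →
    (0 < c.covA t₀ ⬝ᵥ c.lift u ∧ 0 < c.coefT t₀ u ∧ 0 < -e * (c.covB t₀ ⬝ᵥ c.lift u)) := by
    simpa using hw
  have hbd : ∀ u ∈ Ioo (t₀ - δ) (t₀ + δ), e * (u - t₀) < δ ∧ -e * (u - t₀) < δ := by
    intro u hu
    rcases he with rfl | rfl <;> constructor <;> linarith [hu.1, hu.2]
  -- The far end of the window lies on the other side of the tangents.
  have hend : ∀ᶠ t in side e t₀, ν * (c.tvec t ⬝ᵥ c.lift (t₀ + -e * (δ / 2))) < 0 := by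
    have ht : Tendsto (fun t => ν * (c.tvec t ⬝ᵥ c.lift (t₀ + -e * (δ / 2)))) (side e t₀) _ :=
      (tendsto_dotProduct (c.tendsto_tvec_side e t₀) tendsto_const_nhds).const_mul ν
    refine ht.eventually (gt_mem_nhds ?_)
    have e1 : -e * (t₀ + -e * (δ / 2) - t₀) = δ / 2 := by linear_combination (δ / 2) * ee
    have := hs₂ t₀ (t₀ + -e * (δ / 2)) (by simp) (by simpa using hδ₂) (by rw [e1]; linarith)
      (by rw [e1]; linarith) (by intro h; rw [← h, sub_self, mul_zero] at e1; linarith)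
    linarith
  filter_upwards [hend, hc1, eventually_mem_window hδ, eventually_side_pos e t₀]
    with t hend ⟨a1, a2, a3, a4, a5, a6⟩ htw hts
  have hTP : 0 < ν * (c.tvec t ⬝ᵥ c.lift t₀) :=
    hs₁ t t₀ hts.le (by linarith [(hbd t htw).1]) (by simp) (by simpa using hδ₁)
      (by rintro rfl; simp at hts)
  obtain ⟨u₁, m1, n1, n2, z1⟩ := c.exists_zero_between hend hTP
  have hu1 : 0 < -e * (u₁ - t₀) ∧ -e * (u₁ - t₀) < δ := by
    rcases he with rfl | rfl
    · rw [uIcc_of_le (by linarith)] at m1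
      have := lt_of_le_of_ne m1.2 n2
      constructor <;> linarith [m1.1]
    · rw [uIcc_of_ge (by linarith)] at m1
      have := lt_of_le_of_ne m1.1 n2.symm
      constructor <;> linarith [m1.2]
  have i1 : u₁ ∈ Ioo (t₀ - δ) (t₀ + δ) := by
    rcases he with rfl | rfl <;> constructor <;> linarith
  -- Of two intersections beyond the flex, each would have to lie beyond the other.
  have order : ∀ x ∈ Ioo (t₀ - δ) (t₀ + δ), ∀ y ∈ Ioo (t₀ - δ) (t₀ + δ), 0 < -e * (x - t₀) →
      0 < -e * (y - t₀) → x ≠ y → c.tvec t ⬝ᵥ c.lift x = 0 → c.tvec t ⬝ᵥ c.lift y = 0 →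
      0 < -e * ((c.covA t₀ ⬝ᵥ c.lift x) * (c.covB t₀ ⬝ᵥ c.lift y) -
        (c.covB t₀ ⬝ᵥ c.lift x) * (c.covA t₀ ⬝ᵥ c.lift y)) := by
    intro x hx y hy hxs hys hxy zx zy
    obtain ⟨x1, x2, x3⟩ := hw x hx hxs
    obtain ⟨y1, y2, y3⟩ := hw y hy hys
    have hyx : 0 < -ν * (c.tvec y ⬝ᵥ c.lift x) :=
      hs₂ y x hys.le (by linarith [(hbd y hy).2]) hxs.le (by linarith [(hbd x hx).2]) hxy.symm
    have hyP : 0 < -ν * (c.tvec y ⬝ᵥ c.lift t₀) :=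
      hs₂ y t₀ hys.le (by linarith [(hbd y hy).2]) (by simp) (by simpa using hδ₂)
        (by rintro rfl; simp at hys)
    have ftx := c.frame_tvec_dot t₀ t (c.lift x)
    have fty := c.frame_tvec_dot t₀ t (c.lift y)
    have ftP := c.frame_tvec_dot t₀ t (c.lift t₀)
    have fyx := c.frame_tvec_dot t₀ y (c.lift x)
    have fyy := c.frame_tvec_dot t₀ y (c.lift y)
    have fyP := c.frame_tvec_dot t₀ y (c.lift t₀)
    rw [tvec_dot_lift, covB_lift, covA_lift] at ftP fyP
    rw [tvec_dot_lift] at fyy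
    rw [zx] at ftx
    rw [zy] at fty
    set n := c.tvec t₀ ⬝ᵥ c.tvec t₀
    set Ax := c.covA t₀ ⬝ᵥ c.lift x
    set Bx := c.covB t₀ ⬝ᵥ c.lift x
    set Yx := c.tvec t₀ ⬝ᵥ c.lift x
    set Ay := c.covA t₀ ⬝ᵥ c.lift y
    set By := c.covB t₀ ⬝ᵥ c.lift y
    set Yy := c.tvec t₀ ⬝ᵥ c.lift y
    set M := c.coefT t₀ t
    set Q := c.coefB t₀ t
    set R := c.coefA t₀ t
    set M' := c.coefT t₀ y
    set Q' := c.coefB t₀ y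
    set R' := c.coefA t₀ y
    set q := M' * Q - M * Q' with hq
    set r := M' * R - M * R' with hr
    have r_pos : 0 < ν * r := by
      have e1 : n * (ν * r) = n ^ 2 * (M' * (ν * (c.tvec t ⬝ᵥ c.lift t₀)) +
          M * (-ν * (c.tvec y ⬝ᵥ c.lift t₀))) := by
        rw [hr]; linear_combination (-ν * M') * ftP + (ν * M) * fyP
      have e2 : 0 < n ^ 2 * (M' * (ν * (c.tvec t ⬝ᵥ c.lift t₀)) + M * (-ν * (c.tvec y ⬝ᵥ c.lift t₀))) := by
        positivity
      rw [← e1] at e2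
      exact pos_of_mul_pos_right e2 hn.le
    have hxx : 0 < ν * (-(Bx * q) + Ax * r) := by
      have e1 : ν * (-(Bx * q) + Ax * r) = n ^ 2 * (M * (-ν * (c.tvec y ⬝ᵥ c.lift x))) := by
        rw [hr, hq]; linear_combination (-ν * M') * ftx + (ν * M) * fyx
      rw [e1]; positivity
    have hyy : -(By * q) + Ay * r = 0 := by
      rw [hr, hq]; linear_combination (-M') * fty + M * fyy
    have e3 : (-e * By) * (ν * (-(Bx * q) + Ax * r)) = (ν * r) * (-e * (Ax * By - Bx * Ay)) := by
      linear_combination (-e * ν * Bx) * hyy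
    have e4 := mul_pos y3 hxx
    rw [e3] at e4
    exact pos_of_mul_pos_right e4 r_pos.le
  have hiff : ∀ u ∈ Ioo (t₀ - δ) (t₀ + δ), c.tvec t ⬝ᵥ c.lift u = 0 ↔ u = t ∨ u = u₁ := by
    intro u hu
    constructor
    · intro hz
      by_cases hus : 0 ≤ e * (u - t₀)
      · left
        by_contra hne
        have := hs₁ t u hts.le (by linarith [(hbd t htw).1]) hus (by linarith [(hbd u hu).1]) (Ne.symm hne)
        rw [hz, mul_zero] at this
        exact lt_irrefl _ this
      · right
        by_contra hne
        have hus' : 0 < -e * (u - t₀) := by linarith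
        have o1 := order u hu u₁ i1 hus' hu1.1 hne hz z1
        have o2 := order u₁ i1 u hu hu1.1 hus' (Ne.symm hne) z1 hz
        linarith
    · rintro (rfl | rfl)
      · exact c.tvec_dot_lift _
      · exact z1
  obtain ⟨w1, w2, w3⟩ := hw u₁ i1 hu1.1
  refine ⟨u₁, i1, ?_, hiff, ?_, ?_⟩
  · rintro rfl; linarith
  -- If the tangent at `t` were also the tangent at `u₁`, its covector would be a positive multiple of the one
  -- at `u₁`; but the two have opposite signs at `γ(t₀)`.
  · intro hd
    have e1 := c.eq_smul_tvec z1 hd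
    set κ := (c.tvec t ⬝ᵥ c.tvec u₁) / (c.tvec u₁ ⬝ᵥ c.tvec u₁)
    have hBT : c.covB t₀ ⬝ᵥ c.tvec t₀ = 0 := by
      unfold covB; rw [dotProduct_comm, dot_self_cross]
    have hAT : c.covA t₀ ⬝ᵥ c.tvec t₀ = 0 := by
      unfold covA; rw [dotProduct_comm, dot_cross_self]
    have f1 := c.frame_tvec_dot t₀ t (c.tvec t₀)
    have f2 := c.frame_tvec_dot t₀ u₁ (c.tvec t₀)
    rw [hBT, hAT] at f1 f2
    rw [e1, smul_dotProduct, smul_eq_mul] at f1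
    have f3 : (c.tvec t₀ ⬝ᵥ c.tvec t₀) * c.coefT t₀ t = (c.tvec t₀ ⬝ᵥ c.tvec t₀) * c.coefT t₀ u₁ * κ := by
      linear_combination κ * f2 - f1
    have hκ : 0 < κ := by
      have := mul_pos hn a2
      rw [f3] at this
      exact pos_of_mul_pos_right this (mul_pos hn w2).le
    have hP : 0 < -ν * (c.tvec u₁ ⬝ᵥ c.lift t₀) :=
      hs₂ u₁ t₀ hu1.1.le (by linarith) (by simp) (by simpa using hδ₂)
        (by rintro rfl; simp at hu1)
    rw [e1, smul_dotProduct, smul_eq_mul] at hTP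
    have := mul_pos hκ hP
    linarith
  · have hdec := c.frame_decomp t (c.lift u₁)
    rw [z1, zero_smul, add_zero] at hdec
    have d1 := congrArg (fun x => c.covA t₀ ⬝ᵥ x) hdec
    have d2 := congrArg (fun x => c.covB t₀ ⬝ᵥ x) hdec
    simp only [dotProduct_add, dotProduct_smul, smul_eq_mul] at d1 d2
    have hnt := dot_self_pos (c.tvec_ne_zero t)
    have e1 : (c.tvec t ⬝ᵥ c.tvec t) * ((c.covA t₀ ⬝ᵥ c.lift t) * (-e * (c.covB t₀ ⬝ᵥ c.lift u₁)) +
        (e * (c.covB t₀ ⬝ᵥ c.lift t)) * (c.covA t₀ ⬝ᵥ c.lift u₁)) =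
        c.coefT t₀ t * (-e * (c.covB t ⬝ᵥ c.lift u₁)) := by
      unfold coefT
      linear_combination (-e * (c.covA t₀ ⬝ᵥ c.lift t)) * d2 + (e * (c.covB t₀ ⬝ᵥ c.lift t)) * d1
    have e2 : 0 < (c.tvec t ⬝ᵥ c.tvec t) * ((c.covA t₀ ⬝ᵥ c.lift t) * (-e * (c.covB t₀ ⬝ᵥ c.lift u₁)) +
        (e * (c.covB t₀ ⬝ᵥ c.lift t)) * (c.covA t₀ ⬝ᵥ c.lift u₁)) := by positivity
    rw [e1] at e2
    exact pos_of_mul_pos_right e2 a2.le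

/-- At a flex, the further intersection of the curve with its tangents passes through the point of tangency from
the forward to the backward half tangent. -/
theorem local_flex {ℓ : Fin 3 → ℝ} {t₀ e : ℝ} (he : e = 1 ∨ e = -1) (hf : c.IsFlex t₀)
    (hp : ℓ ⬝ᵥ c.lift t₀ ≠ 0) :
    c.HasLocalSum (side e t₀) c.tvec (fun t u => c.halfSign ℓ t (c.lift u)) t₀ (isign (-e)) ∧
    ∀ᶠ δ in 𝓝[>] (0 : ℝ), ∀ᶠ t in side e t₀, ∀ u ∈ Ioo (t₀ - δ) (t₀ + δ), c.tvec t ⬝ᵥ c.lift u = 0 →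
      u = t ∨ (c.halfSign ℓ t (c.lift u) ≠ 0 ∧ c.tvec t ⬝ᵥ deriv c.lift u ≠ 0) := by
  have he0 : -e ≠ 0 := by rcases he with rfl | rfl <;> norm_num
  have ht : Tendsto (fun z : ℝ × ℝ => (ℓ ⬝ᵥ c.lift z.1) * (ℓ ⬝ᵥ c.lift z.2)) (𝓝 t₀ ×ˢ 𝓝 t₀) _ :=
    ((c.tendsto_dot_lift ℓ t₀).comp tendsto_fst).mul ((c.tendsto_dot_lift ℓ t₀).comp tendsto_snd)
  have hs := eventually_window_side (e := e) (p := fun t u => 0 < (ℓ ⬝ᵥ c.lift t) * (ℓ ⬝ᵥ c.lift u))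
    (ht.eventually (lt_mem_nhds (mul_self_pos.2 hp)))
  have key : ∀ᶠ δ in 𝓝[>] (0 : ℝ), ∀ᶠ t in side e t₀, t ∈ Ioo (t₀ - δ) (t₀ + δ) ∧
      ∃ u₁ ∈ Ioo (t₀ - δ) (t₀ + δ), t ≠ u₁ ∧
      (∀ u ∈ Ioo (t₀ - δ) (t₀ + δ), c.tvec t ⬝ᵥ c.lift u = 0 ↔ u = t ∨ u = u₁) ∧
      c.tvec t ⬝ᵥ deriv c.lift u₁ ≠ 0 ∧ c.halfSign ℓ t (c.lift u₁) = isign (-e) := by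
    filter_upwards [c.flex_window he hf, hs, self_mem_nhdsWithin] with δ h1 h2 hpos
    filter_upwards [h1, h2, eventually_mem_window hpos] with t ⟨u₁, i1, hne, hiff, hd, hB⟩ h2 htw
    refine ⟨htw, u₁, i1, hne, hiff, hd, isign_eq_of_mul_pos ?_⟩
    have := mul_pos hB (h2 u₁ i1)
    linarith
  constructor
  · filter_upwards [key] with δ h
    filter_upwards [h] with t ⟨htw, u₁, i1, hne, hiff, hd, hv⟩
    refine (finsum_window_two htw i1 hne hiff).trans ?_
    rw [halfSign_self, hv, zero_add]
  · filter_upwards [key] with δ h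
    filter_upwards [h] with t ⟨htw, u₁, i1, hne, hiff, hd, hv⟩ u hu hz
    rcases (hiff u hu).1 hz with rfl | rfl
    · exact Or.inl rfl
    · exact Or.inr ⟨by rw [hv]; exact isign_ne_zero he0, hd⟩

end ClosedCurve

section Curve

variable {ι : Type*} (C : ι → ClosedCurve)

/-! ### Incidence in terms of covectors -/

/-- The points of the normalization which the curve maps to the line with covector `d`. -/
def zeroSet (d : Fin 3 → ℝ) : Set (ι × ℝ) := {p | p ∈ normalization ι ∧ d ⬝ᵥ (C p.1).lift p.2 = 0}

theorem onLine_iff (p : ι × ℝ) (D : Line) : OnLine (pointAt C p) D ↔ D.rep ⬝ᵥ (C p.1).lift p.2 = 0 := by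
  conv_lhs => rw [← D.mk_rep]
  exact Projectivization.orthogonal_mk _ _

theorem onLine_tangentAt_iff (p q : ι × ℝ) : OnLine (pointAt C q) (tangentAt C p) ↔
    (C p.1).tvec p.2 ⬝ᵥ (C q.1).lift q.2 = 0 := Projectivization.orthogonal_mk _ _

theorem inter_eq (D : Line) : inter C D = zeroSet C D.rep := by
  ext p
  exact and_congr_right fun _ => onLine_iff C p D

theorem inter_tangentAt (p : ι × ℝ) : inter C (tangentAt C p) = zeroSet C ((C p.1).tvec p.2) := by
  ext q
  exact and_congr_right fun _ => onLine_tangentAt_iff C p q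

theorem pointAt_eq_iff (p q : ι × ℝ) : pointAt C p = pointAt C q ↔
    ∃ lam : ℝ, lam ≠ 0 ∧ (C q.1).lift q.2 = lam • (C p.1).lift p.2 := by
  rw [eq_comm]
  unfold pointAt ClosedCurve.point
  rw [Projectivization.mk_eq_mk_iff']
  constructor
  · rintro ⟨a, ha⟩
    refine ⟨a, ?_, ha.symm⟩
    rintro rfl
    rw [zero_smul] at ha
    exact (C q.1).lift_ne_zero q.2 ha.symm
  · rintro ⟨a, -, ha⟩
    exact ⟨a, ha.symm⟩

theorem tangentAt_eq_iff (p q : ι × ℝ) : tangentAt C p = tangentAt C q ↔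
    ∃ κ : ℝ, κ ≠ 0 ∧ (C p.1).tvec p.2 = κ • (C q.1).tvec q.2 := by
  unfold tangentAt ClosedCurve.tangent
  rw [Projectivization.mk_eq_mk_iff']
  constructor
  · rintro ⟨a, ha⟩
    refine ⟨a, ?_, ha.symm⟩
    rintro rfl
    rw [zero_smul] at ha
    exact (C p.1).tvec_ne_zero p.2 ha.symm
  · rintro ⟨a, -, ha⟩
    exact ⟨a, ha.symm⟩

theorem tangentAt_eq_line {p : ι × ℝ} {D : Line} {a : ℝ} (h : D.rep = a • (C p.1).tvec p.2) :
    tangentAt C p = D := by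
  rw [← D.mk_rep, eq_comm]
  exact (Projectivization.mk_eq_mk_iff' ..).2 ⟨a, h.symm⟩

theorem tangentAt_eq_iff_deriv {p q : ι × ℝ} (h : (C p.1).tvec p.2 ⬝ᵥ (C q.1).lift q.2 = 0) :
    tangentAt C p = tangentAt C q ↔ (C p.1).tvec p.2 ⬝ᵥ deriv (C q.1).lift q.2 = 0 := by
  rw [tangentAt_eq_iff]
  constructor
  · rintro ⟨κ, -, hκ⟩
    rw [hκ, smul_dotProduct, ClosedCurve.tvec_dot_deriv, smul_zero]
  · intro h'
    have e := (C q.1).eq_smul_tvec h h'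
    refine ⟨_, ?_, e⟩
    intro h0
    rw [h0, zero_smul] at e
    exact (C p.1).tvec_ne_zero p.2 e

theorem tvec_dot_eq_zero_of_tangentAt {p q : ι × ℝ} (h : tangentAt C p = tangentAt C q) :
    (C p.1).tvec p.2 ⬝ᵥ (C q.1).lift q.2 = 0 := by
  obtain ⟨κ, -, hκ⟩ := (tangentAt_eq_iff C p q).1 h
  rw [hκ, smul_dotProduct, ClosedCurve.tvec_dot_lift, smul_zero]

theorem tvec_dot_eq_zero_of_pointAt {p q : ι × ℝ} (h : pointAt C p = pointAt C q) :
    (C p.1).tvec p.2 ⬝ᵥ (C q.1).lift q.2 = 0 := by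
  obtain ⟨κ, -, hκ⟩ := (pointAt_eq_iff C p q).1 h
  rw [hκ, dotProduct_smul, ClosedCurve.tvec_dot_lift, smul_zero]

theorem pointAt_eq_iff_covB {p q : ι × ℝ} (h : (C p.1).tvec p.2 ⬝ᵥ (C q.1).lift q.2 = 0) :
    pointAt C p = pointAt C q ↔ (C p.1).covB p.2 ⬝ᵥ (C q.1).lift q.2 = 0 := by
  rw [pointAt_eq_iff]
  constructor
  · rintro ⟨lam, -, hl⟩
    rw [hl, dotProduct_smul, ClosedCurve.covB_lift, smul_zero]
  · intro h'
    have hn := (dot_self_pos ((C p.1).tvec_ne_zero p.2)).ne'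
    have e := (C p.1).frame_decomp p.2 ((C q.1).lift q.2)
    rw [h, h', zero_smul, zero_smul, add_zero, add_zero] at e
    have e2 : (C q.1).lift q.2 = (((C p.1).tvec p.2 ⬝ᵥ (C p.1).tvec p.2)⁻¹ *
        ((C p.1).covA p.2 ⬝ᵥ (C q.1).lift q.2)) • (C p.1).lift p.2 := by
      rw [mul_smul, ← e, smul_smul, inv_mul_cancel₀ hn, one_smul]
    refine ⟨_, ?_, e2⟩
    intro h0
    rw [h0, zero_smul] at e2
    exact (C q.1).lift_ne_zero q.2 e2

theorem zeroSet_eq_iUnion (d : Fin 3 → ℝ) :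
    zeroSet C d = ⋃ j, (fun u => (j, u)) '' {u | u ∈ Ico (0 : ℝ) 1 ∧ d ⬝ᵥ (C j).lift u = 0} := by
  ext ⟨j, u⟩
  simp [zeroSet, normalization]

theorem finite_zeroSet [Finite ι] {d : Fin 3 → ℝ} (hd : d ≠ 0) : (zeroSet C d).Finite := by
  rw [zeroSet_eq_iUnion]
  exact finite_iUnion fun j => ((C j).finite_zeros hd Ico_subset_Icc_self).image _

theorem finsum_zeroSet [Finite ι] {d : Fin 3 → ℝ} (hd : d ≠ 0) (f : ι × ℝ → ℤ) :
    ∑ᶠ p ∈ zeroSet C d, f p =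
      ∑ᶠ j, ∑ᶠ u ∈ {u | u ∈ Ico (0 : ℝ) 1 ∧ d ⬝ᵥ (C j).lift u = 0}, f (j, u) := by
  rw [zeroSet_eq_iUnion, finsum_mem_iUnion]
  · refine finsum_congr fun j => ?_
    rw [finsum_mem_image]
    intro u _ v _ h
    exact (Prod.mk.inj h).2
  · intro j k hjk
    refine Set.disjoint_left.2 ?_
    rintro _ ⟨u, -, rfl⟩ ⟨v, -, h⟩
    exact hjk (Prod.mk.inj h).1.symm
  · exact fun j => ((C j).finite_zeros hd Ico_subset_Icc_self).image _

theorem sum_zeroSet_eventually [Finite ι] {α : Type*} {F : Filter α} {D : α → Fin 3 → ℝ} {D₀ : Fin 3 → ℝ}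
    (h0 : D₀ ≠ 0) (hD : Tendsto D F (𝓝 D₀)) {w : α → ι × ℝ → ℤ}
    (hw : ∀ x j u, w x (j, u + 1) = w x (j, u)) {v : ι × ℝ → ℤ}
    (h : ∀ q ∈ zeroSet C D₀, (C q.1).HasLocalSum F D (fun x u => w x (q.1, u)) q.2 (v q)) :
    ∀ᶠ x in F, ∑ᶠ q ∈ zeroSet C (D x), w x q = ∑ᶠ q ∈ zeroSet C D₀, v q := by
  have key : ∀ j, ∀ᶠ x in F, ∑ᶠ u ∈ {u | u ∈ Ico (0 : ℝ) 1 ∧ D x ⬝ᵥ (C j).lift u = 0}, w x (j, u) =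
      ∑ᶠ u ∈ {u | u ∈ Ico (0 : ℝ) 1 ∧ D₀ ⬝ᵥ (C j).lift u = 0}, v (j, u) := fun j =>
    (C j).sum_zeros_eventually h0 hD (w := fun x u => w x (j, u)) (v := fun u => v (j, u))
      (fun x u => hw x j u) fun u hu hz => h (j, u) ⟨hu, hz⟩
  filter_upwards [eventually_all.2 key, hD.eventually_ne h0] with x hx hne
  rw [finsum_zeroSet C hne, finsum_zeroSet C h0]
  exact finsum_congr hx

/-! ### The jumps of the signed count of the points on the tangents -/

/-- The sign of a bitangent tangent at `p` and `q`: it is `1` if the curve lies on the same side of it near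
both points, in the chart with line at infinity `ℓ`. -/
noncomputable def bitangentSign (ℓ : Fin 3 → ℝ) (p q : ι × ℝ) : ℤ :=
  isign ((C p.1).sideSign 1 p.2 * (C q.1).sideSign 1 q.2 * ((C p.1).tvec p.2 ⬝ᵥ (C q.1).tvec q.2) *
    (ℓ ⬝ᵥ (C p.1).lift p.2) * (ℓ ⬝ᵥ (C q.1).lift q.2))

/-- The sign of a tangent at `p` through a point `q` at infinity: it is `1` if near `p` the curve lies on the
side of its tangent on which the asymptote at `q` lies. -/
noncomputable def asymptoteSign (ℓ : Fin 3 → ℝ) (p q : ι × ℝ) : ℤ :=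
  isign ((C p.1).sideSign 1 p.2 * (ℓ ⬝ᵥ (C p.1).lift p.2) * (ℓ ⬝ᵥ deriv (C q.1).lift q.2) *
    ((C p.1).tvec p.2 ⬝ᵥ deriv (C q.1).lift q.2))

open Classical in
/-- The jump at `p` of the signed count of the points on the tangents, caused by the point `q` of the
tangent at `p`. -/
noncomputable def jump (ℓ : Fin 3 → ℝ) (p q : ι × ℝ) : ℤ :=
  (if q = p ∧ (C p.1).IsFlex p.2 then -2 else 0) +
  (if p ≠ q ∧ pointAt C p = pointAt C q then -2 else 0) +
  (if p ≠ q ∧ tangentAt C p = tangentAt C q then 2 * bitangentSign C ℓ p q else 0) +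
  (if p ≠ q ∧ ℓ ⬝ᵥ (C p.1).lift p.2 = 0 then 2 else 0) +
  (if ℓ ⬝ᵥ (C q.1).lift q.2 = 0 ∧ ℓ ⬝ᵥ (C p.1).lift p.2 ≠ 0 then 2 * asymptoteSign C ℓ p q else 0)

/-- The intersection at the parameter `u` of the component `j` with the tangent of the component `i` at `t`
is regular: it is the point of tangency, or transverse, finite and different from the point of tangency. -/
def RegularAt (ℓ : Fin 3 → ℝ) (i : ι) (t : ℝ) (j : ι) (u : ℝ) : Prop :=
  (j = i ∧ ∃ n : ℤ, u = t + n) ∨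
    ((C i).halfSign ℓ t ((C j).lift u) ≠ 0 ∧ (C i).tvec t ⬝ᵥ deriv (C j).lift u ≠ 0)

variable {C} (hC : IsGeneric C) {L : Line} (hL : IsGenericallyTransverse C L)

include hL in
theorem deriv_ne_zero_at_infinity {p : ι × ℝ} (hp : p ∈ normalization ι)
    (h : L.rep ⬝ᵥ (C p.1).lift p.2 = 0) : L.rep ⬝ᵥ deriv (C p.1).lift p.2 ≠ 0 := fun h' =>
  hL.transverse p ⟨hp, (onLine_iff C p L).2 h⟩ (tangentAt_eq_line C ((C p.1).eq_smul_tvec h h'))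

include hL in
theorem not_isFlex_of_infinity {p q : ι × ℝ} (hp : p ∈ normalization ι) (hq : q ∈ normalization ι)
    (h : (C p.1).tvec p.2 ⬝ᵥ (C q.1).lift q.2 = 0) (h' : L.rep ⬝ᵥ (C q.1).lift q.2 = 0) :
    ¬ (C p.1).IsFlex p.2 := fun hf =>
  hL.flex q ⟨hq, (onLine_iff C q L).2 h'⟩ p ⟨hp, hf⟩ ((onLine_tangentAt_iff C p q).2 h)

include hL in
theorem ne_zero_of_bitangent {p q : ι × ℝ} (hp : p ∈ normalization ι) (hq : q ∈ normalization ι)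
    (hne : p ≠ q) (h : tangentAt C p = tangentAt C q) :
    L.rep ⬝ᵥ (C p.1).lift p.2 ≠ 0 ∧ L.rep ⬝ᵥ (C q.1).lift q.2 ≠ 0 := by
  constructor
  · intro h0
    refine hL.bitangent p ⟨hp, (onLine_iff C p L).2 h0⟩ (tangentAt C p) ⟨p, hp, q, hq, hne, rfl, h.symm⟩ ?_
    exact (onLine_tangentAt_iff C p p).2 ((C p.1).tvec_dot_lift p.2)
  · intro h0
    refine hL.bitangent q ⟨hq, (onLine_iff C q L).2 h0⟩ (tangentAt C p) ⟨p, hp, q, hq, hne, rfl, h.symm⟩ ?_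
    rw [h]
    exact (onLine_tangentAt_iff C q q).2 ((C q.1).tvec_dot_lift q.2)

include hC hL in
/-- The local contributions at an intersection `q` with the tangent at `p`, for the tangents on both sides
of `p`. -/
theorem exists_local_values {p q : ι × ℝ} (hp : p ∈ normalization ι)
    (hq : q ∈ zeroSet C ((C p.1).tvec p.2)) : ∃ v : ℝ → ℤ,
      (∀ e : ℝ, e = 1 ∨ e = -1 → (C q.1).HasLocalSum (side e p.2) (C p.1).tvec
        (fun t u => (C p.1).halfSign L.rep t ((C q.1).lift u)) q.2 (v e) ∧
        ∀ᶠ δ in 𝓝[>] (0 : ℝ), ∀ᶠ t in side e p.2, ∀ u ∈ Ioo (q.2 - δ) (q.2 + δ),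
          (C p.1).tvec t ⬝ᵥ (C q.1).lift u = 0 → RegularAt C L.rep p.1 t q.1 u) ∧
      v 1 - v (-1) = jump C L.rep p q := by
  obtain ⟨hqN, h0⟩ := hq
  have reg : ∀ {v : ℝ → ℤ}, (∀ e : ℝ, e = 1 ∨ e = -1 →
      ClosedCurve.LocalContribution (C p.1) (C q.1) L.rep p.2 q.2 e (v e)) →
      ∀ e : ℝ, e = 1 ∨ e = -1 → (C q.1).HasLocalSum (side e p.2) (C p.1).tvec
        (fun t u => (C p.1).halfSign L.rep t ((C q.1).lift u)) q.2 (v e) ∧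
        ∀ᶠ δ in 𝓝[>] (0 : ℝ), ∀ᶠ t in side e p.2, ∀ u ∈ Ioo (q.2 - δ) (q.2 + δ),
          (C p.1).tvec t ⬝ᵥ (C q.1).lift u = 0 → RegularAt C L.rep p.1 t q.1 u := by
    intro v h e he
    refine ⟨(h e he).1, (h e he).2.mono fun δ hδ => hδ.mono fun t ht u hu hz => Or.inr (ht u hu hz)⟩
  have i1 : isign 1 = 1 := isign_pos one_pos
  have i2 : isign (-1) = -1 := by rw [isign_opp, i1]
  by_cases hpq : q = p
  · subst hpq
    by_cases hf : (C q.1).IsFlex q.2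
    · have hl : L.rep ⬝ᵥ (C q.1).lift q.2 ≠ 0 := fun h => not_isFlex_of_infinity hL hp hqN h0 h hf
      refine ⟨fun e => isign (-e), fun e he => ⟨((C q.1).local_flex he hf hl).1, ?_⟩, ?_⟩
      · refine ((C q.1).local_flex he hf hl).2.mono fun δ hδ => hδ.mono fun t ht u hu hz => ?_
        rcases ht u hu hz with rfl | h
        · exact Or.inl ⟨rfl, 0, by simp⟩
        · exact Or.inr h
      · simp [jump, hf, hl, i1, i2]
    · refine ⟨fun _ => 0, fun e he => ⟨((C q.1).local_diagonal hf).1, ?_⟩, ?_⟩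
      · refine ((C q.1).local_diagonal (ℓ := L.rep) (e := e) hf).2.mono fun δ hδ => hδ.mono fun t ht u hu hz => ?_
        exact Or.inl ⟨rfl, 0, by simp [ht u hu hz]⟩
      · simp [jump, hf]
  have hpq' : p ≠ q := fun h => hpq h.symm
  by_cases hpt : pointAt C p = pointAt C q
  -- At a node at infinity the jumps `-2` and `2` cancel.
  · obtain ⟨lam, hlam, hnode⟩ := (pointAt_eq_iff C p q).1 hpt
    have hT := hC.node_transverse p hp q hqN hpq' hpt
    have h' : (C p.1).tvec p.2 ⬝ᵥ deriv (C q.1).lift q.2 ≠ 0 := fun h =>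
      hT ((tangentAt_eq_iff_deriv C h0).2 h)
    by_cases hl : L.rep ⬝ᵥ (C p.1).lift p.2 = 0
    · have hl2 : L.rep ⬝ᵥ (C q.1).lift q.2 = 0 := by rw [hnode, dotProduct_smul, hl, smul_zero]
      have hf := not_isFlex_of_infinity hL hp hqN h0 hl2
      refine ⟨fun _ => _, reg fun e he => (C p.1).localContribution_node_at_infinity (C q.1) he hlam hnode h' hf hl
        (deriv_ne_zero_at_infinity hL hp hl) (deriv_ne_zero_at_infinity hL hqN hl2), ?_⟩
      simp [jump, hpq, hpq', hpt, hT, hl]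
    · have hl2 : L.rep ⬝ᵥ (C q.1).lift q.2 ≠ 0 := by
        rw [hnode, dotProduct_smul, smul_eq_mul]; exact mul_ne_zero hlam hl
      refine ⟨fun e => isign (-e), reg fun e he =>
        (C p.1).localContribution_node (C q.1) he hlam hnode h' hl, ?_⟩
      simp [jump, hpq, hpq', hpt, hT, hl, hl2, i1, i2]
  have hB : (C p.1).covB p.2 ⬝ᵥ (C q.1).lift q.2 ≠ 0 := fun h => hpt ((pointAt_eq_iff_covB C h0).2 h)
  by_cases hT : tangentAt C p = tangentAt C q
  · obtain ⟨hl, hl2⟩ := ne_zero_of_bitangent hL hp hqN hpq' hT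
    have hf : ¬ (C p.1).IsFlex p.2 := fun hf => hC.flex_tangent p ⟨hp, hf⟩ q hqN hpq' hT
    have hf' : ¬ (C q.1).IsFlex q.2 := fun hf => hC.flex_tangent q ⟨hqN, hf⟩ p hp hpq hT.symm
    obtain ⟨κ, hκ, hκT⟩ := (tangentAt_eq_iff C p q).1 hT
    have hs : (C p.1).halfSign L.rep p.2 ((C q.1).lift q.2) ≠ 0 :=
      isign_ne_zero (mul_ne_zero (mul_ne_zero hB hl) hl2)
    refine ⟨_, reg fun e he => (C p.1).localContribution_bitangent (C q.1) he hκ hκT hf hf' hs, ?_⟩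
    have hn := dot_self_pos ((C q.1).tvec_ne_zero q.2)
    have hν : (C p.1).sideSign 1 p.2 ≠ 0 := by
      rcases ((C p.1).sideSign_spec p.2 (Or.inl rfl)).1 with h | h <;> rw [h] <;> norm_num
    have hν' : (C q.1).sideSign 1 q.2 ≠ 0 := by
      rcases ((C q.1).sideSign_spec q.2 (Or.inl rfl)).1 with h | h <;> rw [h] <;> norm_num
    have hj : jump C L.rep p q = 2 * bitangentSign C L.rep p q := by
      simp [jump, hpq, hpq', hpt, hT, hl, hl2]
    rw [hj]
    set Ξ := κ * (C p.1).sideSign 1 p.2 * (C q.1).sideSign 1 q.2 * ((C p.1).covB p.2 ⬝ᵥ (C q.1).lift q.2)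
      with hΞ
    have hΞ0 : Ξ ≠ 0 := by positivity
    have hsg : bitangentSign C L.rep p q = isign Ξ * (C p.1).halfSign L.rep p.2 ((C q.1).lift q.2) := by
      unfold bitangentSign ClosedCurve.halfSign
      rw [← isign_mul]
      refine isign_eq_of_mul_pos ?_
      rw [hκT, smul_dotProduct, smul_eq_mul, hΞ]
      have e1 : ∀ a b n B x y : ℝ, a * b * (κ * n) * x * y * (κ * a * b * B * (B * x * y)) =
          n * (κ * a * b * x * y * B) ^ 2 := fun _ _ _ _ _ _ => by ring
      rw [e1]
      positivity
    rw [hsg]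
    rcases lt_or_gt_of_ne hΞ0 with h | h
    · rw [if_neg (by linarith), if_pos (by linarith), isign_neg h]; ring
    · rw [if_pos (by linarith), if_neg (by linarith), isign_pos h]; ring
  have h' : (C p.1).tvec p.2 ⬝ᵥ deriv (C q.1).lift q.2 ≠ 0 := fun h =>
    hT ((tangentAt_eq_iff_deriv C h0).2 h)
  by_cases hl : L.rep ⬝ᵥ (C p.1).lift p.2 = 0
  · refine ⟨fun e => isign e, reg fun e he => (C p.1).localContribution_tangency_at_infinity (C q.1) he h0 h' hl
      (deriv_ne_zero_at_infinity hL hp hl) hB, ?_⟩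
    simp [jump, hpq, hpq', hpt, hT, hl, i1, i2]
  by_cases hl2 : L.rep ⬝ᵥ (C q.1).lift q.2 = 0
  · refine ⟨_, reg fun e he => (C p.1).localContribution_point_at_infinity (C q.1) he h0 h'
      (not_isFlex_of_infinity hL hp hqN h0 hl2) hl hl2 (deriv_ne_zero_at_infinity hL hqN hl2) hB, ?_⟩
    have hj : jump C L.rep p q = 2 * asymptoteSign C L.rep p q := by
      simp [jump, hpq, hpt, hT, hl, hl2]
    rw [hj, one_mul, neg_one_mul, isign_opp, asymptoteSign]
    ring
  · have hs : (C p.1).halfSign L.rep p.2 ((C q.1).lift q.2) ≠ 0 :=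
      isign_ne_zero (mul_ne_zero (mul_ne_zero hB hl) hl2)
    refine ⟨_, reg fun e he => (C p.1).localContribution_regular (C q.1) h0 h' hs, ?_⟩
    simp [jump, hpq, hpt, hT, hl, hl2]

include hC hL in
/-- Along each component, the jumps of the signed count of the points on the tangents add up to zero. -/
theorem sum_jump_component [Finite ι] (i : ι) : ∑ᶠ t ∈ Ico (0 : ℝ) 1,
    ∑ᶠ q ∈ zeroSet C ((C i).tvec t), jump C L.rep (i, t) q = 0 := by
  have hloc : ∀ t, ∃ r l : ℤ, t ∈ Ico (0 : ℝ) 1 →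
      (∀ᶠ s in 𝓝[>] t, ∑ᶠ q ∈ zeroSet C ((C i).tvec s), (C i).halfSign L.rep s ((C q.1).lift q.2) = r) ∧
      (∀ᶠ s in 𝓝[<] t, ∑ᶠ q ∈ zeroSet C ((C i).tvec s), (C i).halfSign L.rep s ((C q.1).lift q.2) = l) ∧
      ∑ᶠ q ∈ zeroSet C ((C i).tvec t), jump C L.rep (i, t) q = r - l := by
    intro t
    by_cases ht : t ∈ Ico (0 : ℝ) 1
    · have hex : ∀ q, ∃ v : ℝ → ℤ, q ∈ zeroSet C ((C i).tvec t) →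
          (∀ e : ℝ, e = 1 ∨ e = -1 → (C q.1).HasLocalSum (side e t) (C i).tvec
            (fun t u => (C i).halfSign L.rep t ((C q.1).lift u)) q.2 (v e)) ∧
          v 1 - v (-1) = jump C L.rep (i, t) q := by
        intro q
        by_cases hq : q ∈ zeroSet C ((C i).tvec t)
        · obtain ⟨v, h1, h2⟩ := exists_local_values hC hL (p := (i, t)) ht hq
          exact ⟨v, fun _ => ⟨fun e he => (h1 e he).1, h2⟩⟩
        · exact ⟨fun _ => 0, fun h => absurd h hq⟩
      choose v hv using hex
      have hside : ∀ e : ℝ, e = 1 ∨ e = -1 → ∀ᶠ s in side e t,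
          ∑ᶠ q ∈ zeroSet C ((C i).tvec s), (C i).halfSign L.rep s ((C q.1).lift q.2) =
          ∑ᶠ q ∈ zeroSet C ((C i).tvec t), v q e := by
        intro e he
        refine sum_zeroSet_eventually C ((C i).tvec_ne_zero t) ((C i).tendsto_tvec_side e t)
          (w := fun s q => (C i).halfSign L.rep s ((C q.1).lift q.2))
          (fun s j u => (C i).halfSign_lift_add_one L.rep s (C j) u) fun q hq => (hv q hq).1 e he
      refine ⟨∑ᶠ q ∈ zeroSet C ((C i).tvec t), v q 1, ∑ᶠ q ∈ zeroSet C ((C i).tvec t), v q (-1),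
        fun _ => ⟨?_, ?_, ?_⟩⟩
      · rw [← side_one]; exact hside 1 (Or.inl rfl)
      · rw [← side_neg_one]; exact hside (-1) (Or.inr rfl)
      · rw [← finsum_mem_sub_distrib _ _ (finite_zeroSet C ((C i).tvec_ne_zero t))]
        exact finsum_mem_congr rfl fun q hq => (hv q hq).2.symm
    · exact ⟨0, 0, fun h => absurd h ht⟩
  choose r l h using hloc
  rw [finsum_mem_congr rfl fun t ht => (h t ht).2.2]
  refine sum_jumps_circle (f := fun s =>
    ∑ᶠ q ∈ zeroSet C ((C i).tvec s), (C i).halfSign L.rep s ((C q.1).lift q.2)) (fun s => ?_)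
    (fun t ht => (h t ht).1) (fun t ht => (h t ht).2.1)
  simp only [ClosedCurve.tvec_add_one, ClosedCurve.halfSign_add_one]

/-! ### Finiteness -/

theorem finite_flexes [Finite ι] : (flexes C).Finite := by
  have : flexes C ⊆ ⋃ j, (fun u => (j, u)) '' {u | u ∈ Icc (0 : ℝ) 1 ∧ (C j).IsFlex u} := by
    rintro ⟨j, u⟩ ⟨hu, hf⟩
    exact mem_iUnion.2 ⟨j, u, ⟨Ico_subset_Icc_self hu, hf⟩, rfl⟩
  exact (finite_iUnion fun j => (finite_of_isolated isCompact_Icc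
    fun t _ => (C j).eventually_not_isFlex t).image _).subset this

include hC hL in
/-- All but finitely many tangents meet the curve only in regular points. -/
theorem finite_irregular [Finite ι] (i : ι) :
    {t | t ∈ Icc (0 : ℝ) 1 ∧ ¬ ∀ j u, (C i).tvec t ⬝ᵥ (C j).lift u = 0 → RegularAt C L.rep i t j u}.Finite := by
  have h1 : ∀ t ∈ Ico (0 : ℝ) 1, ∀ᶠ s in 𝓝[≠] t,
      ∀ j u, (C i).tvec s ⬝ᵥ (C j).lift u = 0 → RegularAt C L.rep i s j u := by
    intro t ht
    refine eventually_ne_of_side fun e he => ?_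
    rw [eventually_all]
    intro j
    refine (C j).forall_zeros_eventually (P := fun s u => RegularAt C L.rep i s j u)
      ((C i).tendsto_tvec_side e t) ?_ ?_
    · intro s u
      obtain ⟨ε, hε, h⟩ := (C j).exists_sign
      have hε0 : ε ≠ 0 := by rintro rfl; norm_num at hε
      have e1 : (C i).tvec s ⬝ᵥ deriv (C j).lift (u + 1) ≠ 0 ↔ (C i).tvec s ⬝ᵥ deriv (C j).lift u ≠ 0 := by
        rw [(h u).2, dotProduct_smul, smul_eq_mul]
        simp [hε0]
      unfold RegularAt
      rw [e1, (C i).halfSign_lift_add_one]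
      refine or_congr_left (and_congr_right fun _ => ?_)
      constructor
      · rintro ⟨n, hn⟩
        exact ⟨n - 1, by push_cast; linarith⟩
      · rintro ⟨n, hn⟩
        exact ⟨n + 1, by push_cast; linarith⟩
    · intro u hu hz
      obtain ⟨v, h, -⟩ := exists_local_values hC hL (p := (i, t)) (q := (j, u)) ht ⟨hu, hz⟩
      exact (h e he).2
  refine finite_of_isolated isCompact_Icc fun t ht => ?_
  simp only [not_not]
  rcases ht.2.eq_or_lt with rfl | hlt
  · have h2 : Tendsto (fun s : ℝ => s - 1) (𝓝[≠] 1) (𝓝[≠] 0) := by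
      refine tendsto_nhdsWithin_of_tendsto_nhds_of_eventually_within _ ?_ ?_
      · have : Tendsto (fun y : ℝ => y - 1) (𝓝 1) (𝓝 (1 - 1)) := Continuous.tendsto (by fun_prop) _
        rw [sub_self] at this
        exact this.mono_left nhdsWithin_le_nhds
      · filter_upwards [self_mem_nhdsWithin] with y hy
        exact sub_ne_zero.2 hy
    filter_upwards [h2.eventually (h1 0 ⟨le_rfl, one_pos⟩)] with s hs j u hz
    have e1 : (C i).tvec (s - 1) = (C i).tvec s := by rw [← (C i).tvec_add_one, sub_add_cancel]
    have e2 : ∀ w, (C i).halfSign L.rep (s - 1) w = (C i).halfSign L.rep s w := fun w => by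
      rw [← (C i).halfSign_add_one, sub_add_cancel]
    rcases hs j u (by rw [e1]; exact hz) with ⟨h3, n, hn⟩ | h3
    · exact Or.inl ⟨h3, n - 1, by rw [hn]; push_cast; ring⟩
    · rw [e1, e2] at h3
      exact Or.inr h3
  · exact h1 t ⟨ht.1, hlt⟩

theorem eq_of_add_int {p q : ι × ℝ} (hp : p ∈ normalization ι) (hq : q ∈ normalization ι)
    (h : q.1 = p.1 ∧ ∃ n : ℤ, q.2 = p.2 + n) : q = p := by
  obtain ⟨h1, n, hn⟩ := h
  have hp : p.2 ∈ Ico (0 : ℝ) 1 := hp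
  have hq : q.2 ∈ Ico (0 : ℝ) 1 := hq
  have a1 : (-1 : ℝ) < n := by linarith [hp.2, hq.1]
  have a2 : (n : ℝ) < 1 := by linarith [hp.1, hq.2]
  have : n = 0 := by
    have h1' : -1 < n := by exact_mod_cast a1
    have h2' : n < 1 := by exact_mod_cast a2
    omega
  rw [this] at hn
  exact Prod.ext h1 (by simpa using hn)

variable (C L) in
/-- The pairs `(p, q)` of distinct points of the normalization for which `q` lies on the tangent at `p`, and which
are a node or a bitangent or have a point at infinity. -/
def specialPairs : Set ((ι × ℝ) × (ι × ℝ)) :=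
  {x | x.1 ∈ normalization ι ∧ x.2 ∈ zeroSet C ((C x.1.1).tvec x.1.2) ∧ x.1 ≠ x.2 ∧
    (pointAt C x.1 = pointAt C x.2 ∨ tangentAt C x.1 = tangentAt C x.2 ∨
      L.rep ⬝ᵥ (C x.1.1).lift x.1.2 = 0 ∨ L.rep ⬝ᵥ (C x.2.1).lift x.2.2 = 0)}

include hC hL in
theorem finite_specialPairs [Finite ι] : (specialPairs C L).Finite := by
  set I : Set (ι × ℝ) := ⋃ i, (fun u => (i, u)) '' {t | t ∈ Icc (0 : ℝ) 1 ∧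
    ¬ ∀ j u, (C i).tvec t ⬝ᵥ (C j).lift u = 0 → RegularAt C L.rep i t j u} with hI
  have hIfin : I.Finite := finite_iUnion fun i => (finite_irregular hC hL i).image _
  have : specialPairs C L ⊆ ⋃ p ∈ I, (fun q => (p, q)) '' zeroSet C ((C p.1).tvec p.2) := by
    rintro ⟨p, q⟩ ⟨hp, hq, hne, h⟩
    refine mem_iUnion₂.2 ⟨p, ?_, q, hq, rfl⟩
    refine mem_iUnion.2 ⟨p.1, p.2, ⟨Ico_subset_Icc_self hp, fun hreg => ?_⟩, rfl⟩
    rcases hreg q.1 q.2 hq.2 with h1 | ⟨h1, h2⟩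
    · exact hne (eq_of_add_int hp hq.1 h1).symm
    · have h3 := ne_zero_of_isign h1
      rcases h with h | h | h | h
      · rw [(pointAt_eq_iff_covB C hq.2).1 h] at h3; simp at h3
      · exact h2 ((tangentAt_eq_iff_deriv C hq.2).1 h)
      · simp only at h; rw [h] at h3; simp at h3
      · simp only at h; rw [h] at h3; simp at h3
  exact (hIfin.biUnion fun p _ => (finite_zeroSet C ((C p.1).tvec_ne_zero p.2)).image _).subset this

end Curve

/-! ### The number of intersections in a pencil of lines -/

namespace ClosedCurve

variable (c : ClosedCurve)

theorem hasLocalSum_of_transverse {α : Type*} {F : Filter α} {D : α → Fin 3 → ℝ} {D₀ : Fin 3 → ℝ} {u₀ : ℝ}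
    (hD : Tendsto D F (𝓝 D₀)) (h0 : D₀ ⬝ᵥ c.lift u₀ = 0) (h' : D₀ ⬝ᵥ deriv c.lift u₀ ≠ 0) :
    c.HasLocalSum F D (fun _ _ => 1) u₀ 1 := by
  filter_upwards [c.transverse_window h0 h'] with δ hδ
  filter_upwards [hD.eventually hδ] with x ⟨_, _, u₁, hu₁, h⟩
  exact finsum_window_one hu₁ h

/-- Lines through a point of the curve which is not a flex, close to the tangent there, meet the curve in
one further point nearby. -/
theorem hasLocalSum_of_pencil {α : Type*} {F : Filter α} {D : α → Fin 3 → ℝ} {κ u₀ : ℝ} (hf : ¬ c.IsFlex u₀)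
    (hκ : κ ≠ 0) (hD : Tendsto D F (𝓝 (κ • c.tvec u₀))) (h0 : ∀ᶠ x in F, D x ⬝ᵥ c.lift u₀ = 0)
    (h' : ∀ᶠ x in F, D x ⬝ᵥ deriv c.lift u₀ ≠ 0) : c.HasLocalSum F D (fun _ _ => 1) u₀ 2 := by
  filter_upwards [c.tangent_window_pencil hf hκ, self_mem_nhdsWithin] with δ hδ hpos
  have hpos : 0 < δ := hpos
  filter_upwards [hD.eventually hδ, h0, h'] with x h h0 h'
  obtain ⟨u₁, hu₁, hne, h⟩ := h h0 h'
  exact finsum_window_two (f := fun _ => 1) (u₁ := u₀) ⟨by linarith, by linarith⟩ hu₁ hne h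

/-- When a line sweeps over a tangent, two intersections appear or disappear. -/
theorem hasLocalSum_of_tangent {D : ℝ → Fin 3 → ℝ} {E : Fin 3 → ℝ} {κ u₀ x₀ e : ℝ} (hf : ¬ c.IsFlex u₀)
    (hκ : κ ≠ 0) (hD : ∀ x, D x = κ • c.tvec u₀ + (x - x₀) • E) (hE : E ⬝ᵥ c.lift u₀ ≠ 0)
    (he : e = 1 ∨ e = -1) : c.HasLocalSum (side e x₀) D (fun _ _ => 1) u₀
      (1 - isign (e * (κ * c.sideSign 1 u₀ * (E ⬝ᵥ c.lift u₀)))) := by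
  have hν : c.sideSign 1 u₀ ≠ 0 := by
    rcases (c.sideSign_spec u₀ (Or.inl rfl)).1 with h | h <;> rw [h] <;> norm_num
  have he0 : e ≠ 0 := by rcases he with rfl | rfl <;> norm_num
  have hlim : Tendsto D (side e x₀) (𝓝 (κ • c.tvec u₀)) := by
    have : Tendsto D (𝓝 x₀) (𝓝 (D x₀)) := by
      have hc : Continuous D := by
        rw [show D = fun x => κ • c.tvec u₀ + (x - x₀) • E from funext hD]
        fun_prop
      exact hc.tendsto x₀
    rw [hD x₀, sub_self, zero_smul, add_zero] at this
    exact this.mono_left (side_le e x₀)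
  rcases lt_or_gt_of_ne (show e * (κ * c.sideSign 1 u₀ * (E ⬝ᵥ c.lift u₀)) ≠ 0 by positivity) with h | h
  · rw [isign_neg h]
    filter_upwards [c.tangent_window_two hf hκ] with δ hδ
    filter_upwards [hlim.eventually hδ, eventually_side_pos e x₀] with x hx hpos
    have hneg : κ * c.sideSign 1 u₀ * (D x ⬝ᵥ c.lift u₀) < 0 := by
      have := mul_neg_of_pos_of_neg hpos h
      rw [hD, add_dotProduct, smul_dotProduct, smul_dotProduct, tvec_dot_lift, smul_eq_mul, smul_eq_mul,
        mul_zero, zero_add]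
      have e1 : e * (x - x₀) * (e * (κ * c.sideSign 1 u₀ * (E ⬝ᵥ c.lift u₀))) =
        (e * e) * (κ * c.sideSign 1 u₀ * ((x - x₀) * (E ⬝ᵥ c.lift u₀))) := by ring
      rwa [e1, mul_self_of_sign he, one_mul] at this
    obtain ⟨u₁, h₁, u₂, h₂, hne, h, -⟩ := hx hneg
    exact finsum_window_two (f := fun _ => 1) h₁ h₂ hne h
  · rw [isign_pos h]
    have hs : ∀ᶠ x in side e x₀, 0 < κ * c.sideSign 1 u₀ * (x - x₀) * (E ⬝ᵥ c.lift u₀) := by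
      filter_upwards [eventually_side_pos e x₀] with x hpos
      have := mul_pos hpos h
      have e1 : e * (x - x₀) * (e * (κ * c.sideSign 1 u₀ * (E ⬝ᵥ c.lift u₀))) =
        (e * e) * (κ * c.sideSign 1 u₀ * (x - x₀) * (E ⬝ᵥ c.lift u₀)) := by ring
      rwa [e1, mul_self_of_sign he, one_mul] at this
    filter_upwards [c.tangent_window_none hf (E := fun _ => E) tendsto_const_nhds (Eventually.of_forall hD) hs]
      with δ hδ
    filter_upwards [hδ] with x hx
    exact finsum_window_zero fun u hu hz => absurd hz (hx u hu)

end ClosedCurve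

/-- The pencil of lines spanned by the lines `e ℓ` (at `x = 0`) and `T` (at `x = 1`). -/
def pencil (ℓ T : Fin 3 → ℝ) (e x : ℝ) : Fin 3 → ℝ := (1 - x) • (e • ℓ) + x • T

theorem pencil_dot (ℓ T : Fin 3 → ℝ) (e x : ℝ) (w : Fin 3 → ℝ) :
    pencil ℓ T e x ⬝ᵥ w = (1 - x) * (e * (ℓ ⬝ᵥ w)) + x * (T ⬝ᵥ w) := by
  simp [pencil, add_dotProduct, smul_dotProduct]

theorem pencil_eq_add (ℓ T : Fin 3 → ℝ) (e x₀ x : ℝ) :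
    pencil ℓ T e x = pencil ℓ T e x₀ + (x - x₀) • (T - e • ℓ) := by
  unfold pencil
  module

theorem continuous_pencil (ℓ T : Fin 3 → ℝ) (e : ℝ) : Continuous (pencil ℓ T e) := by
  unfold pencil
  fun_prop

theorem tendsto_pencil (ℓ T : Fin 3 → ℝ) (e x₀ e' : ℝ) :
    Tendsto (pencil ℓ T e) (side e' x₀) (𝓝 (pencil ℓ T e x₀)) :=
  ((continuous_pencil ℓ T e).tendsto x₀).mono_left (side_le e' x₀)

/-- The sum over a finite set is the sum over the fibres of a map. -/
theorem finsum_mem_fiberwise {α β : Type*} {P : Set α} (hP : P.Finite) {f : α → β} {S : Set β}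
    (hf : MapsTo f P S) (g : α → ℤ) :
    ∑ᶠ y ∈ S, ∑ᶠ p ∈ {p | p ∈ P ∧ f p = y}, g p = ∑ᶠ p ∈ P, g p := by
  have h1 : ∑ᶠ y ∈ S, ∑ᶠ p ∈ {p | p ∈ P ∧ f p = y}, g p =
      ∑ᶠ y ∈ f '' P, ∑ᶠ p ∈ {p | p ∈ P ∧ f p = y}, g p := by
    refine finsum_mem_inter_support_eq' _ _ _ fun y hy => ⟨fun _ => ?_, fun h => hf.image_subset h⟩
    by_contra hy'
    exact hy (finsum_mem_eq_zero_of_forall_eq_zero fun p hp => absurd ⟨p, hp.1, hp.2⟩ hy')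
  rw [h1, ← finsum_mem_biUnion]
  · refine finsum_mem_congr ?_ fun _ _ => rfl
    ext p
    simp only [mem_iUnion, mem_image, mem_ofPred_eq, exists_prop]
    exact ⟨fun ⟨_, _, h, _⟩ => h, fun h => ⟨f p, ⟨p, h, rfl⟩, h, rfl⟩⟩
  · intro y _ z _ hyz
    exact Set.disjoint_left.2 fun p hp hp' => hyz (hp.2.symm.trans hp'.2)
  · exact hP.image f
  · exact fun y _ => hP.subset fun p hp => hp.1

theorem finsum_mem_const_one {α : Type*} {s : Set α} (hs : s.Finite) : ∑ᶠ _a ∈ s, (1 : ℤ) = s.ncard := by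
  rw [finsum_mem_eq_finite_toFinset_sum _ hs, Set.ncard_eq_toFinset_card _ hs]
  simp

theorem finsum_mem_ite {α : Type*} (s : Set α) (c : α → Prop) [DecidablePred c] (g : α → ℤ) :
    ∑ᶠ u ∈ s, (if c u then g u else 0) = ∑ᶠ u ∈ {u | u ∈ s ∧ c u}, g u :=
  finsum_congr fun u => by by_cases h1 : u ∈ s <;> by_cases h2 : c u <;> simp [h1, h2]

section Curve

variable {ι : Type*} {C : ι → ClosedCurve} {L : Line}

theorem zeroSet_smul (C : ι → ClosedCurve) {a : ℝ} (ha : a ≠ 0) (d : Fin 3 → ℝ) :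
    zeroSet C (a • d) = zeroSet C d := by
  ext p
  simp [zeroSet, smul_dotProduct, ha]

theorem pencil_ne_zero (hL : IsGenericallyTransverse C L) {q : ι × ℝ} (hq : q ∈ normalization ι)
    (h0 : L.rep ⬝ᵥ (C q.1).lift q.2 = 0) {e x : ℝ} (he : e = 1 ∨ e = -1) (hx : x ≠ 1) :
    pencil L.rep ((C q.1).tvec q.2) e x ⬝ᵥ deriv (C q.1).lift q.2 ≠ 0 := by
  have he0 : e ≠ 0 := by rcases he with rfl | rfl <;> norm_num
  rw [pencil_dot, ClosedCurve.tvec_dot_deriv, mul_zero, add_zero]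
  exact mul_ne_zero (sub_ne_zero.2 hx.symm) (mul_ne_zero he0 (deriv_ne_zero_at_infinity hL hq h0))

open Classical in
/-- The jump of the number of intersections in the pencil at a line tangent at `u`. -/
theorem exists_pencil_values (hL : IsGenericallyTransverse C L) {q : ι × ℝ} (hq : q ∈ normalization ι)
    (h0 : L.rep ⬝ᵥ (C q.1).lift q.2 = 0) {e x : ℝ} (he : e = 1 ∨ e = -1) (hx : x ∈ Ioo (0 : ℝ) 1) {p : ι × ℝ}
    (hp : p ∈ zeroSet C (pencil L.rep ((C q.1).tvec q.2) e x)) : ∃ v : ℝ → ℤ,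
      (∀ e' : ℝ, e' = 1 ∨ e' = -1 → (C p.1).HasLocalSum (side e' x) (pencil L.rep ((C q.1).tvec q.2) e)
        (fun _ _ => 1) p.2 (v e')) ∧
      v 1 - v (-1) = if pencil L.rep ((C q.1).tvec q.2) e x ⬝ᵥ deriv (C p.1).lift p.2 = 0 ∧
        L.rep ⬝ᵥ (C p.1).lift p.2 ≠ 0 then 2 * asymptoteSign C L.rep p q else 0 := by
  obtain ⟨hpN, hz⟩ := hp
  set ℓ := L.rep
  set T := (C q.1).tvec q.2 with hT
  have he0 : e ≠ 0 := by rcases he with rfl | rfl <;> norm_num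
  have hx0 : x ≠ 0 := hx.1.ne'
  by_cases hz' : pencil ℓ T e x ⬝ᵥ deriv (C p.1).lift p.2 = 0
  swap
  · exact ⟨fun _ => 1, fun e' _ => (C p.1).hasLocalSum_of_transverse (tendsto_pencil ℓ T e x e') hz hz',
      by simp [hz']⟩
  obtain ⟨κ, hκT⟩ : ∃ κ, pencil ℓ T e x = κ • (C p.1).tvec p.2 := ⟨_, (C p.1).eq_smul_tvec hz hz'⟩
  have hne := pencil_ne_zero hL hq h0 he hx.2.ne
  have hκ : κ ≠ 0 := by
    rintro rfl
    rw [hκT] at hne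
    simp at hne
  have hTq : (C p.1).tvec p.2 ⬝ᵥ (C q.1).lift q.2 = 0 := by
    have := congrArg (fun d => d ⬝ᵥ (C q.1).lift q.2) hκT
    simp only [pencil_dot, smul_dotProduct, h0, hT, ClosedCurve.tvec_dot_lift, mul_zero, add_zero,
      smul_eq_mul] at this
    exact (mul_eq_zero.1 this.symm).resolve_left hκ
  have hf := not_isFlex_of_infinity hL hpN hq hTq h0
  have hzp := hz
  rw [pencil_dot] at hzp
  have hzp' := hz'
  rw [pencil_dot] at hzp'
  by_cases hl : ℓ ⬝ᵥ (C p.1).lift p.2 = 0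
  -- Here `p` and `q` are the two branches of a node at infinity, and all lines of the pencil pass through `p`.
  · refine ⟨fun _ => 2, fun e' _ => ?_, by simp [hl]⟩
    refine (C p.1).hasLocalSum_of_pencil hf hκ (by rw [← hκT]; exact tendsto_pencil ℓ T e x e')
      (Eventually.of_forall fun y => ?_) ?_
    · rw [hl, mul_zero, mul_zero, zero_add] at hzp
      rw [pencil_dot, hl, (mul_eq_zero.1 hzp).resolve_left hx0]
      ring
    · filter_upwards [eventually_side_pos e' x] with y hy
      have hyx : y - x ≠ 0 := by intro h; rw [h, mul_zero] at hy; exact lt_irrefl _ hy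
      rw [pencil_eq_add ℓ T e x, add_dotProduct, hz', zero_add, smul_dotProduct, smul_eq_mul]
      refine mul_ne_zero hyx fun h => ?_
      rw [sub_dotProduct, smul_dotProduct, smul_eq_mul, sub_eq_zero] at h
      rw [h] at hzp'
      have : e * (ℓ ⬝ᵥ deriv (C p.1).lift p.2) = 0 := by linarith
      exact (mul_ne_zero he0 (deriv_ne_zero_at_infinity hL hpN hl)) this
  · have hE : x * ((T - e • ℓ) ⬝ᵥ (C p.1).lift p.2) = -(e * (ℓ ⬝ᵥ (C p.1).lift p.2)) := by
      rw [sub_dotProduct, smul_dotProduct, smul_eq_mul]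
      linarith
    have hE0 : (T - e • ℓ) ⬝ᵥ (C p.1).lift p.2 ≠ 0 := by
      intro h
      rw [h, mul_zero, eq_comm, neg_eq_zero] at hE
      exact mul_ne_zero he0 hl hE
    refine ⟨_, fun e' he' => (C p.1).hasLocalSum_of_tangent hf hκ
      (fun y => by rw [pencil_eq_add ℓ T e x, hκT]) hE0 he', ?_⟩
    have hν : (C p.1).sideSign 1 p.2 ≠ 0 := by
      rcases ((C p.1).sideSign_spec p.2 (Or.inl rfl)).1 with h | h <;> rw [h] <;> norm_num
    have hdq : κ * ((C p.1).tvec p.2 ⬝ᵥ deriv (C q.1).lift q.2) = (1 - x) * (e * (ℓ ⬝ᵥ deriv (C q.1).lift q.2)) := by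
      have := congrArg (fun d => d ⬝ᵥ deriv (C q.1).lift q.2) hκT
      simp only [pencil_dot, smul_dotProduct, hT, ClosedCurve.tvec_dot_deriv, mul_zero, add_zero,
        smul_eq_mul] at this
      exact this.symm
    have hℓq := deriv_ne_zero_at_infinity hL hq h0
    have key : asymptoteSign C ℓ p q = -isign (κ * (C p.1).sideSign 1 p.2 * ((T - e • ℓ) ⬝ᵥ (C p.1).lift p.2)) := by
      rw [asymptoteSign, ← isign_opp]
      refine isign_eq_of_mul_pos (pos_of_mul_pos_right (a := x) ?_ hx.1.le)
      set ν := (C p.1).sideSign 1 p.2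
      set lp := ℓ ⬝ᵥ (C p.1).lift p.2
      set lq := ℓ ⬝ᵥ deriv (C q.1).lift q.2
      have e1 : x * (ν * lp * lq * ((C p.1).tvec p.2 ⬝ᵥ deriv (C q.1).lift q.2) *
          -(κ * ν * ((T - e • ℓ) ⬝ᵥ (C p.1).lift p.2))) = (1 - x) * (ν * lp * lq * e) ^ 2 := by
        linear_combination (-(ν ^ 2 * lp * lq * κ * ((C p.1).tvec p.2 ⬝ᵥ deriv (C q.1).lift q.2))) * hE +
          (ν ^ 2 * lp ^ 2 * lq * e) * hdq
      rw [e1]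
      have : 0 < 1 - x := sub_pos.2 hx.2
      positivity
    rw [if_pos ⟨hz', hl⟩, key, one_mul, neg_one_mul, isign_opp]
    ring

open Classical in
/-- The number of intersections in the pencil goes from that with `ℓ` to that with `T`, plus one for the
intersection which merges with the point of tangency of `T`. -/
theorem sum_pencil_jumps [Finite ι] (hL : IsGenericallyTransverse C L) {q : ι × ℝ} (hq : q ∈ normalization ι)
    (h0 : L.rep ⬝ᵥ (C q.1).lift q.2 = 0) {e : ℝ} (he : e = 1 ∨ e = -1) :
    ∑ᶠ x ∈ Ioo (0 : ℝ) 1, ∑ᶠ p ∈ zeroSet C (pencil L.rep ((C q.1).tvec q.2) e x),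
      (if pencil L.rep ((C q.1).tvec q.2) e x ⬝ᵥ deriv (C p.1).lift p.2 = 0 ∧
        L.rep ⬝ᵥ (C p.1).lift p.2 ≠ 0 then 2 * asymptoteSign C L.rep p q else 0) =
      (zeroSet C ((C q.1).tvec q.2)).ncard + 1 - (zeroSet C L.rep).ncard := by
  set ℓ := L.rep with hℓ
  set T := (C q.1).tvec q.2 with hT
  set J : ℝ → ι × ℝ → ℤ := fun x p => if pencil ℓ T e x ⬝ᵥ deriv (C p.1).lift p.2 = 0 ∧
    ℓ ⬝ᵥ (C p.1).lift p.2 ≠ 0 then 2 * asymptoteSign C ℓ p q else 0 with hJ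
  have he0 : e ≠ 0 := by rcases he with rfl | rfl <;> norm_num
  have hℓ0 : ℓ ≠ 0 := L.rep_nonzero
  have hT0 : T ≠ 0 := (C q.1).tvec_ne_zero q.2
  have hp0 : pencil ℓ T e 0 = e • ℓ := by simp [pencil]
  have hp1 : pencil ℓ T e 1 = T := by simp [pencil]
  have hpne : ∀ x, pencil ℓ T e x ≠ 0 := by
    intro x
    by_cases hx : x = 1
    · rw [hx, hp1]; exact hT0
    · intro h
      have := pencil_ne_zero hL hq h0 he hx
      rw [← hℓ, ← hT, h] at this
      simp at this
  set f : ℝ → ℤ := fun x => ∑ᶠ p ∈ zeroSet C (pencil ℓ T e x), (1 : ℤ) with hf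
  have hloc : ∀ {x e' : ℝ} {v : ι × ℝ → ℤ}, (∀ p ∈ zeroSet C (pencil ℓ T e x),
      (C p.1).HasLocalSum (side e' x) (pencil ℓ T e) (fun _ _ => 1) p.2 (v p)) →
      ∀ᶠ y in side e' x, f y = ∑ᶠ p ∈ zeroSet C (pencil ℓ T e x), v p := by
    intro x e' v h
    exact sum_zeroSet_eventually C (hpne x) (tendsto_pencil ℓ T e x e') (w := fun _ _ => 1)
      (fun _ _ _ => rfl) h
  have hmid : ∀ x, ∃ r l : ℤ, x ∈ Ioo (0 : ℝ) 1 → (∀ᶠ y in 𝓝[>] x, f y = r) ∧ (∀ᶠ y in 𝓝[<] x, f y = l) ∧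
      ∑ᶠ p ∈ zeroSet C (pencil ℓ T e x), J x p = r - l := by
    intro x
    by_cases hx : x ∈ Ioo (0 : ℝ) 1
    · have hex : ∀ p, ∃ v : ℝ → ℤ, p ∈ zeroSet C (pencil ℓ T e x) →
          (∀ e' : ℝ, e' = 1 ∨ e' = -1 → (C p.1).HasLocalSum (side e' x) (pencil ℓ T e)
            (fun _ _ => 1) p.2 (v e')) ∧ v 1 - v (-1) = J x p := by
        intro p
        by_cases hp : p ∈ zeroSet C (pencil ℓ T e x)
        · obtain ⟨v, h⟩ := exists_pencil_values hL hq h0 he hx hp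
          exact ⟨v, fun _ => h⟩
        · exact ⟨fun _ => 0, fun h => absurd h hp⟩
      choose v hv using hex
      refine ⟨∑ᶠ p ∈ zeroSet C (pencil ℓ T e x), v p 1, ∑ᶠ p ∈ zeroSet C (pencil ℓ T e x), v p (-1),
        fun _ => ⟨?_, ?_, ?_⟩⟩
      · rw [← side_one]; exact hloc fun p hp => (hv p hp).1 1 (Or.inl rfl)
      · rw [← side_neg_one]; exact hloc fun p hp => (hv p hp).1 (-1) (Or.inr rfl)
      · rw [← finsum_mem_sub_distrib _ _ (finite_zeroSet C (hpne x))]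
        exact finsum_mem_congr rfl fun p hp => (hv p hp).2.symm
    · exact ⟨0, 0, fun h => absurd h hx⟩
  choose r l hrl using hmid
  have hstart : ∀ᶠ y in 𝓝[>] (0 : ℝ), f y = (zeroSet C ℓ).ncard := by
    have : ∀ p ∈ zeroSet C (pencil ℓ T e 0),
        (C p.1).HasLocalSum (side 1 0) (pencil ℓ T e) (fun _ _ => 1) p.2 1 := by
      intro p hp
      refine (C p.1).hasLocalSum_of_transverse (tendsto_pencil ℓ T e 0 1) hp.2 ?_
      rw [hp0, zeroSet_smul C he0] at hp
      rw [hp0, smul_dotProduct]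
      exact smul_ne_zero he0 (deriv_ne_zero_at_infinity hL hp.1 hp.2)
    have := hloc (v := fun _ => 1) this
    rw [side_one, finsum_mem_const_one (finite_zeroSet C (hpne 0)), hp0, zeroSet_smul C he0] at this
    exact this
  have hend : ∀ᶠ y in 𝓝[<] (1 : ℝ), f y = (zeroSet C T).ncard + 1 := by
    -- All intersections with `T` other than `q` are transverse, since no bitangent passes through `q`.
    have : ∀ p ∈ zeroSet C (pencil ℓ T e 1), (C p.1).HasLocalSum (side (-1) 1) (pencil ℓ T e)
        (fun _ _ => 1) p.2 (1 + if p = q then 1 else 0) := by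
      intro p hp
      by_cases hpq : p = q
      · subst hpq
        rw [if_pos rfl, one_add_one_eq_two]
        refine (C p.1).hasLocalSum_of_pencil (κ := 1) (not_isFlex_of_infinity hL hq hq
          ((C p.1).tvec_dot_lift p.2) h0) one_ne_zero ?_ (Eventually.of_forall fun y => ?_) ?_
        · have := tendsto_pencil ℓ T e 1 (-1)
          rw [hp1] at this
          rwa [one_smul]
        · rw [pencil_dot, h0, hT, ClosedCurve.tvec_dot_lift]; ring
        · filter_upwards [eventually_side_pos (-1) 1] with y hy
          exact pencil_ne_zero hL hq h0 he (by linarith)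
      · rw [if_neg hpq, add_zero]
        refine (C p.1).hasLocalSum_of_transverse (tendsto_pencil ℓ T e 1 (-1)) hp.2 ?_
        rw [hp1] at hp ⊢
        intro h
        exact (ne_zero_of_bitangent hL hq hp.1 (Ne.symm hpq) ((tangentAt_eq_iff_deriv C hp.2).2 h)).1 h0
    have := hloc this
    rw [side_neg_one, hp1, finsum_mem_add_distrib (finite_zeroSet C hT0),
      finsum_mem_const_one (finite_zeroSet C hT0), finsum_mem_ite] at this
    have hset : {p | p ∈ zeroSet C T ∧ p = q} = {q} := by
      ext p
      constructor
      · exact fun h => h.2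
      · rintro rfl; exact ⟨⟨hq, (C p.1).tvec_dot_lift p.2⟩, rfl⟩
    rw [hset, finsum_mem_singleton] at this
    exact this
  -- The limits at the ends of the interval replace the values of `r` at `0` and of `l` at `1`.
  obtain ⟨-, hsum⟩ := sum_jumps (f := f) (r := Function.update r 0 (zeroSet C ℓ).ncard)
    (l := Function.update l 1 ((zeroSet C T).ncard + 1)) zero_lt_one
    (fun x hx => by
      rcases hx.1.eq_or_lt with rfl | h
      · rw [Function.update_self]; exact hstart
      · rw [Function.update_of_ne h.ne']; exact (hrl x ⟨h, hx.2⟩).1)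
    (fun x hx => by
      rcases hx.2.eq_or_lt with rfl | h
      · rw [Function.update_self]; exact hend
      · rw [Function.update_of_ne h.ne]; exact (hrl x ⟨hx.1, h⟩).2.1)
  rw [Function.update_self, Function.update_self] at hsum
  rw [← hsum]
  refine finsum_mem_congr rfl fun x hx => ?_
  rw [Function.update_of_ne hx.1.ne', Function.update_of_ne hx.2.ne, ← (hrl x hx).2.2]

/-- The points of the curve, not at infinity, whose tangents pass through the point `q`. -/
def tangentsThrough (C : ι → ClosedCurve) (ℓ : Fin 3 → ℝ) (q : ι × ℝ) : Set (ι × ℝ) :=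
  {p | p ∈ normalization ι ∧ ℓ ⬝ᵥ (C p.1).lift p.2 ≠ 0 ∧ (C p.1).tvec p.2 ⬝ᵥ (C q.1).lift q.2 = 0}

/-- Each such tangent occurs in one of the two halves `y.1 = ±1` of the pencil. -/
theorem exists_pencil_eq (hL : IsGenericallyTransverse C L) {p q : ι × ℝ} (hq : q ∈ normalization ι)
    (h0 : L.rep ⬝ᵥ (C q.1).lift q.2 = 0) (hp : p ∈ tangentsThrough C L.rep q) :
    ∃ y : ℝ × ℝ, (y.1 = 1 ∨ y.1 = -1) ∧ y.2 ∈ Ioo (0 : ℝ) 1 ∧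
      ∃ κ : ℝ, κ ≠ 0 ∧ pencil L.rep ((C q.1).tvec q.2) y.1 y.2 = κ • (C p.1).tvec p.2 := by
  obtain ⟨hpN, hl, hpq⟩ := hp
  have hℓ' := deriv_ne_zero_at_infinity hL hq h0
  -- The tangent at `p` is `a ℓ + b T`, with nonzero coefficients.
  set a := ((C p.1).tvec p.2 ⬝ᵥ deriv (C q.1).lift q.2) / (L.rep ⬝ᵥ deriv (C q.1).lift q.2) with ha
  obtain ⟨b, hb⟩ : ∃ b, (C p.1).tvec p.2 - a • L.rep = b • (C q.1).tvec q.2 := by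
    refine ⟨_, (C q.1).eq_smul_tvec ?_ ?_⟩
    · rw [sub_dotProduct, hpq, smul_dotProduct, h0, smul_zero, sub_zero]
    · rw [sub_dotProduct, smul_dotProduct, smul_eq_mul, ha, div_mul_cancel₀ _ hℓ', sub_self]
  have hne : p ≠ q := by rintro rfl; exact hl h0
  have ha0 : a ≠ 0 := by
    intro h
    have h' : (C p.1).tvec p.2 ⬝ᵥ deriv (C q.1).lift q.2 = 0 := by
      rw [ha, div_eq_zero_iff] at h
      exact h.resolve_right hℓ'
    exact (ne_zero_of_bitangent hL hpN hq hne ((tangentAt_eq_iff_deriv C hpq).2 h')).2 h0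
  have hb0 : b ≠ 0 := by
    rintro rfl
    rw [zero_smul, sub_eq_zero] at hb
    have := (C p.1).tvec_dot_lift p.2
    rw [hb, smul_dotProduct, smul_eq_mul] at this
    exact mul_ne_zero ha0 hl this
  have hTp : (C p.1).tvec p.2 = a • L.rep + b • (C q.1).tvec q.2 := by rw [← hb]; abel
  have hsum : 0 < |a| + |b| := by positivity
  refine ⟨(SignType.sign (a * b), |b| / (|a| + |b|)), ?_, ⟨by positivity, ?_⟩,
    |b| / b / (|a| + |b|), by positivity, ?_⟩
  · rcases lt_or_gt_of_ne (mul_ne_zero ha0 hb0) with h | h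
    · simp [sign_neg h]
    · simp [sign_pos h]
  · rw [div_lt_one hsum]
    linarith [abs_pos.2 ha0]
  · rw [hTp, pencil, smul_add, smul_smul, smul_smul, smul_smul]
    have e1 : (1 - |b| / (|a| + |b|)) * (SignType.sign (a * b) : ℝ) = |b| / b / (|a| + |b|) * a := by
      rw [one_sub_div hsum.ne', add_sub_cancel_right, sign_mul]
      push_cast
      have h1 : (SignType.sign a : ℝ) * |a| = a := sign_mul_abs a
      have h2 : |b| / b = (SignType.sign b : ℝ) := by
        rw [div_eq_iff hb0, sign_mul_self]
      rw [h2]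
      field_simp
      linear_combination (SignType.sign b : ℝ) * h1
    have e2 : |b| / (|a| + |b|) = |b| / b / (|a| + |b|) * b := by field_simp
    rw [e1, ← e2]

/-- A line occurs at most once in the two halves of the pencil. -/
theorem pencil_unique (hL : IsGenericallyTransverse C L) {q : ι × ℝ} (hq : q ∈ normalization ι)
    (h0 : L.rep ⬝ᵥ (C q.1).lift q.2 = 0) {S : Fin 3 → ℝ} {y z : ℝ × ℝ}
    (hy : (y.1 = 1 ∨ y.1 = -1) ∧ y.2 ∈ Ioo (0 : ℝ) 1 ∧
      ∃ κ : ℝ, κ ≠ 0 ∧ pencil L.rep ((C q.1).tvec q.2) y.1 y.2 = κ • S)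
    (hz : (z.1 = 1 ∨ z.1 = -1) ∧ z.2 ∈ Ioo (0 : ℝ) 1 ∧
      ∃ κ : ℝ, κ ≠ 0 ∧ pencil L.rep ((C q.1).tvec q.2) z.1 z.2 = κ • S) : y = z := by
  obtain ⟨e, x⟩ := y
  obtain ⟨e', x'⟩ := z
  obtain ⟨he, ⟨hx0, hx1⟩, κ, hκ, h⟩ := hy
  obtain ⟨he', ⟨hx0', hx1'⟩, κ', hκ', h'⟩ := hz
  simp only at he he' hx0 hx1 hx0' hx1' h h'
  have hℓ' := deriv_ne_zero_at_infinity hL hq h0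
  have hdot : ∀ w, κ' * ((1 - x) * (e * (L.rep ⬝ᵥ w)) + x * ((C q.1).tvec q.2 ⬝ᵥ w)) =
      κ * ((1 - x') * (e' * (L.rep ⬝ᵥ w)) + x' * ((C q.1).tvec q.2 ⬝ᵥ w)) := by
    intro w
    rw [← pencil_dot, ← pencil_dot, h, h', smul_dotProduct, smul_dotProduct, smul_eq_mul, smul_eq_mul]
    ring
  have h1 : κ' * ((1 - x) * e) = κ * ((1 - x') * e') := by
    have := hdot (deriv (C q.1).lift q.2)
    rw [ClosedCurve.tvec_dot_deriv] at this
    refine mul_right_cancel₀ hℓ' ?_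
    linear_combination this
  have h2 : κ' * x = κ * x' := by
    refine mul_right_cancel₀ (dot_self_pos ((C q.1).tvec_ne_zero q.2)).ne' ?_
    linear_combination hdot ((C q.1).tvec q.2) - (L.rep ⬝ᵥ (C q.1).tvec q.2) * h1
  have h3 : (1 - x) * e * x' = (1 - x') * e' * x := by
    refine mul_left_cancel₀ (mul_ne_zero hκ hκ') ?_
    linear_combination (κ * x') * h1 - κ * (1 - x') * e' * h2
  have p1 := mul_pos (sub_pos.2 hx1) hx0'
  have p2 := mul_pos (sub_pos.2 hx1') hx0
  rcases he with rfl | rfl <;> rcases he' with rfl | rfl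
  · exact Prod.ext rfl (by simp only; linarith)
  · exfalso; linarith
  · exfalso; linarith
  · exact Prod.ext rfl (by simp only; linarith)

theorem finite_tangentsThrough [Finite ι] (hC : IsGeneric C) (hL : IsGenericallyTransverse C L) {q : ι × ℝ}
    (hq : q ∈ normalization ι) (h0 : L.rep ⬝ᵥ (C q.1).lift q.2 = 0) : (tangentsThrough C L.rep q).Finite := by
  refine ((finite_specialPairs hC hL).image Prod.fst).subset fun p hp => ⟨(p, q), ⟨hp.1, ⟨hq, hp.2.2⟩, ?_,
    Or.inr (Or.inr (Or.inr h0))⟩, rfl⟩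
  exact fun h : p = q => hp.2.1 (h ▸ h0)

/-- The signed number of tangents through a point `q` at infinity. -/
theorem sum_asymptoteSign [Finite ι] (hC : IsGeneric C) (hL : IsGenericallyTransverse C L) {q : ι × ℝ}
    (hq : q ∈ normalization ι) (h0 : L.rep ⬝ᵥ (C q.1).lift q.2 = 0) :
    ∑ᶠ p ∈ tangentsThrough C L.rep q, asymptoteSign C L.rep p q =
      (zeroSet C ((C q.1).tvec q.2)).ncard + 1 - (zeroSet C L.rep).ncard := by
  classical
  set P := tangentsThrough C L.rep q with hP
  have hPfin : P.Finite := finite_tangentsThrough hC hL hq h0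
  have hex : ∀ p, ∃ y : ℝ × ℝ, p ∈ P → ((y.1 = 1 ∨ y.1 = -1) ∧ y.2 ∈ Ioo (0 : ℝ) 1 ∧
      ∃ κ : ℝ, κ ≠ 0 ∧ pencil L.rep ((C q.1).tvec q.2) y.1 y.2 = κ • (C p.1).tvec p.2) := by
    intro p
    by_cases hp : p ∈ P
    · obtain ⟨y, h⟩ := exists_pencil_eq hL hq h0 hp
      exact ⟨y, fun _ => h⟩
    · exact ⟨0, fun h => absurd h hp⟩
  choose y hy using hex
  have key : ∀ e : ℝ, e = 1 ∨ e = -1 → ∑ᶠ p ∈ {p | p ∈ P ∧ (y p).1 = e}, 2 * asymptoteSign C L.rep p q =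
      (zeroSet C ((C q.1).tvec q.2)).ncard + 1 - (zeroSet C L.rep).ncard := by
    intro e he
    rw [← sum_pencil_jumps hL hq h0 he, ← finsum_mem_fiberwise (S := Ioo (0 : ℝ) 1) (f := fun p => (y p).2)
      (hPfin.subset fun p hp => hp.1) fun p hp => (hy p hp.1).2.1]
    refine finsum_mem_congr rfl fun x hx => ?_
    rw [finsum_mem_ite]
    refine finsum_mem_congr ?_ fun _ _ => rfl
    ext p
    constructor
    · rintro ⟨⟨hp, rfl⟩, rfl⟩
      obtain ⟨-, -, κ, hκ, h⟩ := hy p hp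
      refine ⟨⟨hp.1, ?_⟩, ?_, hp.2.1⟩
      · rw [h, smul_dotProduct, ClosedCurve.tvec_dot_lift, smul_zero]
      · rw [h, smul_dotProduct, ClosedCurve.tvec_dot_deriv, smul_zero]
    · rintro ⟨⟨hpN, hz⟩, hz', hl⟩
      have hne := pencil_ne_zero hL hq h0 he hx.2.ne
      have hκT := (C p.1).eq_smul_tvec hz hz'
      set κ := (pencil L.rep ((C q.1).tvec q.2) e x ⬝ᵥ (C p.1).tvec p.2) / ((C p.1).tvec p.2 ⬝ᵥ (C p.1).tvec p.2)
      have hκ : κ ≠ 0 := by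
        intro h
        rw [hκT, h] at hne
        simp at hne
      have hTq : (C p.1).tvec p.2 ⬝ᵥ (C q.1).lift q.2 = 0 := by
        have := congrArg (fun d => d ⬝ᵥ (C q.1).lift q.2) hκT
        simp only [pencil_dot, smul_dotProduct, h0, ClosedCurve.tvec_dot_lift, mul_zero, add_zero,
          smul_eq_mul] at this
        exact (mul_eq_zero.1 this.symm).resolve_left hκ
      have hpP : p ∈ P := ⟨hpN, hl, hTq⟩
      have := pencil_unique hL hq h0 (z := (e, x)) (hy p hpP) ⟨he, hx, κ, hκ, hκT⟩
      exact ⟨⟨hpP, congrArg Prod.fst this⟩, congrArg Prod.snd this⟩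
  have h1 := finsum_mem_fiberwise hPfin (S := {(1 : ℝ), -1}) (f := fun p => (y p).1)
    (fun p hp => by simpa using (hy p hp).1) fun p => 2 * asymptoteSign C L.rep p q
  rw [finsum_mem_pair (by norm_num), key 1 (Or.inl rfl), key (-1) (Or.inr rfl)] at h1
  rw [← mul_finsum_mem' _ _ hPfin] at h1
  linarith

end Curve

/-! ### Pairs of points with the same image -/

/-- The ordered pairs of distinct points of `N` with the same image under `φ`. -/
def doublePairs {α β : Type*} (N : Set α) (φ : α → β) : Set (α × α) :=
  {x | x.1 ∈ N ∧ x.2 ∈ N ∧ x.1 ≠ x.2 ∧ φ x.1 = φ x.2}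

section Pairs

variable {α β : Type*} {N : Set α} {φ : α → β}
  (h3 : ∀ p ∈ N, ∀ q ∈ N, ∀ r ∈ N, p ≠ q → p ≠ r → q ≠ r → φ p = φ q → φ p ≠ φ r)

include h3 in
theorem doublePairs_unique {x y : α × α} (hx : x ∈ doublePairs N φ) (hy : y ∈ doublePairs N φ)
    (h : φ x.1 = φ y.1) : y = x ∨ y = (x.2, x.1) := by
  obtain ⟨p, q⟩ := x
  obtain ⟨p', q'⟩ := y
  obtain ⟨hp, hq, hne, he⟩ := hx
  obtain ⟨hp', hq', hne', he'⟩ := hy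
  simp only at *
  have key : ∀ r ∈ N, φ p = φ r → r = p ∨ r = q := by
    intro r hr hφ
    by_contra! hcon
    exact h3 p hp q hq r hr hne hcon.1.symm hcon.2.symm he hφ
  rcases key p' hp' h with rfl | rfl <;> rcases key q' hq' (h.trans he') with rfl | rfl
  · exact absurd rfl hne'
  · exact Or.inl rfl
  · exact Or.inr rfl
  · exact absurd rfl hne'

include h3 in
/-- If no three points have the same image, each double value comes from exactly two ordered pairs. -/
theorem finsum_doublePairs (hfin : (doublePairs N φ).Finite) {w : α × α → ℤ} {W : β → ℤ}
    (hw : ∀ x ∈ doublePairs N φ, w x = W (φ x.1)) : ∑ᶠ x ∈ doublePairs N φ, w x =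
      2 * ∑ᶠ y ∈ (fun x => φ x.1) '' doublePairs N φ, W y := by
  rw [← finsum_mem_fiberwise hfin (mapsTo_image (fun x : α × α => φ x.1) _), mul_finsum_mem]
  refine finsum_mem_congr rfl ?_
  rintro _ ⟨x, hx, rfl⟩
  have hswap : (x.2, x.1) ∈ doublePairs N φ := ⟨hx.2.1, hx.1, hx.2.2.1.symm, hx.2.2.2.symm⟩
  have hset : {y | y ∈ doublePairs N φ ∧ φ y.1 = φ x.1} = {x, (x.2, x.1)} := by
    ext y
    constructor
    · exact fun hy => doublePairs_unique h3 hx hy.1 hy.2.symm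
    · rintro (rfl | rfl)
      · exact ⟨hx, rfl⟩
      · exact ⟨hswap, hx.2.2.2.symm⟩
  rw [hset, finsum_mem_pair, hw _ hx, hw _ hswap, ← hx.2.2.2]
  · ring
  · exact fun h => hx.2.2.1 (congrArg Prod.fst h)

end Pairs

/-! ### The two types of bitangents -/

theorem ClosedCurve.eventually_affineEq (c : ClosedCurve) {L D : Line} {t a : ℝ} (hf : ¬ c.IsFlex t)
    (ha : a ≠ 0) (hD : D.rep = a • c.tvec t) (hl : L.rep ⬝ᵥ c.lift t ≠ 0) :
    ∀ᶠ u in 𝓝[≠] t, 0 < a * c.sideSign 1 t * (L.rep ⬝ᵥ c.lift t) * affineEq L D (c.lift u) := by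
  have h1 : ∀ᶠ u in 𝓝[≠] t, 0 < c.sideSign 1 t * (c.tvec t ⬝ᵥ c.lift u) := by
    refine eventually_ne_of_side fun e he => ?_
    have := c.eventually_side_sideSign t he
    rw [c.sideSign_eq hf he] at this
    exact this.mono fun u hu => hu.1
  have h2 : ∀ᶠ u in 𝓝[≠] t, 0 < (L.rep ⬝ᵥ c.lift t) * (L.rep ⬝ᵥ c.lift u) :=
    (((c.tendsto_dot_lift L.rep t).const_mul _).eventually (lt_mem_nhds (mul_self_pos.2 hl))).filter_mono
      nhdsWithin_le_nhds
  filter_upwards [h1, h2] with u h1 h2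
  have hu : L.rep ⬝ᵥ c.lift u ≠ 0 := by
    intro h
    rw [h, mul_zero] at h2
    exact lt_irrefl _ h2
  have e : a * c.sideSign 1 t * (L.rep ⬝ᵥ c.lift t) * affineEq L D (c.lift u) =
      (a / (L.rep ⬝ᵥ c.lift u)) ^ 2 * ((c.sideSign 1 t * (c.tvec t ⬝ᵥ c.lift u)) *
        ((L.rep ⬝ᵥ c.lift t) * (L.rep ⬝ᵥ c.lift u))) := by
    rw [affineEq, hD, smul_dotProduct, smul_eq_mul]
    field_simp
  rw [e]
  positivity

theorem ClosedCurve.positiveNear_iff (c : ClosedCurve) {L D : Line} {t a : ℝ} (hf : ¬ c.IsFlex t)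
    (ha : a ≠ 0) (hD : D.rep = a • c.tvec t) (hl : L.rep ⬝ᵥ c.lift t ≠ 0) :
    PositiveNear L D c t ↔ 0 < a * c.sideSign 1 t * (L.rep ⬝ᵥ c.lift t) := by
  have h := c.eventually_affineEq hf ha hD hl
  constructor
  · intro hp
    obtain ⟨u, h1, h2⟩ := (h.and hp).exists
    exact pos_of_mul_pos_left h1 h2.le
  · exact fun hp => h.mono fun u hu => pos_of_mul_pos_right hu hp.le

theorem ClosedCurve.negativeNear_iff (c : ClosedCurve) {L D : Line} {t a : ℝ} (hf : ¬ c.IsFlex t)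
    (ha : a ≠ 0) (hD : D.rep = a • c.tvec t) (hl : L.rep ⬝ᵥ c.lift t ≠ 0) :
    NegativeNear L D c t ↔ a * c.sideSign 1 t * (L.rep ⬝ᵥ c.lift t) < 0 := by
  have h := c.eventually_affineEq hf ha hD hl
  constructor
  · intro hp
    obtain ⟨u, h1, h2⟩ := (h.and hp).exists
    exact neg_of_mul_pos_left h1 h2.le
  · exact fun hp => h.mono fun u hu => neg_of_mul_pos_right hu hp.le

section Curve

variable {ι : Type*} {C : ι → ClosedCurve} {L : Line}

theorem bitangentSign_comm (C : ι → ClosedCurve) (ℓ : Fin 3 → ℝ) (p q : ι × ℝ) :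
    bitangentSign C ℓ p q = bitangentSign C ℓ q p := by
  unfold bitangentSign
  rw [dotProduct_comm ((C p.1).tvec p.2)]
  congr 1
  ring

/-- The sides of a bitangent on which the curve lies near its two points of tangency are the signs of two
numbers, whose product has the sign `bitangentSign`. -/
theorem exists_sides (hC : IsGeneric C) (hL : IsGenericallyTransverse C L) {p q : ι × ℝ}
    (h : (p, q) ∈ doublePairs (normalization ι) (tangentAt C)) : ∃ A B : ℝ, A ≠ 0 ∧ B ≠ 0 ∧
      (PositiveNear L (tangentAt C p) (C p.1) p.2 ↔ 0 < A) ∧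
      (NegativeNear L (tangentAt C p) (C p.1) p.2 ↔ A < 0) ∧
      (PositiveNear L (tangentAt C p) (C q.1) q.2 ↔ 0 < B) ∧
      (NegativeNear L (tangentAt C p) (C q.1) q.2 ↔ B < 0) ∧ bitangentSign C L.rep p q = isign (A * B) := by
  obtain ⟨hp, hq, hne, hT⟩ := h
  simp only at hp hq hne hT
  have hfp : ¬ (C p.1).IsFlex p.2 := fun hf => hC.flex_tangent p ⟨hp, hf⟩ q hq hne hT
  have hfq : ¬ (C q.1).IsFlex q.2 := fun hf => hC.flex_tangent q ⟨hq, hf⟩ p hp hne.symm hT.symm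
  obtain ⟨hlp, hlq⟩ := ne_zero_of_bitangent hL hp hq hne hT
  obtain ⟨a, ha, hrep⟩ := (C p.1).exists_tangent_rep p.2
  obtain ⟨κ, hκ, hκT⟩ := (tangentAt_eq_iff C p q).1 hT
  have hrep : (tangentAt C p).rep = a • (C p.1).tvec p.2 := hrep
  have hrep' : (tangentAt C p).rep = (a * κ) • (C q.1).tvec q.2 := by rw [hrep, hκT, smul_smul]
  have hν : (C p.1).sideSign 1 p.2 ≠ 0 := by
    rcases ((C p.1).sideSign_spec p.2 (Or.inl rfl)).1 with h | h <;> rw [h] <;> norm_num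
  have hν' : (C q.1).sideSign 1 q.2 ≠ 0 := by
    rcases ((C q.1).sideSign_spec q.2 (Or.inl rfl)).1 with h | h <;> rw [h] <;> norm_num
  refine ⟨_, _, by positivity, by positivity, (C p.1).positiveNear_iff hfp ha hrep hlp,
    (C p.1).negativeNear_iff hfp ha hrep hlp, (C q.1).positiveNear_iff hfq (mul_ne_zero ha hκ) hrep' hlq,
    (C q.1).negativeNear_iff hfq (mul_ne_zero ha hκ) hrep' hlq, isign_eq_of_mul_pos ?_⟩
  rw [hκT, smul_dotProduct, smul_eq_mul]
  have hn := dot_self_pos ((C q.1).tvec_ne_zero q.2)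
  generalize (C q.1).tvec q.2 ⬝ᵥ (C q.1).tvec q.2 = n at hn
  generalize (C p.1).sideSign 1 p.2 = ν at hν
  generalize (C q.1).sideSign 1 q.2 = ν' at hν'
  generalize L.rep ⬝ᵥ (C p.1).lift p.2 = x at hlp
  generalize L.rep ⬝ᵥ (C q.1).lift q.2 = y at hlq
  have e : ν * ν' * (κ * n) * x * y * (a * ν * x * (a * κ * ν' * y)) = n * (a * κ * ν * ν' * x * y) ^ 2 := by
    ring
  rw [e]
  positivity

theorem mem_bitangents_iff (D : Line) : D ∈ bitangents C ↔
    D ∈ (fun x => tangentAt C x.1) '' doublePairs (normalization ι) (tangentAt C) := by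
  constructor
  · rintro ⟨p, hp, q, hq, hne, h1, h2⟩
    exact ⟨(p, q), ⟨hp, hq, hne, h1.trans h2.symm⟩, h1⟩
  · rintro ⟨⟨p, q⟩, ⟨hp, hq, hne, h1⟩, rfl⟩
    exact ⟨p, hp, q, hq, hne, rfl, h1.symm⟩

theorem bitangentSign_eq (hC : IsGeneric C) {p q p' q' : ι × ℝ}
    (h : (p, q) ∈ doublePairs (normalization ι) (tangentAt C))
    (h' : (p', q') ∈ doublePairs (normalization ι) (tangentAt C)) (hT : tangentAt C p = tangentAt C p')
    (ℓ : Fin 3 → ℝ) : bitangentSign C ℓ p' q' = bitangentSign C ℓ p q := by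
  rcases doublePairs_unique hC.no_triple_tangent h h' hT with h | h
  · rw [(Prod.mk.inj h).1, (Prod.mk.inj h).2]
  · rw [(Prod.mk.inj h).1, (Prod.mk.inj h).2, bitangentSign_comm]

theorem mem_exteriorBitangents_iff (hC : IsGeneric C) (hL : IsGenericallyTransverse C L) {p q : ι × ℝ}
    (h : (p, q) ∈ doublePairs (normalization ι) (tangentAt C)) :
    tangentAt C p ∈ exteriorBitangents C L ↔ bitangentSign C L.rep p q = 1 := by
  constructor
  · rintro ⟨p', hp', q', hq', hne, h1, h2, hs⟩
    have h' : (p', q') ∈ doublePairs (normalization ι) (tangentAt C) := ⟨hp', hq', hne, h1.trans h2.symm⟩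
    rw [← bitangentSign_eq hC h h' h1.symm]
    obtain ⟨A, B, hA, hB, pA, nA, pB, nB, hs'⟩ := exists_sides hC hL h'
    rw [h1] at pA nA pB nB
    rw [pA, nA, pB, nB] at hs
    rw [hs', isign_pos]
    rcases hs with ⟨a, b⟩ | ⟨a, b⟩
    · exact mul_pos a b
    · exact mul_pos_of_neg_of_neg a b
  · intro hs
    obtain ⟨A, B, hA, hB, pA, nA, pB, nB, hs'⟩ := exists_sides hC hL h
    refine ⟨p, h.1, q, h.2.1, h.2.2.1, rfl, h.2.2.2.symm, ?_⟩
    rw [pA, nA, pB, nB]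
    rw [hs'] at hs
    by_contra hcon
    have : A * B < 0 := by
      rcases lt_or_gt_of_ne hA with a | a <;> rcases lt_or_gt_of_ne hB with b | b
      · exact absurd (Or.inr ⟨a, b⟩) hcon
      · exact mul_neg_of_neg_of_pos a b
      · exact mul_neg_of_pos_of_neg a b
      · exact absurd (Or.inl ⟨a, b⟩) hcon
    rw [isign_neg this] at hs
    norm_num at hs

theorem mem_interiorBitangents_iff (hC : IsGeneric C) (hL : IsGenericallyTransverse C L) {p q : ι × ℝ}
    (h : (p, q) ∈ doublePairs (normalization ι) (tangentAt C)) :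
    tangentAt C p ∈ interiorBitangents C L ↔ bitangentSign C L.rep p q = -1 := by
  constructor
  · rintro ⟨p', hp', q', hq', hne, h1, h2, hs⟩
    have h' : (p', q') ∈ doublePairs (normalization ι) (tangentAt C) := ⟨hp', hq', hne, h1.trans h2.symm⟩
    rw [← bitangentSign_eq hC h h' h1.symm]
    obtain ⟨A, B, hA, hB, pA, nA, pB, nB, hs'⟩ := exists_sides hC hL h'
    rw [h1] at pA nA pB nB
    rw [pA, nB] at hs
    rw [hs', isign_neg (mul_neg_of_pos_of_neg hs.1 hs.2)]
  · intro hs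
    obtain ⟨A, B, hA, hB, pA, nA, pB, nB, hs'⟩ := exists_sides hC hL h
    rw [hs'] at hs
    rcases lt_or_gt_of_ne hA with a | a <;> rcases lt_or_gt_of_ne hB with b | b
    · rw [isign_pos (mul_pos_of_neg_of_neg a b)] at hs; norm_num at hs
    · exact ⟨q, h.2.1, p, h.1, h.2.2.1.symm, h.2.2.2.symm, rfl, pB.2 b, nA.2 a⟩
    · exact ⟨p, h.1, q, h.2.1, h.2.2.1, rfl, h.2.2.2.symm, pA.2 a, nB.2 b⟩
    · rw [isign_pos (mul_pos a b)] at hs; norm_num at hs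

theorem bitangentSign_cases (hC : IsGeneric C) (hL : IsGenericallyTransverse C L) {p q : ι × ℝ}
    (h : (p, q) ∈ doublePairs (normalization ι) (tangentAt C)) :
    bitangentSign C L.rep p q = 1 ∨ bitangentSign C L.rep p q = -1 := by
  obtain ⟨A, B, hA, hB, -, -, -, -, hs⟩ := exists_sides hC hL h
  rw [hs]
  rcases lt_or_gt_of_ne (mul_ne_zero hA hB) with h | h
  · exact Or.inr (isign_neg h)
  · exact Or.inl (isign_pos h)

/-- Every bitangent is of exactly one of the two types. -/
theorem xor_exterior_interior (hC : IsGeneric C) (hL : IsGenericallyTransverse C L) {D : Line}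
    (hD : D ∈ bitangents C) : Xor (D ∈ exteriorBitangents C L) (D ∈ interiorBitangents C L) := by
  obtain ⟨⟨p, q⟩, h, rfl⟩ := (mem_bitangents_iff D).1 hD
  simp only
  rw [mem_exteriorBitangents_iff hC hL h, mem_interiorBitangents_iff hC hL h]
  rcases bitangentSign_cases hC hL h with h | h
  · exact Or.inl ⟨h, by rw [h]; norm_num⟩
  · exact Or.inr ⟨h, by rw [h]; norm_num⟩

theorem exteriorBitangents_subset : exteriorBitangents C L ⊆ bitangents C := by
  rintro D ⟨p, hp, q, hq, hne, h1, h2, -⟩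
  exact ⟨p, hp, q, hq, hne, h1, h2⟩

theorem interiorBitangents_subset : interiorBitangents C L ⊆ bitangents C := by
  rintro D ⟨p, hp, q, hq, hne, h1, h2, -⟩
  exact ⟨p, hp, q, hq, hne, h1, h2⟩

theorem finite_doublePairs_tangentAt [Finite ι] (hC : IsGeneric C) (hL : IsGenericallyTransverse C L) :
    (doublePairs (normalization ι) (tangentAt C)).Finite :=
  (finite_specialPairs hC hL).subset fun _ h =>
    ⟨h.1, ⟨h.2.1, tvec_dot_eq_zero_of_tangentAt C h.2.2.2⟩, h.2.2.1, Or.inr (Or.inl h.2.2.2)⟩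

theorem finite_doublePairs_pointAt [Finite ι] (hC : IsGeneric C) (hL : IsGenericallyTransverse C L) :
    (doublePairs (normalization ι) (pointAt C)).Finite :=
  (finite_specialPairs hC hL).subset fun _ h =>
    ⟨h.1, ⟨h.2.1, tvec_dot_eq_zero_of_pointAt C h.2.2.2⟩, h.2.2.1, Or.inl h.2.2.2⟩

theorem bitangents_eq : bitangents C =
    (fun x => tangentAt C x.1) '' doublePairs (normalization ι) (tangentAt C) :=
  Set.ext mem_bitangents_iff

theorem nodes_eq : nodes C = (fun x => pointAt C x.1) '' doublePairs (normalization ι) (pointAt C) := by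
  ext x
  constructor
  · rintro ⟨p, hp, q, hq, hne, h1, h2⟩
    exact ⟨(p, q), ⟨hp, hq, hne, h1.trans h2.symm⟩, h1⟩
  · rintro ⟨⟨p, q⟩, ⟨hp, hq, hne, h1⟩, rfl⟩
    exact ⟨p, hp, q, hq, hne, rfl, h1.symm⟩

theorem finite_bitangents [Finite ι] (hC : IsGeneric C) (hL : IsGenericallyTransverse C L) :
    (bitangents C).Finite := by
  rw [bitangents_eq]
  exact (finite_doublePairs_tangentAt hC hL).image _

theorem finite_nodes [Finite ι] (hC : IsGeneric C) (hL : IsGenericallyTransverse C L) :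
    (nodes C).Finite := by
  rw [nodes_eq]
  exact (finite_doublePairs_pointAt hC hL).image _

theorem sum_nodes [Finite ι] (hC : IsGeneric C) (hL : IsGenericallyTransverse C L) :
    ∑ᶠ _x ∈ doublePairs (normalization ι) (pointAt C), (1 : ℤ) = 2 * (nodes C).ncard := by
  rw [finsum_doublePairs hC.no_triple_point (finite_doublePairs_pointAt hC hL) (W := fun _ => 1)
    fun _ _ => rfl, ← nodes_eq, finsum_mem_const_one (finite_nodes hC hL)]

theorem sum_bitangents [Finite ι] (hC : IsGeneric C) (hL : IsGenericallyTransverse C L) :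
    ∑ᶠ x ∈ doublePairs (normalization ι) (tangentAt C), bitangentSign C L.rep x.1 x.2 =
      2 * signedCount C L := by
  classical
  have hfin := finite_bitangents hC hL
  rw [finsum_doublePairs hC.no_triple_tangent (finite_doublePairs_tangentAt hC hL)
    (W := fun D => (if D ∈ exteriorBitangents C L then 1 else 0) -
      (if D ∈ interiorBitangents C L then 1 else 0)), ← bitangents_eq, finsum_mem_sub_distrib _ _ hfin,
    finsum_mem_ite, finsum_mem_ite]
  · have e1 : {D | D ∈ bitangents C ∧ D ∈ exteriorBitangents C L} = exteriorBitangents C L :=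
      inter_eq_right.2 exteriorBitangents_subset
    have e2 : {D | D ∈ bitangents C ∧ D ∈ interiorBitangents C L} = interiorBitangents C L :=
      inter_eq_right.2 interiorBitangents_subset
    rw [e1, e2, finsum_mem_const_one (hfin.subset exteriorBitangents_subset),
      finsum_mem_const_one (hfin.subset interiorBitangents_subset), signedCount]
  · rintro ⟨p, q⟩ h
    simp only [mem_exteriorBitangents_iff hC hL h, mem_interiorBitangents_iff hC hL h]
    rcases bitangentSign_cases hC hL h with h | h <;> rw [h] <;> norm_num

/-! ### The total of all jumps -/

variable (C L) in
/-- The pairs `(p, q)` at which the signed count of the points on the tangents jumps. -/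
def jumpPairs : Set ((ι × ℝ) × (ι × ℝ)) := specialPairs C L ∪ (fun p => (p, p)) '' flexes C

theorem finite_jumpPairs [Finite ι] (hC : IsGeneric C) (hL : IsGenericallyTransverse C L) :
    (jumpPairs C L).Finite :=
  (finite_specialPairs hC hL).union ((finite_flexes).image _)

theorem mem_jumpPairs_of_jump_ne_zero {p q : ι × ℝ} (hp : p ∈ normalization ι)
    (hq : q ∈ zeroSet C ((C p.1).tvec p.2)) (h : jump C L.rep p q ≠ 0) : (p, q) ∈ jumpPairs C L := by
  by_cases hpq : q = p
  · subst hpq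
    by_cases hf : (C q.1).IsFlex q.2
    · exact Or.inr ⟨q, ⟨hp, hf⟩, rfl⟩
    · exact absurd (by simp [jump, hf]) h
  · refine Or.inl ⟨hp, hq, Ne.symm hpq, ?_⟩
    by_contra! hcon
    obtain ⟨h1, h2, h3, h4⟩ := hcon
    exact h (by simp_all [jump])

theorem mem_zeroSet_of_mem_jumpPairs {x : (ι × ℝ) × (ι × ℝ)} (hx : x ∈ jumpPairs C L) :
    x.1 ∈ normalization ι ∧ x.2 ∈ zeroSet C ((C x.1.1).tvec x.1.2) := by
  rcases hx with hx | ⟨p, hp, rfl⟩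
  · exact ⟨hx.1, hx.2.1⟩
  · exact ⟨hp.1, hp.1, (C p.1).tvec_dot_lift p.2⟩

/-- All jumps add up to zero. -/
theorem sum_jumpPairs [Finite ι] (hC : IsGeneric C) (hL : IsGenericallyTransverse C L) :
    ∑ᶠ x ∈ jumpPairs C L, jump C L.rep x.1 x.2 = 0 := by
  have hfin := finite_jumpPairs hC hL
  rw [← finsum_mem_fiberwise hfin (S := univ) (f := fun x => x.1.1) (mapsTo_univ _ _)]
  refine finsum_mem_eq_zero_of_forall_eq_zero fun i _ => ?_
  rw [← sum_jump_component hC hL i, ← finsum_mem_fiberwise (hfin.subset fun x hx => hx.1)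
    (S := Ico (0 : ℝ) 1) (f := fun x => x.1.2) fun x hx => (mem_zeroSet_of_mem_jumpPairs hx.1).1]
  refine finsum_mem_congr rfl fun t ht => ?_
  have hset : {x | x ∈ {x | x ∈ jumpPairs C L ∧ x.1.1 = i} ∧ x.1.2 = t} =
      (fun q => ((i, t), q)) '' {q | ((i, t), q) ∈ jumpPairs C L} := by
    ext x
    constructor
    · rintro ⟨⟨hx, rfl⟩, rfl⟩
      exact ⟨x.2, hx, rfl⟩
    · rintro ⟨q, hq, rfl⟩
      exact ⟨⟨hq, rfl⟩, rfl⟩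
  rw [hset, finsum_mem_image fun _ _ _ _ h => (Prod.mk.inj h).2]
  refine finsum_mem_inter_support_eq' _ _ _ fun q hq => ⟨fun h => (mem_zeroSet_of_mem_jumpPairs h).2, fun h => ?_⟩
  exact mem_jumpPairs_of_jump_ne_zero (p := (i, t)) ht h hq

/-- The jumps caused by points of tangency at infinity. -/
theorem sum_tangency_at_infinity [Finite ι] (hC : IsGeneric C) (hL : IsGenericallyTransverse C L) :
    ∑ᶠ _x ∈ {x | x ∈ jumpPairs C L ∧ x.1 ≠ x.2 ∧ L.rep ⬝ᵥ (C x.1.1).lift x.1.2 = 0}, (2 : ℤ) =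
      ∑ᶠ p ∈ zeroSet C L.rep, 2 * (((zeroSet C ((C p.1).tvec p.2)).ncard : ℤ) - 1) := by
  rw [← finsum_mem_fiberwise ((finite_jumpPairs hC hL).subset fun x hx => hx.1)
    (S := zeroSet C L.rep) (f := Prod.fst) fun x hx => ⟨(mem_zeroSet_of_mem_jumpPairs hx.1).1, hx.2.2⟩]
  refine finsum_mem_congr rfl fun p hp => ?_
  have hset : {x | x ∈ {x | x ∈ jumpPairs C L ∧ x.1 ≠ x.2 ∧ L.rep ⬝ᵥ (C x.1.1).lift x.1.2 = 0} ∧ x.1 = p} =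
      (fun q => (p, q)) '' (zeroSet C ((C p.1).tvec p.2) \ {p}) := by
    ext x
    constructor
    · rintro ⟨⟨hx, hne, -⟩, rfl⟩
      exact ⟨x.2, ⟨(mem_zeroSet_of_mem_jumpPairs hx).2, hne.symm⟩, rfl⟩
    · rintro ⟨q, ⟨hq, hne⟩, rfl⟩
      have hne : p ≠ q := Ne.symm hne
      exact ⟨⟨Or.inl ⟨hp.1, hq, hne, Or.inr (Or.inr (Or.inl hp.2))⟩, hne, hp.2⟩, rfl⟩
  have hfin := finite_zeroSet C ((C p.1).tvec_ne_zero p.2)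
  have hmem : p ∈ zeroSet C ((C p.1).tvec p.2) := ⟨hp.1, (C p.1).tvec_dot_lift p.2⟩
  rw [hset, finsum_mem_image fun _ _ _ _ h => (Prod.mk.inj h).2]
  have h2 : ∑ᶠ _q ∈ zeroSet C ((C p.1).tvec p.2) \ {p}, (2 : ℤ) =
      2 * ∑ᶠ _q ∈ zeroSet C ((C p.1).tvec p.2) \ {p}, (1 : ℤ) := by
    rw [mul_finsum_mem]
    simp
  rw [h2, finsum_mem_const_one (hfin.subset sdiff_subset), ← Set.ncard_sdiff_singleton_add_one hmem hfin]
  push_cast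
  ring

/-- The jumps caused by the points at infinity of the tangents. -/
theorem sum_point_at_infinity [Finite ι] (hC : IsGeneric C) (hL : IsGenericallyTransverse C L) :
    ∑ᶠ x ∈ {x | x ∈ jumpPairs C L ∧ L.rep ⬝ᵥ (C x.2.1).lift x.2.2 = 0 ∧ L.rep ⬝ᵥ (C x.1.1).lift x.1.2 ≠ 0},
      2 * asymptoteSign C L.rep x.1 x.2 = ∑ᶠ q ∈ zeroSet C L.rep,
        2 * (((zeroSet C ((C q.1).tvec q.2)).ncard : ℤ) + 1 - (zeroSet C L.rep).ncard) := by
  rw [← finsum_mem_fiberwise ((finite_jumpPairs hC hL).subset fun x hx => hx.1)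
    (S := zeroSet C L.rep) (f := Prod.snd) fun x hx => ⟨(mem_zeroSet_of_mem_jumpPairs hx.1).2.1, hx.2.1⟩]
  refine finsum_mem_congr rfl fun q hq => ?_
  have hset : {x | x ∈ {x | x ∈ jumpPairs C L ∧ L.rep ⬝ᵥ (C x.2.1).lift x.2.2 = 0 ∧
      L.rep ⬝ᵥ (C x.1.1).lift x.1.2 ≠ 0} ∧ x.2 = q} = (fun p => (p, q)) '' tangentsThrough C L.rep q := by
    ext x
    constructor
    · rintro ⟨⟨hx, h1, h2⟩, rfl⟩
      obtain ⟨h3, h4⟩ := mem_zeroSet_of_mem_jumpPairs hx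
      exact ⟨x.1, ⟨h3, h2, h4.2⟩, rfl⟩
    · rintro ⟨p, ⟨h1, h2, h3⟩, rfl⟩
      have hne : p ≠ q := fun h => h2 (h ▸ hq.2)
      exact ⟨⟨Or.inl ⟨h1, ⟨hq.1, h3⟩, hne, Or.inr (Or.inr (Or.inr hq.2))⟩, hq.2, h2⟩, rfl⟩
  rw [hset, finsum_mem_image fun _ _ _ _ h => (Prod.mk.inj h).1, ← sum_asymptoteSign hC hL hq.1 hq.2,
    mul_finsum_mem]

/-- The sum of all jumps, in terms of the numbers of flexes, nodes, bitangents and intersections. -/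
theorem count_identity [Finite ι] (hC : IsGeneric C) (hL : IsGenericallyTransverse C L) :
    -2 * ((flexes C).ncard : ℤ) - 4 * (nodes C).ncard + 4 * signedCount C L +
      ∑ᶠ p ∈ zeroSet C L.rep, 2 * (((zeroSet C ((C p.1).tvec p.2)).ncard : ℤ) - 1) +
      ∑ᶠ q ∈ zeroSet C L.rep,
        2 * (((zeroSet C ((C q.1).tvec q.2)).ncard : ℤ) + 1 - (zeroSet C L.rep).ncard) = 0 := by
  classical
  have hfin := finite_jumpPairs hC hL
  have h := sum_jumpPairs hC hL
  unfold jump at h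
  rw [finsum_mem_add_distrib hfin, finsum_mem_add_distrib hfin, finsum_mem_add_distrib hfin,
    finsum_mem_add_distrib hfin, finsum_mem_ite, finsum_mem_ite, finsum_mem_ite, finsum_mem_ite,
    finsum_mem_ite, sum_tangency_at_infinity hC hL, sum_point_at_infinity hC hL] at h
  have hconst : ∀ s : Set ((ι × ℝ) × (ι × ℝ)), ∑ᶠ _x ∈ s, (-2 : ℤ) = -2 * ∑ᶠ _x ∈ s, (1 : ℤ) := by
    intro s
    rw [mul_finsum_mem]
    simp
  have s1 : {x | x ∈ jumpPairs C L ∧ x.2 = x.1 ∧ (C x.1.1).IsFlex x.1.2} = (fun p => (p, p)) '' flexes C := by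
    ext x
    constructor
    · rintro ⟨hx, h1, h2⟩
      exact ⟨x.1, ⟨(mem_zeroSet_of_mem_jumpPairs hx).1, h2⟩, Prod.ext rfl h1.symm⟩
    · rintro ⟨p, hp, rfl⟩
      exact ⟨Or.inr ⟨p, hp, rfl⟩, rfl, hp.2⟩
  have s2 : {x | x ∈ jumpPairs C L ∧ x.1 ≠ x.2 ∧ pointAt C x.1 = pointAt C x.2} =
      doublePairs (normalization ι) (pointAt C) := by
    ext x
    constructor
    · rintro ⟨hx, h1, h2⟩
      obtain ⟨h3, h4⟩ := mem_zeroSet_of_mem_jumpPairs hx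
      exact ⟨h3, h4.1, h1, h2⟩
    · rintro ⟨h1, h2, h3, h4⟩
      exact ⟨Or.inl ⟨h1, ⟨h2, tvec_dot_eq_zero_of_pointAt C h4⟩, h3, Or.inl h4⟩, h3, h4⟩
  have s3 : {x | x ∈ jumpPairs C L ∧ x.1 ≠ x.2 ∧ tangentAt C x.1 = tangentAt C x.2} =
      doublePairs (normalization ι) (tangentAt C) := by
    ext x
    constructor
    · rintro ⟨hx, h1, h2⟩
      obtain ⟨h3, h4⟩ := mem_zeroSet_of_mem_jumpPairs hx
      exact ⟨h3, h4.1, h1, h2⟩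
    · rintro ⟨h1, h2, h3, h4⟩
      exact ⟨Or.inl ⟨h1, ⟨h2, tvec_dot_eq_zero_of_tangentAt C h4⟩, h3, Or.inr (Or.inl h4)⟩, h3, h4⟩
  rw [s1, s2, s3, hconst, hconst, finsum_mem_image fun _ _ _ _ h => (Prod.mk.inj h).1,
    finsum_mem_const_one (finite_flexes), sum_nodes hC hL, ← mul_finsum_mem, sum_bitangents hC hL] at h
  linarith

/-- The tangents at infinity correspond to the points at infinity. -/
theorem sum_tangentsAtInfinity [Finite ι] (hL : IsGenericallyTransverse C L) :
    ∑ᶠ T ∈ tangentsAtInfinity C L, (((inter C T).ncard : ℚ) - 1) =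
      ((∑ᶠ p ∈ zeroSet C L.rep, ((zeroSet C ((C p.1).tvec p.2)).ncard : ℤ) : ℤ) : ℚ) -
        (zeroSet C L.rep).ncard := by
  have himg : tangentsAtInfinity C L = tangentAt C '' zeroSet C L.rep := by
    rw [← inter_eq]
    rfl
  have hinj : InjOn (tangentAt C) (zeroSet C L.rep) := by
    intro p hp q hq h
    by_contra hne
    exact (ne_zero_of_bitangent hL hp.1 hq.1 hne h).1 hp.2
  have hfin : (zeroSet C L.rep).Finite := finite_zeroSet C L.rep_nonzero
  rw [himg, finsum_mem_image hinj, finsum_mem_eq_finite_toFinset_sum _ hfin,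
    finsum_mem_eq_finite_toFinset_sum _ hfin, Set.ncard_eq_toFinset_card _ hfin, Finset.sum_sub_distrib]
  push_cast
  simp [inter_tangentAt]

end Curve

end FabriciusBjerre

end

open FabriciusBjerre in
theorem theorem3p2 {ι : Type*} [Finite ι] (C : ι → ClosedCurve) (hC : IsGeneric C)
    (L : Line) (hL : IsGenericallyTransverse C L) :
    (nodes C).Finite ∧ (flexes C).Finite ∧ (bitangents C).Finite ∧ (inter C L).Finite ∧
    (∀ T ∈ tangentsAtInfinity C L, (inter C T).Finite) ∧
    (∀ D ∈ bitangents C, Xor (D ∈ exteriorBitangents C L) (D ∈ interiorBitangents C L)) ∧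
    (signedCount C L : ℚ) =
      ((nodes C).ncard : ℚ) + ((flexes C).ncard : ℚ) / 2
        + ((inter C L).ncard : ℚ) * (((inter C L).ncard : ℚ) - 2) / 2
        - ∑ᶠ T ∈ tangentsAtInfinity C L, (((inter C T).ncard : ℚ) - 1) := by
  have hfin : (zeroSet C L.rep).Finite := finite_zeroSet C L.rep_nonzero
  refine ⟨finite_nodes hC hL, finite_flexes, finite_bitangents hC hL, ?_, ?_,
    fun D hD => xor_exterior_interior hC hL hD, ?_⟩
  · rw [inter_eq]
    exact hfin
  · intro T _
    rw [inter_eq]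
    exact finite_zeroSet C T.rep_nonzero
  · have h := count_identity hC hL
    rw [sum_tangentsAtInfinity hL, inter_eq]
    rw [finsum_mem_eq_finite_toFinset_sum _ hfin, finsum_mem_eq_finite_toFinset_sum _ hfin,
      ← Finset.mul_sum, ← Finset.mul_sum, Finset.sum_sub_distrib, Finset.sum_sub_distrib,
      Finset.sum_add_distrib, Finset.sum_const, Finset.sum_const, ← Set.ncard_eq_toFinset_card _ hfin] at h
    rw [finsum_mem_eq_finite_toFinset_sum _ hfin]
    have h' := congrArg (fun n : ℤ => (n : ℚ)) h
    push_cast [nsmul_eq_mul] at h' ⊢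
    linarith
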